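/- Let $\Gamma_0(N)\le PSL(2,\mathbb Z)$ act on the upper half plane $\mathbb H$. A *Farey polygon* is a hyperbolic ideal polygon with cusps $0/1=a_1/e_1<\dots<a_s/e_s=1/1$ and $\infty$, where the fractions are reduced, $e_i>0$ and $a_{i+1}e_i-a_ie_{i+1}=1$ for all $i$. Its non-vertical sides are the geodesics from $a_i/e_i$ to $a_{i+1}/e_{i+1}$, denoted $(e_i,e_{i+1})$. A *special polygon of $\Gamma_0(N)$* is a Farey polygon, possibly with special triangles (images under $PSL(2,\mathbb Z)$ of the triangle with vertices $\infty,0,e^{i\pi/3}$) attached outside some sides, that is a fundamental domain of $\Gamma_0(N)$ and has a side pairing by elements of $\Gamma_0(N)$ of the following form: the vertical sides are paired by $z\mapsto z+1$; each other side is either paired with a different side, or mapped to itself by a rotation of order two about one of its points, or carries a special triangle, whose two remaining sides are paired by a rotation of order three. The sequence $\{e_i\}$ is called a *Farey sequence of $\Gamma_0(N)$*. A set $\{g_i\}$ of nontrivial elements is an *independent generating set* of a group if the group is the free product of the cyclic subgroups $\langle g_i\rangle$. **Theorem.** Let $n\ge 2$ and $N=2^n$. There is a special polygon $P$ of $\Gamma_0(N)$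 with denominator sequence $\{e_i\}$ such that 1. every fraction in $[0,1]$ with denominator at most $\lfloor\sqrt N\rfloor$ is a cusp of $P$; the sequence $\{e_i\}$ has $1+\lfloor[PSL(2,\mathbb Z):\Gamma_0(N)]/3\rfloor$ members; and for each side $(a,b)$ with $N\nmid a^2+b^2$ and $N\nmid a^2+ab+b^2$ there is exactly one side $(x,y)$ with $N\mid ax+by$; 2. $e_i\le 2^{n-1}$ for all $i$; 3. $e_j=2^{n-1}$ for exactly one $j$; 4. the side pairings of $P$ (one from each pair of mutually inverse ones) form an independent generating set of $\Gamma_0(N)$; 5. the numerators are determined by the denominators: every special polygon of $\Gamma_0(N)$ with the denominator sequence $\{e_i\}$ has the cusps $\{a_i/e_i\}\cup\{\infty\}$. The bound is optimal: every special polygon of $\Gamma_0(N)$ has a cusp with denominator $e_j\ge 2^{n-1}$. -/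

import Mathlib

open scoped MatrixGroups

/-- A Farey polygon: the hyperbolic ideal polygon with cusps `0 = x₀, x₁, …, x_m = 1` and `∞`, in which
any two consecutive rational cusps are Farey neighbours, that is, `a' e - a e' = 1` for
consecutive reduced fractions `a / e` and `a' / e'`. The case `m = 0` is excluded by the two
conditions on the end points. -/
structure FareyPolygon where
  /-- the number `m` of sides that do not end at `∞` -/
  m : ℕ
  /-- the rational cusps, in order -/
  cusp : Fin (m + 1) → ℚ
  cusp_first : cusp 0 = 0
  cusp_last : cusp (Fin.last m) = 1
  neighbours : ∀ i : Fin m,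
    (cusp i.succ).num * ((cusp i.castSucc).den : ℤ)
      - (cusp i.castSucc).num * ((cusp i.succ).den : ℤ) = 1

/-- The rotation of order three about `exp (iπ/3)`: it maps `0 ↦ 1 ↦ ∞ ↦ 0`. -/
def rotThree : SL(2, ℤ) := ⟨!![0, 1; -1, 1], by simp [Matrix.det_fin_two]⟩

/-- The special triangle with vertices `∞`, `0` and `exp (iπ/3)`; its sides lie on the geodesics
`Re z = 0`, `Re z = 1/2` and `|z - 1| = 1`. -/
def specialTriangle : Set UpperHalfPlane :=
  {z | 0 ≤ z.re ∧ z.re ≤ 1 / 2 ∧ 1 ≤ (z.re - 1) ^ 2 + z.im ^ 2}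

namespace FareyPolygon

variable (F : FareyPolygon)

/-- The denominator `e_i` of the `i`-th rational cusp. -/
def denom (i : Fin (F.m + 1)) : ℕ := (F.cusp i).den

/-- The rational cusps as a list. -/
def cuspList : List ℚ := List.ofFn F.cusp

/-- The denominator sequence `e_0, …, e_m` of the cusps as a list. -/
def denomList : List ℕ := List.ofFn F.denom

/-- The element of the modular group that maps the geodesic from `0` to `∞` to the `i`-th side,
the geodesic from `x_i` to `x_{i+1}`. -/
def sideMat (i : Fin F.m) : SL(2, ℤ) :=
  ⟨!![(F.cusp i.succ).num, (F.cusp i.castSucc).num;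
      ((F.cusp i.succ).den : ℤ), ((F.cusp i.castSucc).den : ℤ)], by
    rw [Matrix.det_fin_two_of]
    exact F.neighbours i⟩

/-- The element of the modular group (unique up to sign) that maps the `i`-th side to the `j`-th
side with the orientation reversed: `x_i ↦ x_{j+1}` and `x_{i+1} ↦ x_j`. For `i = j` it is the
rotation of order two about a point of the side. -/
def glue (i j : Fin F.m) : SL(2, ℤ) := F.sideMat j * ModularGroup.S * (F.sideMat i)⁻¹

/-- The rotation of order three about the third vertex of the special triangle attached to the
outside of the `i`-th side. It maps one of the two free sides of this triangle to the other. -/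
def rot (i : Fin F.m) : SL(2, ℤ) := F.sideMat i * rotThree * (F.sideMat i)⁻¹

/-- The ideal polygon with cusps `x₀, …, x_m, ∞`: the part of the strip `0 ≤ Re z ≤ 1` on and
above the semicircles with end points `x_i` and `x_{i+1}`. -/
def idealPolygon : Set UpperHalfPlane :=
  {z | 0 ≤ z.re ∧ z.re ≤ 1 ∧ ∀ i : Fin F.m,
    0 ≤ (z.re - (F.cusp i.castSucc : ℝ)) * (z.re - (F.cusp i.succ : ℝ)) + z.im ^ 2}

/-- The ideal polygon with special triangles attached to the outside of the sides in `odd`. -/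
def region (odd : Finset (Fin F.m)) : Set UpperHalfPlane :=
  F.idealPolygon ∪ ⋃ i ∈ odd, (fun z => F.sideMat i • z) '' specialTriangle

/-- The sides `(a, b) = (e_i, e_{i+1})` and `(x, y) = (e_j, e_{j+1})` are paired modulo `N`:
`N ∣ a x + b y`. -/
def IsPaired (N : ℕ) (i j : Fin F.m) : Prop :=
  N ∣ F.denom i.castSucc * F.denom j.castSucc + F.denom i.succ * F.denom j.succ

/-- The side `(a, b) = (e_i, e_{i+1})` is elliptic modulo `N`: it is even, `N ∣ a² + b²`, or odd,
`N ∣ a² + a b + b²`. -/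
def IsElliptic (N : ℕ) (i : Fin F.m) : Prop :=
  N ∣ F.denom i.castSucc ^ 2 + F.denom i.succ ^ 2 ∨
    N ∣ F.denom i.castSucc ^ 2 + F.denom i.castSucc * F.denom i.succ + F.denom i.succ ^ 2

/-- The combinatorial conditions for the denominators to be a Farey sequence of `Γ₀(N)`: all
fractions in `[0, 1]` with denominator at most `⌊√N⌋` occur among the cusps, the number of terms is
`1 + ⌊[PSL(2, ℤ) : Γ₀(N)] / 3⌋`, and every non-elliptic side has exactly one partner. (The index is
the same in `SL(2, ℤ)`, because `-1 ∈ Γ₀(N)`.) -/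
def IsFareySequenceOf (N : ℕ) : Prop :=
  (∀ q : ℚ, 0 ≤ q → q ≤ 1 → q.den ≤ Nat.sqrt N → ∃ i, F.cusp i = q) ∧
  F.m + 1 = 1 + (CongruenceSubgroup.Gamma0 N).index / 3 ∧
  ∀ i : Fin F.m, ¬ F.IsElliptic N i → ∃! j : Fin F.m, F.IsPaired N i j

end FareyPolygon

/-- `D` is a (closed) fundamental domain for the action of `Γ` on the upper half plane: its
translates cover, and a nontrivial translate of its interior is disjoint from the interior.
The elements `1` and `-1` act trivially. -/
def IsFundamentalRegion (Γ : Subgroup SL(2, ℤ)) (D : Set UpperHalfPlane) : Prop :=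
  IsClosed D ∧ (∀ z : UpperHalfPlane, ∃ γ ∈ Γ, γ • z ∈ D) ∧
    ∀ γ ∈ Γ, γ ≠ 1 → γ ≠ -1 → ∀ z ∈ interior D, γ • z ∉ interior D

/-- A special polygon of `Γ₀(N)`: a Farey polygon with special triangles attached to its odd sides
and with a side pairing by elements of `Γ₀(N)`, which is a fundamental domain of `Γ₀(N)`.
The two vertical sides are paired with each other by `z ↦ z + 1`. Each other side is either
* paired with a different side (`pair i ≠ i`), or
* even (`pair i = i`, not in `odd`): it is turned over by a rotation of order two, or
* odd (`pair i = i`, in `odd`): a special triangle is attached, whose free sides are paired by a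
  rotation of order three. -/
structure SpecialPolygon (N : ℕ) extends FareyPolygon where
  pair : Fin m → Fin m
  pair_pair : ∀ i, pair (pair i) = i
  odd : Finset (Fin m)
  pair_odd : ∀ i ∈ odd, pair i = i
  glue_mem : ∀ i, i ∉ odd → toFareyPolygon.glue i (pair i) ∈ CongruenceSubgroup.Gamma0 N
  rot_mem : ∀ i ∈ odd, toFareyPolygon.rot i ∈ CongruenceSubgroup.Gamma0 N
  fundamental : IsFundamentalRegion (CongruenceSubgroup.Gamma0 N) (toFareyPolygon.region odd)

/-- The modular group `PSL(2, ℤ)`. -/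
abbrev ModGroup : Type := Matrix.ProjectiveSpecialLinearGroup (Fin 2) ℤ

/-- The projection `SL(2, ℤ) → PSL(2, ℤ)`. -/
def toModGroup : SL(2, ℤ) →* ModGroup := QuotientGroup.mk' (Subgroup.center SL(2, ℤ))

/-- `Γ₀(N)` as a subgroup of `PSL(2, ℤ)`. -/
def gammaZero (N : ℕ) : Subgroup ModGroup := (CongruenceSubgroup.Gamma0 N).map toModGroup

namespace SpecialPolygon

variable {N : ℕ} (P : SpecialPolygon N)

/-- The side pairing that belongs to the `i`-th side. -/
def sidePairing (i : Fin P.m) : SL(2, ℤ) :=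
  if i ∈ P.odd then P.rot i else P.glue i (P.pair i)

/-- The side pairings in `PSL(2, ℤ)`: the pairing `z ↦ z + 1` of the vertical sides, and
one side pairing for each elliptic side and for each pair of two different paired sides (the other
side of the pair has the inverse element). -/
def sidePairings : Option {i : Fin P.m // i ≤ P.pair i} → ModGroup
  | none => toModGroup ModularGroup.T
  | some i => toModGroup (P.sidePairing i.1)

end SpecialPolygon

/-- The family `g` is an independent set of generators of the subgroup `H`: no `g i` is trivial and
`H` is the free product of the cyclic subgroups generated by the `g i`. -/
def IsIndependentGenerators {G ι : Type*} [Group G] (g : ι → G) (H : Subgroup G) : Prop :=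
  (∀ i, g i ≠ 1) ∧
  Function.Injective
    (Monoid.CoprodI.lift fun i => (Subgroup.zpowers (g i)).subtype :
      Monoid.CoprodI (fun i => Subgroup.zpowers (g i)) →* G) ∧
  (Monoid.CoprodI.lift fun i => (Subgroup.zpowers (g i)).subtype :
      Monoid.CoprodI (fun i => Subgroup.zpowers (g i)) →* G).range = H

/-! A matrix `X` stands for the oriented geodesic `X (0, ∞)` and for the Farey triangle `X (0, 1,
∞)`, whose oriented edges are `X * R ^ k`. Its right coset modulo `Γ₀(N)` depends only on the bottom
row `(c, d)`, or on the lattice of all `(p, q)` with `N ∣ p d - q c`. As `N` is even, `c² + c d +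
d²` is odd, so the three edges of a triangle lie in different cosets; as `4 ∣ N`, no edge is turned
over by a half turn. So an ideal polygon dissected into pairwise inequivalent Farey triangles is a
fundamental domain as soon as the triangle outside each of its sides is equivalent to one inside.

Such a polygon is grown from the triangle `0, 1, ∞`: add all triangles with denominators at most
`√N`, then inequivalent triangles with denominators at most `N / 2` for as long as possible. The
core is that nothing is missing at the end (`represented_of_maximal`).

Suppose the coset of a side with row `(c, d)` is missing. Its lattice has no vector outside `2 ℤ²`
of hexagonal norm at most `√N`: divided by its odd gcd, such a vector would be the row of a small
triangle, and these are all present. Descent through parent triangles to the `√N` stage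
(`hasEvenPartner`) yields an even lattice vector that spans with `(c, d)` a parallelogram of area
`N`: either `c y + d x = N` (growing), or `c y - d x = ±N` with `x, y < √N` (bounded). Since `c + d
> N / 2` and `x, y ≥ 2`, the growing shape is impossible. The bounded shape propagates from `g` to
`g * T`: the new coset is missing too, since otherwise a missing side would supply a second even
vector, and half a difference of the two would be too short (`not_noShort_of_two_even`); and `(x, x
+ y)` is bounded again (`add_sq_lt_of_noShort`). Iteration makes `y` exceed `√N`, a contradiction.

Once every side is represented, the sides are glued in pairs. The translates of the triangles cover
the plane (`reachedBy`), and ping-pong with the disjoint half-planes outside the sides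
(`glueSides_ping_pong`) gives both the free product and the disjointness of translates. For
optimality, a translate of the geodesic from `0` to `1 / 2ⁿ⁻¹` meets any special polygon, which
forces a cusp whose denominator is divisible by `2ⁿ⁻¹`. -/

open scoped MatrixGroups
open ModularGroup (S T)
open CongruenceSubgroup (Gamma0)

/-! ### Short vectors in the lattice of a coset -/

/-- Every vector of the lattice `{(p, q) | N ∣ p d - q c}` outside `2 ℤ²` has hexagonal norm
`max |p| |q| |p + q|` greater than `√N`. -/
def NoShort (N c d : ℤ) : Prop :=
  ∀ p q : ℤ, N ∣ p * d - q * c → ¬ (2 ∣ p ∧ 2 ∣ q) → N < p ^ 2 ∨ N < q ^ 2 ∨ N < (p + q) ^ 2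

/-- The map `(p, q) ↦ (p + q, -p)` permutes `|p|, |q|, |p + q|` and carries the lattice of `(-d, c +
d)` to that of `(c, d)`. This is the rotation of a triangle. -/
theorem NoShort.rotate {N c d : ℤ} (h : NoShort N c d) : NoShort N (-d) (c + d) := by
  intro p q hpq hodd
  have h1 := h (p + q) (-p) (by convert hpq using 1; ring) (by
    rintro ⟨h1, h2⟩
    exact hodd ⟨by omega, by omega⟩)
  have e : p + q + -p = q := by omega
  rw [e, neg_sq] at h1
  tauto

theorem NoShort.swap {N c d : ℤ} (h : NoShort N c d) : NoShort N d c := by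
  intro p q hpq hodd
  have h1 := h q p (by rw [show q * d - p * c = -(p * c - q * d) by ring, dvd_neg]; exact hpq) (by tauto)
  rw [add_comm q p] at h1
  tauto

section Real

theorem sq_lt_iff_sqrt_lt_abs {N p : ℤ} (hN : 0 ≤ N) : N < p ^ 2 ↔ √(N : ℝ) < |(p : ℝ)| := by
  rw [← Real.sqrt_sq_eq_abs, Real.sqrt_lt_sqrt_iff (by exact_mod_cast hN)]
  exact_mod_cast Iff.rfl

theorem lt_sq_iff_abs_lt_sqrt {N p : ℤ} : p ^ 2 < N ↔ |(p : ℝ)| < √(N : ℝ) := by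
  rw [← Real.sqrt_sq_eq_abs, Real.sqrt_lt_sqrt_iff (sq_nonneg _)]
  exact_mod_cast Iff.rfl

/-- The last hypothesis says that `(p, -q) + (x, y)` is not short. Its second coordinate is small,
so `p + x` must exceed `s`, and the area equation then confines `p` and `q - p`. The short vector
`(p, p - q)` will lie in the lattice of the neighbouring coset. -/
theorem short_of_growing {s x y p q : ℝ} (hx : 0 < x) (hy : 0 < y) (hxs : x < s) (hys : y < s)
    (hxy : s ≤ x + y) (hN : p * y + q * x = s ^ 2) (hq1 : s < q) (hq2 : q ≤ s + y)
    (h : s < |p + x| ∨ s < |-(q - y)| ∨ s < |p + x + -(q - y)|) :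
    |p| ≤ s ∧ |p - q| ≤ s ∧ |p + (p - q)| ≤ s := by
  have hs : 0 < s := hx.trans hxs
  have hp0 : 0 < p + x := by
    have : 0 < (p + x) * y := by nlinarith
    exact pos_of_mul_pos_left this hy.le
  have hq0 : 0 < q - y := by linarith
  have hp1 : s < p + x := by
    rcases h with h | h | h
    · rwa [abs_of_pos hp0] at h
    · rw [abs_neg, abs_of_pos hq0] at h; linarith
    · rcases lt_abs.1 h with h | h <;> linarith
  have hp2 : p < s := by
    have : p * y < s * y := by nlinarith
    exact lt_of_mul_lt_mul_right this hy.le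
  have hqp : q - p ≤ s := by
    have : (q - p) * x ≤ s * x := by nlinarith [mul_nonneg (sub_nonneg.2 hxs.le) (sub_nonneg.2 hxy)]
    exact le_of_mul_le_mul_right this hx
  refine ⟨abs_le.2 ⟨by linarith, by linarith⟩, abs_le.2 ⟨by linarith, by linarith⟩,
    abs_le.2 ⟨by linarith, by linarith⟩⟩

/-- The vector `(x, -y) - (a, b)` is not short, and since `x` lies within `a` of `s` only `y + b`
can make it long. The remaining bounds come from the area equation `a y + b x = s²`. -/
theorem bounds_of_farey_side {s a b x y : ℝ} (ha : 0 < a) (hb : 0 < b) (has : a ≤ s) (hbs : b ≤ s)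
    (hab : s < a + b) (hN : a * y + b * x = s ^ 2) (hx1 : s - a < x) (hx2 : x ≤ s + a)
    (h : s < |x - a| ∨ s < |-(y + b)| ∨ s < |x - a + -(y + b)|) :
    s - b < y ∧ |x - y| < s ∧ (x < s ∨ y < s) := by
  have hs : 0 < s := ha.trans_le has
  have hyb : 0 ≤ y + b := by
    have : 0 ≤ (y + b) * a := by nlinarith
    exact nonneg_of_mul_nonneg_left this ha
  have key : s < y + b := by
    rcases h with h | h | h
    · rcases lt_abs.1 h with h | h <;> linarith
    · rwa [abs_neg, abs_of_nonneg hyb] at h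
    · rcases lt_abs.1 h with h | h
      · linarith
      · by_cases hxa : 0 ≤ x - a
        · linarith
        · have : s * a < (y + b) * a := by nlinarith
          exact lt_of_mul_lt_mul_right this ha.le
  refine ⟨by linarith, abs_lt.2 ⟨?_, ?_⟩, ?_⟩
  · have : (y - x) * a < s * a := by
      nlinarith [mul_nonneg (sub_nonneg.2 has) (sub_nonneg.2 hab.le)]
    have := lt_of_mul_lt_mul_right this ha.le
    linarith
  · have : (x - y) * b < s * b := by
      nlinarith [mul_nonneg (sub_nonneg.2 hbs) (sub_nonneg.2 hab.le)]
    have := lt_of_mul_lt_mul_right this hb.le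
    linarith
  · by_contra hcon
    push Not at hcon
    nlinarith

end Real

/-! ### Even vectors of the lattice -/

/-- Modulo two the lattice is the line spanned by the nonzero vector `(c, d)`, which has just two
points. -/
theorem exists_even_of_line {c d p q : ℤ} (hN : (2 : ℤ) ∣ p * d - q * c) (hcd : IsCoprime c d) :
    (2 ∣ p ∧ 2 ∣ q) ∨ (2 ∣ p - c ∧ 2 ∣ q - d) := by
  obtain ⟨u, v, huv⟩ := hcd
  rcases Int.even_or_odd' p with ⟨p', rfl | rfl⟩ <;> rcases Int.even_or_odd' q with ⟨q', rfl | rfl⟩ <;>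
  rcases Int.even_or_odd' c with ⟨c', rfl | rfl⟩ <;> rcases Int.even_or_odd' d with ⟨d', rfl | rfl⟩ <;>
  rcases Int.even_or_odd' u with ⟨u', rfl | rfl⟩ <;> rcases Int.even_or_odd' v with ⟨v', rfl | rfl⟩ <;>
  ring_nf at hN huv ⊢ <;> omega

/-- The outer triangle of a side with denominators `r₂, r₁` sees an even vector `(x, ∓y)` of its
lattice that spans, together with `(r₁, r₂)`, a parallelogram of area `N`. -/
def HasEvenPartner (N r₁ r₂ : ℤ) : Prop :=
  ∃ x y : ℤ, 2 ∣ x ∧ 2 ∣ y ∧ 0 < x ∧ 0 < y ∧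
    ((r₁ * y + r₂ * x = N ∧ (x - y) ^ 2 < N ∧ (x ^ 2 < N ∨ y ^ 2 < N)) ∨
      ((r₁ * y - r₂ * x = N ∨ r₁ * y - r₂ * x = -N) ∧ x ^ 2 < N ∧ y ^ 2 < N))

theorem HasEvenPartner.swap {N r₁ r₂ : ℤ} (h : HasEvenPartner N r₁ r₂) :
    HasEvenPartner N r₂ r₁ := by
  obtain ⟨x, y, hx, hy, hx0, hy0, ⟨h1, h2, h3⟩ | ⟨h1, h2, h3⟩⟩ := h
  · exact ⟨y, x, hy, hx, hy0, hx0, Or.inl ⟨by linarith, by nlinarith, h3.symm⟩⟩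
  · refine ⟨y, x, hy, hx, hy0, hx0, Or.inr ⟨?_, h3, h2⟩⟩
    rcases h1 with h1 | h1
    · right; linarith
    · left; linarith

/-- Start of the descent. The solutions of `a y + b x = N` form a line with step `(a, -b)`, and
every second one is even. -/
theorem hasEvenPartner_of_farey_side {N a b : ℤ} (h2 : 2 ∣ N) (ha : 0 < a) (hb : 0 < b)
    (haN : a ^ 2 ≤ N) (hbN : b ^ 2 ≤ N) (hab : N < (a + b) ^ 2) (hcop : IsCoprime a b)
    (hns : NoShort N a b) : HasEvenPartner N a b := by
  have hN : 0 < N := lt_of_lt_of_le (by positivity) haN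
  have hs2 : √(N : ℝ) ^ 2 = N := Real.sq_sqrt (by exact_mod_cast hN.le)
  have haR : (0 : ℝ) < a := by exact_mod_cast ha
  have hbR : (0 : ℝ) < b := by exact_mod_cast hb
  obtain ⟨x₀, y₀, h0, hx0, hy0⟩ : ∃ x y : ℤ, a * y + b * x = N ∧ 2 ∣ x ∧ 2 ∣ y := by
    obtain ⟨u, v, huv⟩ := hcop
    have e : a * (u * N) + b * (v * N) = N := by linear_combination N * huv
    rcases exists_even_of_line (p := v * N) (q := -(u * N)) (c := a) (d := b)
      (by rw [show v * N * b - -(u * N) * a = N by linarith]; exact h2) ⟨u, v, huv⟩ with h | h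
    · exact ⟨v * N, u * N, e, h.1, (dvd_neg.1 h.2)⟩
    · refine ⟨v * N - a, u * N + b, by linarith, h.1, ?_⟩
      rw [show u * N + b = -(-(u * N) - b) by ring, dvd_neg]; exact h.2
  -- Steps that preserve parity have length `2a` in `x`, so `x` can be placed in the window `(√N -
  -- a, √N + a]`.
  obtain ⟨k, hk, -⟩ := existsUnique_add_zsmul_mem_Ioc (show (0 : ℝ) < 2 * a by positivity) x₀
    (√N - a)
  rw [zsmul_eq_mul] at hk
  set x := x₀ + k * (2 * a) with hx
  set y := y₀ - k * (2 * b) with hy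
  have hxy : a * y + b * x = N := by rw [hx, hy]; linarith
  have hex : 2 ∣ x := dvd_add hx0 ⟨k * a, by ring⟩
  have hey : 2 ∣ y := dvd_sub hy0 ⟨k * b, by ring⟩
  have hodd := hns (x - a) (-(y + b)) ⟨1, by linarith⟩ (by
    rintro ⟨h1, h3⟩
    rw [dvd_neg] at h3
    have h4 : (2 : ℤ) ∣ a := by omega
    have h5 : (2 : ℤ) ∣ b := by omega
    have := hcop.isUnit_of_dvd' h4 h5
    rw [Int.isUnit_iff] at this
    omega)
  rw [sq_lt_iff_sqrt_lt_abs hN.le, sq_lt_iff_sqrt_lt_abs hN.le, sq_lt_iff_sqrt_lt_abs hN.le] at hodd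
  push_cast at hodd
  have has : (a : ℝ) ≤ √N := Real.le_sqrt_of_sq_le (by exact_mod_cast haN)
  have hbs : (b : ℝ) ≤ √N := Real.le_sqrt_of_sq_le (by exact_mod_cast hbN)
  have habs : √(N : ℝ) < a + b := by
    rw [Real.sqrt_lt' (by positivity)]; exact_mod_cast hab
  have hx1 : √(N : ℝ) - a < x := by rw [hx]; push_cast; exact hk.1
  have hx2 : (x : ℝ) ≤ √N + a := by
    rw [hx]; push_cast; linarith [hk.2]
  obtain ⟨h3, h4, h5⟩ := bounds_of_farey_side haR hbR has hbs habs
    (by rw [hs2]; exact_mod_cast hxy) hx1 hx2 hodd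
  have hxp : (0 : ℝ) < x := by linarith
  have hyp : (0 : ℝ) < y := by linarith
  refine ⟨x, y, hex, hey, by exact_mod_cast hxp, by exact_mod_cast hyp, Or.inl ⟨hxy, ?_, ?_⟩⟩
  · rw [lt_sq_iff_abs_lt_sqrt]; exact_mod_cast h4
  · rw [lt_sq_iff_abs_lt_sqrt, lt_sq_iff_abs_lt_sqrt, abs_of_pos hxp, abs_of_pos hyp]; exact h5

/-- An even vector `(x, y)` stays bounded when sheared to `(x, x + y)`. If `x + y` were at least
`√N`, translating `v` by a multiple of `(x, y)` would give `(p, -q)` with `√N < q ≤ √N + y`; by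
`short_of_growing`, `(p, p - q)` would be a short vector outside `2 ℤ²` in the lattice of `(c, c +
d)`. -/
theorem add_sq_lt_of_noShort {N c d x y v₁ v₂ : ℤ} (h1 : NoShort N c d) (h2 : NoShort N c (c + d))
    (hx : 2 ∣ x) (hy : 2 ∣ y) (hx0 : 0 < x) (hy0 : 0 < y) (hxN : x ^ 2 < N) (hyN : y ^ 2 < N)
    (hD : N ∣ x * d - y * c) (hv : N ∣ v₁ * d - v₂ * c) (hodd : ¬ (2 ∣ v₁ ∧ 2 ∣ v₂))
    (hN : v₁ * y - v₂ * x = N ∨ v₁ * y - v₂ * x = -N) : (x + y) ^ 2 < N := by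
  wlog hN' : v₁ * y - v₂ * x = N generalizing v₁ v₂
  · refine this (v₁ := -v₁) (v₂ := -v₂) ?_ ?_ ?_ ?_
    · rw [show -v₁ * d - -v₂ * c = -(v₁ * d - v₂ * c) by ring, dvd_neg]; exact hv
    · rwa [dvd_neg, dvd_neg]
    · left
      rcases hN with hN | hN
      · exact absurd hN hN'
      · linarith
    · rcases hN with hN | hN
      · exact absurd hN hN'
      · linarith
  have hNp : 0 < N := lt_of_le_of_lt (by positivity) hxN
  have hs2 : √(N : ℝ) ^ 2 = N := Real.sq_sqrt (by exact_mod_cast hNp.le)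
  by_contra hcon
  push Not at hcon
  have hxR : (0 : ℝ) < x := by exact_mod_cast hx0
  have hyR : (0 : ℝ) < y := by exact_mod_cast hy0
  obtain ⟨k, hk, -⟩ := existsUnique_add_zsmul_mem_Ioc hyR (-v₂ : ℝ) (√N)
  rw [zsmul_eq_mul] at hk
  set q := -v₂ + k * y with hq
  set p := v₁ - k * x with hp
  have hpq : p * y + q * x = N := by rw [hq, hp]; linarith
  have hmem : N ∣ p * d + q * c := by
    have : p * d + q * c = (v₁ * d - v₂ * c) - k * (x * d - y * c) := by rw [hq, hp]; ring
    rw [this]; exact dvd_sub hv (hD.mul_left k)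
  have hpar : ¬ (2 ∣ p ∧ 2 ∣ q) := by
    rintro ⟨h3, h4⟩
    refine hodd ⟨?_, ?_⟩
    · have := dvd_add h3 (hx.mul_left k); rwa [hp, sub_add_cancel] at this
    · have := dvd_sub h4 (hy.mul_left k); rwa [hq, add_sub_cancel_right, dvd_neg] at this
  have ho := h1 (p + x) (-(q - y)) (by
      have : (p + x) * d - -(q - y) * c = (p * d + q * c) + (x * d - y * c) := by ring
      rw [this]; exact dvd_add hmem hD) (by rw [dvd_neg]; omega)
  have ho' := h2 p (p - q) (by
      have : p * (c + d) - (p - q) * c = p * d + q * c := by ring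
      rw [this]; exact hmem) (by omega)
  simp only [sq_lt_iff_sqrt_lt_abs hNp.le] at ho ho'
  push_cast at ho ho'
  have := short_of_growing (s := √N) (p := p) (q := q) hxR hyR
    (by rw [lt_sq_iff_abs_lt_sqrt, abs_of_pos hxR] at hxN; exact hxN)
    (by rw [lt_sq_iff_abs_lt_sqrt, abs_of_pos hyR] at hyN; exact hyN)
    (by rw [Real.sqrt_le_left (by positivity)]; exact_mod_cast hcon)
    (by rw [hs2]; exact_mod_cast hpq)
    (by rw [hq]; push_cast; exact hk.1) (by rw [hq]; push_cast; exact hk.2) ho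
  rcases ho' with h | h | h <;> linarith [this.1, this.2.1, this.2.2]

/-- The even vector is sheared along with the row, as in Euclid's algorithm. A growing vector stays
growing while `x < y` and becomes bounded when `x > y`; a bounded one stays bounded by
`add_sq_lt_of_noShort`. -/
theorem HasEvenPartner.step {n : ℕ} {a b : ℤ} (ha : 0 < a) (hb : 0 < b) (hcop : IsCoprime a b)
    (h : HasEvenPartner (2 ^ n) a b) (hns : NoShort (2 ^ n) a b) (hns' : NoShort (2 ^ n) a (a + b))
    (hdvd : ¬ (2 ^ n : ℤ) ∣ (a + b) ^ 2) (hab : (2 ^ n : ℤ) < (a + b) ^ 2) :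
    HasEvenPartner (2 ^ n) a (a + b) := by
  have hodd : ¬ ((2 : ℤ) ∣ a ∧ 2 ∣ b) := by
    rintro ⟨h4, h5⟩
    have := hcop.isUnit_of_dvd' h4 h5
    rw [Int.isUnit_iff] at this
    omega
  obtain ⟨x, y, hx, hy, hx0, hy0, ⟨h1, h2, h3⟩ | ⟨h1, h2, h3⟩⟩ := h
  · rcases lt_trichotomy x y with hxy | rfl | hxy
    · have hxN : x ^ 2 < 2 ^ n := by
        rcases h3 with h3 | h3
        · exact h3
        · nlinarith
      refine ⟨x, y - x, hx, dvd_sub hy hx, hx0, by linarith, Or.inl ⟨by linarith, ?_, Or.inl hxN⟩⟩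
      rcases le_total x (y - x) with h | h <;> nlinarith
    · exfalso
      -- Here `x` and `a + b` are both powers of two, because `N` is one. The smaller divides the
      -- larger, so `N ∣ (a + b)²`, which is excluded.
      have e : (a + b) * x = 2 ^ n := by linarith
      have hxN : x ^ 2 < 2 ^ n := by tauto
      have hxc : x < a + b := by nlinarith
      apply hdvd
      suffices x ∣ a + b by rw [← e, sq]; exact mul_dvd_mul_left _ this
      have h5 : (a + b).natAbs ∣ 2 ^ n := by
        have := Int.natAbs_dvd_natAbs.2 (Dvd.intro _ e); simpa [Int.natAbs_pow] using this
      have h6 : x.natAbs ∣ 2 ^ n := by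
        have := Int.natAbs_dvd_natAbs.2 (Dvd.intro_left _ e); simpa [Int.natAbs_pow] using this
      obtain ⟨i, -, hi⟩ := (Nat.dvd_prime_pow Nat.prime_two).1 h5
      obtain ⟨j, -, hj⟩ := (Nat.dvd_prime_pow Nat.prime_two).1 h6
      rw [← Int.natAbs_dvd_natAbs, hi, hj]
      apply Nat.pow_dvd_pow
      have : 2 ^ j ≤ 2 ^ i := by rw [← hi, ← hj]; omega
      exact (Nat.pow_le_pow_iff_right (by norm_num)).1 this
    · have hyN : y ^ 2 < 2 ^ n := by
        rcases h3 with h3 | h3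
        · nlinarith
        · exact h3
      -- The reflection `(p, q) ↦ (p + q, -q)` of the hexagonal norm turns `(x, -y)` into `(x - y,
      -- y)`, whose coordinate sum `x` is the quantity to be bounded.
      have key := add_sq_lt_of_noShort (c := a + b) (d := -b) (x := x - y) (y := y) (v₁ := a + b)
        (v₂ := -b) hns.rotate.swap
        (by simpa using hns'.swap)
        (dvd_sub hx hy) hy (by linarith) hy0 (by linarith) hyN
        ⟨-1, by linarith⟩ ⟨0, by ring⟩ (by rw [dvd_neg]; omega) (Or.inl (by linarith))
      refine ⟨x, x - y, hx, dvd_sub hx hy, hx0, by linarith, Or.inr ⟨?_, ?_, h2⟩⟩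
      · right; linarith
      · simpa using key
  · have key := add_sq_lt_of_noShort (c := a) (d := b) (v₁ := a) (v₂ := b) hns hns' hx hy hx0 hy0 h2 h3
      (by rcases h1 with h1 | h1
          · exact ⟨-1, by linarith⟩
          · exact ⟨1, by linarith⟩) ⟨0, by ring⟩ hodd h1
    refine ⟨x, x + y, hx, dvd_add hx hy, hx0, by linarith, Or.inr ⟨?_, h2, key⟩⟩
    rcases h1 with h1 | h1
    · left; linarith
    · right; linarith

theorem HasEvenPartner.step' {n : ℕ} {a b : ℤ} (ha : 0 < a) (hb : 0 < b) (hcop : IsCoprime a b)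
    (h : HasEvenPartner (2 ^ n) a b) (hns : NoShort (2 ^ n) a b) (hns' : NoShort (2 ^ n) (a + b) b)
    (hdvd : ¬ (2 ^ n : ℤ) ∣ (a + b) ^ 2) (hab : (2 ^ n : ℤ) < (a + b) ^ 2) :
    HasEvenPartner (2 ^ n) (a + b) b := by
  rw [add_comm] at *
  exact (h.swap.step hb ha hcop.symm hns.swap hns'.swap hdvd hab).swap

/-- The lattice has index `N`, so determinants of pairs of its vectors are multiples of `N`. -/
theorem dvd_cross {N c d u₁ u₂ w₁ w₂ : ℤ} (hcd : IsCoprime c d) (hu : N ∣ u₁ * d - u₂ * c)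
    (hw : N ∣ w₁ * d - w₂ * c) : N ∣ u₁ * w₂ - u₂ * w₁ := by
  obtain ⟨e, f, hef⟩ := hcd
  have : u₁ * w₂ - u₂ * w₁ =
      (u₁ * d - u₂ * c) * (e * w₁ + f * w₂) - (w₁ * d - w₂ * c) * (e * u₁ + f * u₂) := by
    linear_combination (-(u₁ * w₂ - u₂ * w₁)) * hef
  rw [this]
  exact dvd_sub (hu.mul_right _) (hw.mul_right _)

/-- The halved vectors lie in the lattice for `N / 2`, so the determinant is a multiple of `4 (N /
2)`. -/
theorem dvd_cross_even {N c d u₁ u₂ w₁ w₂ : ℤ} (h2 : 2 ∣ N) (hcd : IsCoprime c d)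
    (hu : N ∣ u₁ * d - u₂ * c) (hw : N ∣ w₁ * d - w₂ * c) (hu₁ : 2 ∣ u₁) (hu₂ : 2 ∣ u₂)
    (hw₁ : 2 ∣ w₁) (hw₂ : 2 ∣ w₂) : 2 * N ∣ u₁ * w₂ - u₂ * w₁ := by
  obtain ⟨N, rfl⟩ := h2
  obtain ⟨u₁, rfl⟩ := hu₁
  obtain ⟨u₂, rfl⟩ := hu₂
  obtain ⟨w₁, rfl⟩ := hw₁
  obtain ⟨w₂, rfl⟩ := hw₂
  have h1 : N ∣ u₁ * d - u₂ * c := by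
    rw [show 2 * u₁ * d - 2 * u₂ * c = 2 * (u₁ * d - u₂ * c) by ring] at hu
    exact (mul_dvd_mul_iff_left two_ne_zero).1 hu
  have h2 : N ∣ w₁ * d - w₂ * c := by
    rw [show 2 * w₁ * d - 2 * w₂ * c = 2 * (w₁ * d - w₂ * c) by ring] at hw
    exact (mul_dvd_mul_iff_left two_ne_zero).1 hw
  have := mul_dvd_mul_left (2 * 2) (dvd_cross hcd h1 h2)
  rw [show 2 * (2 * N) = 2 * 2 * N by ring, show 2 * u₁ * (2 * w₂) - 2 * u₂ * (2 * w₁) =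
    2 * 2 * (u₁ * w₂ - u₂ * w₁) by ring]
  exact this

/-- Two even vectors in different sectors of the lattice, each of which is part of a basis and has
two coordinates less than `√N`, differ by twice a short vector that is not even. -/
theorem not_noShort_of_two_even {N c d x y x' y' v₁ v₂ w₁ w₂ : ℤ} (h2 : 2 ∣ N) (hcd : IsCoprime c d)
    (hx : 2 ∣ x) (hy : 2 ∣ y) (hx' : 2 ∣ x') (hy' : 2 ∣ y') (hx0 : 0 < x) (hy0 : 0 < y)
    (hx0' : 0 < x') (hy0' : 0 < y') (hxN : x ^ 2 < N) (hyN : y ^ 2 < N) (hxN' : x' ^ 2 < N)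
    (hyN' : y' ^ 2 < N) (hD : N ∣ x * d - y * c) (hD' : N ∣ -y' * d - (x' + y') * c)
    (hv : N ∣ v₁ * d - v₂ * c) (hodd : ¬ (2 ∣ v₁ ∧ 2 ∣ v₂))
    (hvD : v₁ * y - v₂ * x = N ∨ v₁ * y - v₂ * x = -N) (hw : N ∣ w₁ * d - w₂ * c)
    (hwD : w₁ * (x' + y') - w₂ * -y' = N ∨ w₁ * (x' + y') - w₂ * -y' = -N) :
    ¬ NoShort N c d := by
  intro hns
  have hNp : 0 < N := lt_of_le_of_lt (by positivity) hxN
  -- A positive multiple of `2 N` that is a sum of three products, each less than `N`.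
  have hcross : x * (x' + y') + y * y' = 2 * N := by
    obtain ⟨k, hk⟩ := dvd_cross_even h2 hcd hD hD' hx hy (by rwa [dvd_neg]) (dvd_add hx' hy')
    have hlt : x * (x' + y') + y * y' < 3 * N := by
      nlinarith [sq_nonneg (x - x'), sq_nonneg (x - y'), sq_nonneg (y - y')]
    have hpos : 0 < x * (x' + y') + y * y' := by positivity
    have hk' : x * (x' + y') + y * y' = 2 * N * k := by linarith
    have : 0 < k := by
      by_contra hc
      push Not at hc
      nlinarith
    have : k < 2 := by
      by_contra hc
      push Not at hc
      nlinarith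
    have : k = 1 := by omega
    rw [hk', this, mul_one]
  obtain ⟨e, he⟩ : ∃ e : ℤ, (e = 1 ∨ e = -1) ∧ v₁ * y - v₂ * x = e * N := by
    rcases hvD with h | h
    · exact ⟨1, Or.inl rfl, by linarith⟩
    · exact ⟨-1, Or.inr rfl, by linarith⟩
  have hee : e * e = 1 := by rcases he.1 with h | h <;> rw [h] <;> rfl
  -- The coefficients of `(-y', x' + y')` in the basis `v`, `(x, y)` are quotients of determinants
  -- by `±N`, namely `-2 e` and `-e b`.
  obtain ⟨b, hb⟩ := dvd_cross hcd hD' hv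
  have hb1 : -y' = e * (-2) * v₁ - e * b * x := by
    apply mul_left_cancel₀ hNp.ne'
    have h3 := he.2
    linear_combination (-e) * v₁ * hcross - e * x * hb - e * (-y') * h3 + N * (-y') * (-hee)
  have hb2 : x' + y' = e * (-2) * v₂ - e * b * y := by
    apply mul_left_cancel₀ hNp.ne'
    have h3 := he.2
    linear_combination (-e) * v₂ * hcross - e * y * hb - e * (x' + y') * h3 + N * (x' + y') * (-hee)
  -- For even `b` the second even vector would be twice a lattice vector, and its determinant with
  -- `w` could not be `±N`.
  have hbodd : ¬ 2 ∣ b := by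
    rintro ⟨b', rfl⟩
    obtain ⟨i, hi⟩ := dvd_cross hcd hw hv
    obtain ⟨j, hj⟩ := dvd_cross hcd hw hD
    have h3 : w₁ * (x' + y') - w₂ * -y' = 2 * N * (e * (-i - b' * j)) := by
      rw [hb1, hb2]; linear_combination (-2 * e) * hi - 2 * e * b' * hj
    have h4 : 2 * N ∣ w₁ * (x' + y') - w₂ * -y' := ⟨_, h3⟩
    have h5 : 2 * N ∣ N := by
      rcases hwD with h | h
      · rwa [h] at h4
      · rwa [h, dvd_neg] at h4
    have := Int.le_of_dvd hNp h5
    linarith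
  -- With this `m`, the vector `e v + m (x, y)` is half of `(x, y) - (-y', x' + y')`. It lies in the
  -- lattice, is not even, and has all three hexagonal coordinates below `√N`.
  obtain ⟨m, hm⟩ : ∃ m, 1 + e * b = 2 * m := by
    rcases he.1 with rfl | rfl
    · exact ⟨(1 + b) / 2, by omega⟩
    · exact ⟨(1 - b) / 2, by omega⟩
  have hp : 2 * (e * v₁ + m * x) = x + y' := by linear_combination (-x) * hm + hb1
  have hq : 2 * (e * v₂ + m * y) = y - (x' + y') := by linear_combination (-y) * hm + hb2
  have hshort := hns (e * v₁ + m * x) (e * v₂ + m * y) (by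
      rw [show (e * v₁ + m * x) * d - (e * v₂ + m * y) * c =
        e * (v₁ * d - v₂ * c) + m * (x * d - y * c) by ring]
      exact dvd_add (hv.mul_left _) (hD.mul_left _)) (by
      rintro ⟨h3, h4⟩
      have h5 := (dvd_add_left (hx.mul_left m)).1 h3
      have h6 := (dvd_add_left (hy.mul_left m)).1 h4
      rcases he.1 with rfl | rfl
      · rw [one_mul] at h5 h6; exact hodd ⟨h5, h6⟩
      · rw [neg_one_mul, dvd_neg] at h5 h6; exact hodd ⟨h5, h6⟩)
  set p := e * v₁ + m * x
  set q := e * v₂ + m * y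
  have h1 : (2 * p) ^ 2 < 4 * N := by rw [hp]; nlinarith [sq_nonneg (x - y')]
  have h3 : (2 * q) ^ 2 < 4 * N := by
    rw [hq]; nlinarith [sq_nonneg (x' - y'), mul_pos hy0 (add_pos hx0' hy0')]
  have h4 : (2 * (p + q)) ^ 2 < 4 * N := by
    rw [mul_add, hp, hq]
    nlinarith [sq_nonneg (x - y), mul_pos hx0' (add_pos hx0 hy0)]
  rcases hshort with h | h | h <;> nlinarith

/-! ### Entries and relations of the matrices `S`, `T`, `U`, `R` -/

section Entries

variable (X Y : SL(2, ℤ))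

theorem sl_mul_apply (i j : Fin 2) : (X * Y) i j = X i 0 * Y 0 j + X i 1 * Y 1 j := by
  rw [Matrix.SpecialLinearGroup.coe_mul, Matrix.mul_apply, Fin.sum_univ_two]

theorem sl_det : X 0 0 * X 1 1 - X 0 1 * X 1 0 = 1 := by
  rw [← Matrix.det_fin_two]; exact X.det_coe

theorem sl_inv_zero_zero : X⁻¹ 0 0 = X 1 1 := by rw [Matrix.SpecialLinearGroup.SL2_inv_expl]; rfl
theorem sl_inv_zero_one : X⁻¹ 0 1 = -X 0 1 := by rw [Matrix.SpecialLinearGroup.SL2_inv_expl]; rfl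
theorem sl_inv_one_zero : X⁻¹ 1 0 = -X 1 0 := by rw [Matrix.SpecialLinearGroup.SL2_inv_expl]; rfl
theorem sl_inv_one_one : X⁻¹ 1 1 = X 0 0 := by rw [Matrix.SpecialLinearGroup.SL2_inv_expl]; rfl

variable {X Y}

theorem sl_ext (h00 : X 0 0 = Y 0 0) (h01 : X 0 1 = Y 0 1) (h10 : X 1 0 = Y 1 0)
    (h11 : X 1 1 = Y 1 1) : X = Y := by
  apply Subtype.ext
  ext i j
  fin_cases i <;> fin_cases j <;> assumption

/-- The matrix with rows `(1, 0)` and `(1, 1)`. -/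
def lowerShear : SL(2, ℤ) := ⟨!![1, 0; 1, 1], by simp [Matrix.det_fin_two]⟩

local notation "U" => lowerShear
local notation "R" => rotThree

@[simp] theorem U_00 : U 0 0 = 1 := rfl
@[simp] theorem U_01 : U 0 1 = 0 := rfl
@[simp] theorem U_10 : U 1 0 = 1 := rfl
@[simp] theorem U_11 : U 1 1 = 1 := rfl
@[simp] theorem T_00 : T 0 0 = 1 := rfl
@[simp] theorem T_01 : T 0 1 = 1 := rfl
@[simp] theorem T_10 : T 1 0 = 0 := rfl
@[simp] theorem T_11 : T 1 1 = 1 := rfl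
@[simp] theorem S_00 : S 0 0 = 0 := rfl
@[simp] theorem S_01 : S 0 1 = -1 := rfl
@[simp] theorem S_10 : S 1 0 = 1 := rfl
@[simp] theorem S_11 : S 1 1 = 0 := rfl
@[simp] theorem R_00 : R 0 0 = 0 := rfl
@[simp] theorem R_01 : R 0 1 = 1 := rfl
@[simp] theorem R_10 : R 1 0 = -1 := rfl
@[simp] theorem R_11 : R 1 1 = 1 := rfl
@[simp] theorem one_00 : (1 : SL(2, ℤ)) 0 0 = 1 := rfl
@[simp] theorem one_01 : (1 : SL(2, ℤ)) 0 1 = 0 := rfl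
@[simp] theorem one_10 : (1 : SL(2, ℤ)) 1 0 = 0 := rfl
@[simp] theorem one_11 : (1 : SL(2, ℤ)) 1 1 = 1 := rfl
@[simp] theorem neg_apply_sl (i j : Fin 2) : (-X) i j = -X i j := rfl

theorem S_mul_S : S * S = -1 := by apply sl_ext <;> simp [sl_mul_apply]
theorem R_cube : R ^ 3 = -1 := by
  rw [pow_succ, pow_two]; apply sl_ext <;> simp [sl_mul_apply]
theorem U_mul_S : U * S = -R := by apply sl_ext <;> simp [sl_mul_apply]
theorem T_mul_S : T * S = -R ^ 2 := by rw [pow_two]; apply sl_ext <;> simp [sl_mul_apply]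
theorem R_mul_S : R * S = U := by apply sl_ext <;> simp [sl_mul_apply]
theorem R_sq_mul_S : R ^ 2 * S = T := by rw [pow_two]; apply sl_ext <;> simp [sl_mul_apply]
theorem T_inv_eq : T⁻¹ = S * R := by
  apply sl_ext <;> simp [sl_mul_apply, sl_inv_zero_zero, sl_inv_zero_one, sl_inv_one_zero,
    sl_inv_one_one]

end Entries

-- Half-planes bounded by Farey geodesics

local notation "U" => lowerShear
local notation "R" => rotThree

/-- `h` maps the geodesics from `0` to `∞`, and the half-plane `Re z > 0` it bounds, into the
half-plane `Re z ≤ 0`. -/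
def Apart (h : SL(2, ℤ)) : Prop :=
  h 0 0 * h 1 0 ≤ 0 ∧ h 0 1 * h 1 1 ≤ 0 ∧ h 0 0 * h 1 1 + h 0 1 * h 1 0 ≤ 0

/-- `h` maps the ideal triangle with vertices `0, 1, ∞` into the half-plane `Re z ≤ 0`. -/
def TriangleApart (h : SL(2, ℤ)) : Prop :=
  h 0 0 * h 1 0 ≤ 0 ∧ h 0 1 * h 1 1 ≤ 0 ∧ (h 0 0 + h 0 1) * (h 1 0 + h 1 1) ≤ 0

namespace Apart

variable {h : SL(2, ℤ)}

/-- The product for the vertex `1` is the sum of the three quantities in `Apart`. -/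
theorem triangleApart (H : Apart h) : TriangleApart h :=
  ⟨H.1, H.2.1, by linarith [H.1, H.2.1, H.2.2]⟩

theorem top_mul_nonneg (H : Apart h) : 0 ≤ h 0 0 * h 0 1 := by
  obtain ⟨h1, h2, h3⟩ := H
  have := sl_det h
  have h4 : h 0 1 * h 1 0 < 0 := by linarith
  have h5 : 0 < h 1 0 ^ 2 := by
    have : h 1 0 ≠ 0 := by rintro h; rw [h] at h4; simp at h4
    positivity
  have h6 : 0 ≤ (h 0 0 * h 0 1) * h 1 0 ^ 2 := by
    have := mul_nonneg_of_nonpos_of_nonpos h1 h4.le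
    linarith
  exact nonneg_of_mul_nonneg_left h6 h5

theorem bot_mul_nonneg (H : Apart h) : 0 ≤ h 1 0 * h 1 1 := by
  obtain ⟨h1, h2, h3⟩ := H
  have := sl_det h
  have h4 : h 0 1 * h 1 0 < 0 := by linarith
  have h5 : 0 < h 0 1 ^ 2 := by
    have : h 0 1 ≠ 0 := by rintro h; rw [h] at h4; simp at h4
    positivity
  have h6 : 0 ≤ (h 1 0 * h 1 1) * h 0 1 ^ 2 := by
    have := mul_nonneg_of_nonpos_of_nonpos h2 h4.le
    linarith
  exact nonneg_of_mul_nonneg_left h6 h5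

/-- `U` and `T` map `Re z > 0` onto the half-planes cut off by the other two sides of the triangle
`0, 1, ∞`. Splitting a side therefore only shrinks the half-plane outside, and apartness survives.
-/
theorem mul_U (H : Apart h) : Apart (h * U) := by
  obtain ⟨h1, h2, h3⟩ := H
  refine ⟨?_, ?_, ?_⟩ <;> simp only [sl_mul_apply, U_00, U_01, U_10, U_11] <;> nlinarith

theorem mul_T (H : Apart h) : Apart (h * T) := by
  obtain ⟨h1, h2, h3⟩ := H
  refine ⟨?_, ?_, ?_⟩ <;> simp only [sl_mul_apply, T_00, T_01, T_10, T_11] <;> nlinarith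

theorem inv_U_mul (H : Apart h) : Apart (U⁻¹ * h) := by
  have := H.top_mul_nonneg
  obtain ⟨h1, h2, h3⟩ := H
  refine ⟨?_, ?_, ?_⟩ <;> simp only [sl_mul_apply, sl_inv_zero_zero, sl_inv_zero_one,
    sl_inv_one_zero, sl_inv_one_one, U_00, U_01, U_10, U_11] <;>
    nlinarith [sq_nonneg (h 0 0), sq_nonneg (h 0 1)]

theorem inv_T_mul (H : Apart h) : Apart (T⁻¹ * h) := by
  have := H.bot_mul_nonneg
  obtain ⟨h1, h2, h3⟩ := H
  refine ⟨?_, ?_, ?_⟩ <;> simp only [sl_mul_apply, sl_inv_zero_zero, sl_inv_zero_one,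
    sl_inv_one_zero, sl_inv_one_one, T_00, T_01, T_10, T_11] <;>
    nlinarith [sq_nonneg (h 1 0), sq_nonneg (h 1 1)]

end Apart

theorem not_apart_one : ¬ Apart 1 := fun h => by simpa using h.2.2

namespace TriangleApart

variable {h : SL(2, ℤ)}

theorem inv_U_mul (H : TriangleApart h) : TriangleApart (U⁻¹ * h) := by
  obtain ⟨h1, h2, h3⟩ := H
  refine ⟨?_, ?_, ?_⟩ <;> simp only [sl_mul_apply, sl_inv_zero_zero, sl_inv_zero_one,
    sl_inv_one_zero, sl_inv_one_one, U_00, U_01, U_10, U_11] <;>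
    nlinarith [sq_nonneg (h 0 0), sq_nonneg (h 0 1), sq_nonneg (h 0 0 + h 0 1)]

theorem inv_T_mul (H : TriangleApart h) : TriangleApart (T⁻¹ * h) := by
  obtain ⟨h1, h2, h3⟩ := H
  refine ⟨?_, ?_, ?_⟩ <;> simp only [sl_mul_apply, sl_inv_zero_zero, sl_inv_zero_one,
    sl_inv_one_zero, sl_inv_one_one, T_00, T_01, T_10, T_11] <;>
    nlinarith [sq_nonneg (h 1 0), sq_nonneg (h 1 1), sq_nonneg (h 1 0 + h 1 1)]

end TriangleApart

theorem not_triangleApart_one : ¬ TriangleApart 1 := fun h => by simpa using h.2.2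

theorem triangleApart_inv_U : TriangleApart U⁻¹ := by
  refine ⟨?_, ?_, ?_⟩ <;> simp [sl_inv_zero_zero, sl_inv_zero_one, sl_inv_one_zero, sl_inv_one_one]

theorem triangleApart_inv_T : TriangleApart T⁻¹ := by
  refine ⟨?_, ?_, ?_⟩ <;> simp [sl_inv_zero_zero, sl_inv_zero_one, sl_inv_one_zero, sl_inv_one_one]

theorem triangleApart_inv_S : TriangleApart S⁻¹ := by
  refine ⟨?_, ?_, ?_⟩ <;> simp [sl_inv_zero_zero, sl_inv_zero_one, sl_inv_one_zero, sl_inv_one_one]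

/-- The half-planes outside the geodesics `X (0, ∞)` and `Y (0, ∞)` are disjoint. -/
def SidesApart (X Y : SL(2, ℤ)) : Prop := Apart (X⁻¹ * Y) ∧ Apart (Y⁻¹ * X)

theorem SidesApart.symm {X Y : SL(2, ℤ)} (h : SidesApart X Y) : SidesApart Y X := And.symm h

theorem SidesApart.mul_U {X Y : SL(2, ℤ)} (h : SidesApart X Y) : SidesApart X (Y * U) :=
  ⟨by rw [← mul_assoc]; exact h.1.mul_U, by rw [mul_inv_rev, mul_assoc]; exact h.2.inv_U_mul⟩

theorem SidesApart.mul_T {X Y : SL(2, ℤ)} (h : SidesApart X Y) : SidesApart X (Y * T) :=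
  ⟨by rw [← mul_assoc]; exact h.1.mul_T, by rw [mul_inv_rev, mul_assoc]; exact h.2.inv_T_mul⟩

theorem sidesApart_U_T (X : SL(2, ℤ)) : SidesApart (X * U) (X * T) := by
  have h1 : (X * U)⁻¹ * (X * T) = U⁻¹ * T := by group
  have h2 : (X * T)⁻¹ * (X * U) = T⁻¹ * U := by group
  rw [SidesApart, h1, h2]
  refine ⟨⟨?_, ?_, ?_⟩, ?_, ?_, ?_⟩ <;> simp [sl_mul_apply, sl_inv_zero_zero, sl_inv_zero_one,
    sl_inv_one_zero, sl_inv_one_one]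

/-! ### Dissections of ideal polygons -/

/-- The dissections of ideal polygons into Farey triangles. The matrix `X` in the list stands for
the side `X (0, ∞)`, the matrix `M` in the finite set for the triangle `M (0, 1, ∞)`. -/
inductive Dissection : List SL(2, ℤ) → Finset SL(2, ℤ) → Prop
  | base : Dissection [U] {1}
  | split {l₁ l₂ : List SL(2, ℤ)} {X : SL(2, ℤ)} {t : Finset SL(2, ℤ)} :
      Dissection (l₁ ++ X :: l₂) t → Dissection (l₁ ++ X * U :: X * T :: l₂) (insert X t)

namespace Dissection

variable {l : List SL(2, ℤ)} {t : Finset SL(2, ℤ)}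

theorem one_mem (h : Dissection l t) : 1 ∈ t := by
  induction h with
  | base => simp
  | split _ ih => exact Finset.mem_insert_of_mem ih

theorem ne_nil (h : Dissection l t) : l ≠ [] := by
  cases h <;> simp

theorem pairwise_split {α : Type*} {r : α → α → Prop} {l₁ l₂ : List α} {x a b : α}
    (h : (l₁ ++ x :: l₂).Pairwise r) (ha : ∀ y, r x y → r a y) (hb : ∀ y, r x y → r b y)
    (ha' : ∀ y, r y x → r y a) (hb' : ∀ y, r y x → r y b) (hab : r a b) :
    (l₁ ++ a :: b :: l₂).Pairwise r := by
  rw [List.pairwise_append, List.pairwise_cons] at h ⊢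
  rw [List.pairwise_cons]
  obtain ⟨h1, ⟨h2, h3⟩, h4⟩ := h
  refine ⟨h1, ⟨?_, fun y hy => hb y (h2 y hy), h3⟩, ?_⟩
  · intro y hy
    rcases List.mem_cons.1 hy with rfl | hy
    · exact hab
    · exact ha y (h2 y hy)
  · intro y hy z hz
    rcases List.mem_cons.1 hz with rfl | hz
    · exact ha' y (h4 y hy x (by simp))
    · rcases List.mem_cons.1 hz with rfl | hz
      · exact hb' y (h4 y hy x (by simp))
      · exact h4 y hy z (by simp [hz])

/-- Invariant of splitting: the half-plane outside `X` is exchanged for two disjoint half-planes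
inside it. `S` and `T` are the vertical sides, which are never split. -/
theorem pairwise (h : Dissection l t) : (S :: T :: l).Pairwise SidesApart := by
  induction h with
  | base =>
    simp only [List.pairwise_cons, List.mem_cons, List.not_mem_nil, or_false, forall_eq_or_imp,
      forall_eq, false_imp_iff, implies_true, List.Pairwise.nil, and_true]
    refine ⟨⟨?_, ?_⟩, ?_⟩ <;> refine ⟨⟨?_, ?_, ?_⟩, ?_, ?_, ?_⟩ <;> simp [sl_mul_apply,
      sl_inv_zero_zero, sl_inv_zero_one, sl_inv_one_zero, sl_inv_one_one]
  | @split l₁ l₂ X t _ ih =>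
    rw [← List.cons_append, ← List.cons_append] at ih ⊢
    exact pairwise_split ih (fun y h => h.symm.mul_U.symm) (fun y h => h.symm.mul_T.symm)
      (fun y h => h.mul_U) (fun y h => h.mul_T) (sidesApart_U_T X)

theorem triangleApart (h : Dissection l t) :
    ∀ X ∈ S :: T :: l, ∀ M ∈ t, TriangleApart (X⁻¹ * M) := by
  induction h with
  | base =>
    simp only [Finset.mem_singleton, forall_eq, mul_one, List.mem_cons, List.not_mem_nil, or_false]
    rintro X (rfl | rfl | rfl)
    exacts [triangleApart_inv_S, triangleApart_inv_T, triangleApart_inv_U]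
  | @split l₁ l₂ X t hd ih =>
    intro Y hY M hM
    have hpw := hd.pairwise
    rw [← List.cons_append, ← List.cons_append] at ih hpw hY
    rw [List.pairwise_append] at hpw
    replace hY : Y ∈ S :: T :: l₁ ∨ Y = X * U ∨ Y = X * T ∨ Y ∈ l₂ := by
      simpa [or_assoc] using hY
    have hU : (X * U)⁻¹ * X = U⁻¹ := by group
    have hT : (X * T)⁻¹ * X = T⁻¹ := by group
    rcases Finset.mem_insert.1 hM with rfl | hM
    · rcases hY with hY | rfl | rfl | hY
      · exact (hpw.2.2 Y hY M (by simp)).1.triangleApart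
      · rw [hU]; exact triangleApart_inv_U
      · rw [hT]; exact triangleApart_inv_T
      · exact ((List.pairwise_cons.1 hpw.2.1).1 Y hY).2.triangleApart
    · have hX := ih X (by simp) M hM
      rcases hY with hY | rfl | rfl | hY
      · exact ih Y (List.mem_append.2 (by rw [List.mem_cons (b := X)]; tauto)) M hM
      · rw [mul_inv_rev, mul_assoc]; exact hX.inv_U_mul
      · rw [mul_inv_rev, mul_assoc]; exact hX.inv_T_mul
      · exact ih Y (List.mem_append.2 (by rw [List.mem_cons (b := X)]; tauto)) M hM

theorem not_mem_of_side (h : Dissection l t) {X : SL(2, ℤ)} (hX : X ∈ l) : X ∉ t := fun hXt => by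
  have := h.triangleApart X (by simp [hX]) X hXt
  rw [inv_mul_cancel] at this
  exact not_triangleApart_one this

theorem length_eq_card (h : Dissection l t) : l.length = t.card := by
  induction h with
  | base => simp
  | split hd ih =>
    rw [Finset.card_insert_of_notMem (hd.not_mem_of_side (by simp)), ← ih]
    simp; omega

/-- The end points of the side `X (0, ∞)` are rational numbers in `[0, 1]`, in order. -/
def InUnitInterval (X : SL(2, ℤ)) : Prop :=
  0 ≤ X 0 1 ∧ X 0 1 < X 1 1 ∧ 0 < X 0 0 ∧ X 0 0 ≤ X 1 0

theorem InUnitInterval.mul_U {X : SL(2, ℤ)} (h : InUnitInterval X) : InUnitInterval (X * U) := by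
  obtain ⟨h1, h2, h3, h4⟩ := h
  refine ⟨?_, ?_, ?_, ?_⟩ <;> simp only [sl_mul_apply, U_00, U_01, U_10, U_11] <;> linarith

theorem InUnitInterval.mul_T {X : SL(2, ℤ)} (h : InUnitInterval X) : InUnitInterval (X * T) := by
  obtain ⟨h1, h2, h3, h4⟩ := h
  refine ⟨?_, ?_, ?_, ?_⟩ <;> simp only [sl_mul_apply, T_00, T_01, T_10, T_11] <;> linarith

theorem inUnitInterval_U : InUnitInterval U := by
  refine ⟨?_, ?_, ?_, ?_⟩ <;> simp

theorem inUnitInterval_side (h : Dissection l t) : ∀ X ∈ l, InUnitInterval X := by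
  induction h with
  | base => simpa using inUnitInterval_U
  | @split l₁ l₂ X t _ ih =>
    intro Y hY
    simp only [List.mem_append, List.mem_cons] at hY ih
    rcases hY with hY | rfl | rfl | hY
    · exact ih Y (Or.inl hY)
    · exact (ih X (Or.inr (Or.inl rfl))).mul_U
    · exact (ih X (Or.inr (Or.inl rfl))).mul_T
    · exact ih Y (Or.inr (Or.inr hY))

theorem inUnitInterval_triangle (h : Dissection l t) : ∀ M ∈ t, M = 1 ∨ InUnitInterval M := by
  induction h with
  | base => simp
  | split hd ih =>
    intro M hM
    rcases Finset.mem_insert.1 hM with rfl | hM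
    · exact Or.inr (hd.inUnitInterval_side M (by simp))
    · exact ih M hM

theorem parent_side (h : Dissection l t) :
    ∀ X ∈ l, ∃ M ∈ t, X = M * U ∨ (M ≠ 1 ∧ X = M * T) := by
  induction h with
  | base => simp
  | @split l₁ l₂ X t hd ih =>
    have hX1 : X ≠ 1 := by
      rintro rfl
      exact hd.not_mem_of_side (by simp) hd.one_mem
    intro Y hY
    simp only [List.mem_append, List.mem_cons] at hY ih
    rcases hY with hY | rfl | rfl | hY
    · obtain ⟨M, hM, h⟩ := ih Y (Or.inl hY)
      exact ⟨M, Finset.mem_insert_of_mem hM, h⟩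
    · exact ⟨X, Finset.mem_insert_self _ _, Or.inl rfl⟩
    · exact ⟨X, Finset.mem_insert_self _ _, Or.inr ⟨hX1, rfl⟩⟩
    · obtain ⟨M, hM, h⟩ := ih Y (Or.inr (Or.inr hY))
      exact ⟨M, Finset.mem_insert_of_mem hM, h⟩

theorem parent_triangle (h : Dissection l t) :
    ∀ X ∈ t, X = 1 ∨ ∃ M ∈ t, X = M * U ∨ (M ≠ 1 ∧ X = M * T) := by
  induction h with
  | base => simp
  | @split l₁ l₂ X t hd ih =>
    intro Y hY
    rcases Finset.mem_insert.1 hY with rfl | hY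
    · obtain ⟨M, hM, h⟩ := hd.parent_side Y (by simp)
      exact Or.inr ⟨M, Finset.mem_insert_of_mem hM, h⟩
    · rcases ih Y hY with h | ⟨M, hM, h⟩
      · exact Or.inl h
      · exact Or.inr ⟨M, Finset.mem_insert_of_mem hM, h⟩

theorem child (h : Dissection l t) :
    ∀ M ∈ t, (M * U ∈ t ∨ M * U ∈ l) ∧ (M = 1 ∨ M * T ∈ t ∨ M * T ∈ l) := by
  induction h with
  | base => simp
  | @split l₁ l₂ X t hd ih =>
    intro M hM
    rcases Finset.mem_insert.1 hM with rfl | hM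
    · exact ⟨Or.inr (by simp), Or.inr (Or.inr (by simp))⟩
    · obtain ⟨h1, h2⟩ := ih M hM
      simp only [Finset.mem_insert, List.mem_append, List.mem_cons] at h1 h2 ⊢
      tauto

theorem isChain (h : Dissection l t) :
    l.IsChain (fun X Y => Y 0 1 = X 0 0 ∧ Y 1 1 = X 1 0) ∧
      (∀ X ∈ l.head?, X 0 1 = 0 ∧ X 1 1 = 1) ∧ (∀ X ∈ l.getLast?, X 0 0 = 1 ∧ X 1 0 = 1) := by
  induction h with
  | base => simp
  | @split l₁ l₂ X t hd ih =>
    obtain ⟨h1, h2, h3⟩ := ih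
    have hU1 : (X * U) 0 1 = X 0 1 := by simp [sl_mul_apply]
    have hU2 : (X * U) 1 1 = X 1 1 := by simp [sl_mul_apply]
    have hT1 : (X * T) 0 0 = X 0 0 := by simp [sl_mul_apply]
    have hT2 : (X * T) 1 0 = X 1 0 := by simp [sl_mul_apply]
    refine ⟨?_, ?_, ?_⟩
    · rw [List.isChain_append] at h1 ⊢
      rw [List.isChain_cons] at h1 ⊢
      rw [List.isChain_cons]
      obtain ⟨h4, ⟨h5, h6⟩, h7⟩ := h1
      refine ⟨h4, ⟨?_, ?_, h6⟩, ?_⟩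
      · simp [sl_mul_apply]
      · intro Y hY
        rw [hT1, hT2]
        exact h5 Y hY
      · intro Y hY Z hZ
        simp only [List.head?_cons, Option.mem_def, Option.some.injEq] at hZ
        subst hZ
        rw [hU1, hU2]
        exact h7 Y hY X (by simp)
    · cases l₁ with
      | nil =>
        simp only [List.nil_append, List.head?_cons, Option.mem_def, Option.some.injEq,
          forall_eq'] at h2 ⊢
        rw [hU1, hU2]; exact h2
      | cons a l₁ => simpa using h2
    · cases l₂ using List.reverseRecOn with
      | nil =>
        have e1 : (l₁ ++ [X * U, X * T]).getLast? = some (X * T) := by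
          simp [List.getLast?_append]
        have e2 : (l₁ ++ [X]).getLast? = some X := by simp
        rw [e2] at h3
        rw [e1]
        simp only [Option.mem_def, Option.some.injEq, forall_eq'] at h3 ⊢
        rw [hT1, hT2]; exact h3
      | append_singleton l₂ a =>
        have e1 : (l₁ ++ X * U :: X * T :: (l₂ ++ [a])).getLast? = some a := by
          simp [List.getLast?_append, List.getLast?_cons]
        have e2 : (l₁ ++ X :: (l₂ ++ [a])).getLast? = some a := by
          simp [List.getLast?_append, List.getLast?_cons]
        rw [e2] at h3
        rw [e1]
        exact h3

end Dissection

/-! ### Cosets of `Γ₀(N)` and inequivalent triangles -/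

theorem mem_Gamma0_iff {N : ℕ} {g : SL(2, ℤ)} : g ∈ Gamma0 N ↔ (N : ℤ) ∣ g 1 0 := by
  rw [CongruenceSubgroup.Gamma0_mem, ZMod.intCast_zmod_eq_zero_iff_dvd]

theorem mul_inv_mem_Gamma0_iff {N : ℕ} {g h : SL(2, ℤ)} :
    g * h⁻¹ ∈ Gamma0 N ↔ (N : ℤ) ∣ g 1 0 * h 1 1 - g 1 1 * h 1 0 := by
  rw [mem_Gamma0_iff, sl_mul_apply, sl_inv_zero_zero, sl_inv_one_zero, mul_neg, sub_eq_add_neg]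

/-- `g` and `h` lie in the same right coset of `Γ₀(N)`. -/
def SameCoset (N : ℕ) (g h : SL(2, ℤ)) : Prop := g * h⁻¹ ∈ Gamma0 N

namespace SameCoset

variable {N : ℕ} {g h k : SL(2, ℤ)}

theorem iff_dvd : SameCoset N g h ↔ (N : ℤ) ∣ g 1 0 * h 1 1 - g 1 1 * h 1 0 :=
  mul_inv_mem_Gamma0_iff

theorem refl (g : SL(2, ℤ)) : SameCoset N g g := by
  rw [SameCoset, mul_inv_cancel]; exact one_mem _

theorem symm (H : SameCoset N g h) : SameCoset N h g := by
  rw [SameCoset] at *; rw [← inv_mem_iff]; simpa using H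

theorem trans (H : SameCoset N g h) (H' : SameCoset N h k) : SameCoset N g k := by
  rw [SameCoset] at *
  have := mul_mem H H'
  rwa [mul_assoc, inv_mul_cancel_left] at this

theorem mul_right (H : SameCoset N g h) (k : SL(2, ℤ)) : SameCoset N (g * k) (h * k) := by
  rw [SameCoset] at *; simpa [mul_assoc] using H

theorem neg_left_iff : SameCoset N (-g) h ↔ SameCoset N g h := by
  rw [iff_dvd, iff_dvd, neg_apply_sl, neg_apply_sl, ← dvd_neg]; ring_nf

theorem neg_right_iff : SameCoset N g (-h) ↔ SameCoset N g h := by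
  rw [iff_dvd, iff_dvd, neg_apply_sl, neg_apply_sl, ← dvd_neg]; ring_nf

theorem mul_R_cube_iff : SameCoset N g (h * R ^ 3) ↔ SameCoset N g h := by
  rw [R_cube, mul_neg, mul_one, neg_right_iff]

theorem mul_R_pow_mod_iff (m : ℕ) : SameCoset N g (h * R ^ m) ↔ SameCoset N g (h * R ^ (m % 3)) := by
  induction m using Nat.strong_induction_on with
  | _ m ih =>
    by_cases hm : m < 3
    · rw [Nat.mod_eq_of_lt hm]
    · obtain ⟨j, rfl⟩ : ∃ j, m = j + 3 := ⟨m - 3, by omega⟩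
      rw [pow_add, ← mul_assoc, mul_R_cube_iff, ih j (by omega), Nat.add_mod_right]

end SameCoset

theorem sl_R_row (g : SL(2, ℤ)) : (g * R) 1 0 = -g 1 1 ∧ (g * R) 1 1 = g 1 0 + g 1 1 := by
  constructor <;> simp [sl_mul_apply]

theorem sl_R_sq_row (g : SL(2, ℤ)) :
    (g * R ^ 2) 1 0 = -(g 1 0 + g 1 1) ∧ (g * R ^ 2) 1 1 = g 1 0 := by
  rw [pow_two, ← mul_assoc]
  exact ⟨by rw [(sl_R_row (g * R)).1, (sl_R_row g).2],
    by rw [(sl_R_row (g * R)).2, (sl_R_row g).1, (sl_R_row g).2]; ring⟩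

theorem sl_U_row (g : SL(2, ℤ)) : (g * U) 1 0 = g 1 0 + g 1 1 ∧ (g * U) 1 1 = g 1 1 := by
  constructor <;> simp [sl_mul_apply]

theorem sl_T_row (g : SL(2, ℤ)) : (g * T) 1 0 = g 1 0 ∧ (g * T) 1 1 = g 1 0 + g 1 1 := by
  constructor <;> simp [sl_mul_apply]

theorem sl_S_row (g : SL(2, ℤ)) : (g * S) 1 0 = g 1 1 ∧ (g * S) 1 1 = -g 1 0 := by
  constructor <;> simp [sl_mul_apply]

theorem sl_row_isCoprime (g : SL(2, ℤ)) : IsCoprime (g 1 0) (g 1 1) :=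
  ⟨-g 0 1, g 0 0, by linarith [sl_det g]⟩

/-- `g` is equivalent to an oriented side of a triangle in `t`. -/
def Represented (N : ℕ) (t : Finset SL(2, ℤ)) (g : SL(2, ℤ)) : Prop :=
  ∃ M ∈ t, ∃ k : ℕ, SameCoset N g (M * R ^ k)

/-- The triangles in `t` are pairwise inequivalent. -/
def Inequivalent (N : ℕ) (t : Finset SL(2, ℤ)) : Prop :=
  ∀ M ∈ t, ∀ M' ∈ t, ∀ k : ℕ, SameCoset N M (M' * R ^ k) → M = M'

theorem Represented.of_sameCoset {N : ℕ} {t : Finset SL(2, ℤ)} {g h : SL(2, ℤ)}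
    (H : Represented N t h) (hgh : SameCoset N g h) : Represented N t g := by
  obtain ⟨M, hM, k, hk⟩ := H
  exact ⟨M, hM, k, hgh.trans hk⟩

theorem Represented.mul_R {N : ℕ} {t : Finset SL(2, ℤ)} {g : SL(2, ℤ)} (H : Represented N t g) :
    Represented N t (g * R) := by
  obtain ⟨M, hM, k, hk⟩ := H
  exact ⟨M, hM, k + 1, by rw [pow_succ, ← mul_assoc]; exact hk.mul_right R⟩

/-- Equivalence of triangles is symmetric: `M ~ X R ^ k` gives `X ~ M R ^ (2 k)`, because `R ^ (3 k)
= ±1`. -/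
theorem inequivalent_insert {N : ℕ} {t : Finset SL(2, ℤ)} (ht : Inequivalent N t) {X : SL(2, ℤ)}
    (hX : ¬ Represented N t X) : Inequivalent N (insert X t) := by
  intro M hM M' hM' k hk
  rcases Finset.mem_insert.1 hM with h1 | h1 <;> rcases Finset.mem_insert.1 hM' with h2 | h2
  · rw [h1, h2]
  · exact absurd ⟨M', h2, k, h1 ▸ hk⟩ hX
  · subst h2
    refine absurd ⟨M, h1, k * 2, ?_⟩ hX
    have h1 := (hk.mul_right (R ^ (k * 2))).symm
    rw [mul_assoc, ← pow_add, show k + k * 2 = 3 * k by ring, pow_mul, R_cube] at h1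
    rcases neg_one_pow_eq_or SL(2, ℤ) k with h | h <;> rw [h] at h1
    · rwa [mul_one] at h1
    · rwa [mul_neg, mul_one, SameCoset.neg_left_iff] at h1
  · exact ht M h1 M' h2 k hk

/-- A coset fixed by a rotation of order three would need `N ∣ c² + c d + d²`, which is odd for
coprime `c, d`. -/
theorem not_sameCoset_mul_R {N : ℕ} (hN : 2 ∣ N) (M : SL(2, ℤ)) {k : ℕ}
    (h : SameCoset N M (M * R ^ k)) : 3 ∣ k := by
  have h2 : (2 : ℤ) ∣ N := by exact_mod_cast hN
  have hpar : ¬ (2 : ℤ) ∣ M 1 0 ^ 2 + M 1 0 * M 1 1 + M 1 1 ^ 2 := by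
    have hc := sl_row_isCoprime M
    have hodd : ¬ ((2 : ℤ) ∣ M 1 0 ∧ 2 ∣ M 1 1) := by
      rintro ⟨h4, h5⟩
      have := hc.isUnit_of_dvd' h4 h5
      rw [Int.isUnit_iff] at this
      omega
    rcases Int.even_or_odd' (M 1 0) with ⟨a, ha | ha⟩ <;>
    rcases Int.even_or_odd' (M 1 1) with ⟨b, hb | hb⟩ <;> rw [ha, hb] at hodd ⊢ <;>
    ring_nf at hodd ⊢ <;> omega
  rw [SameCoset.mul_R_pow_mod_iff] at h
  have h3 : k % 3 < 3 := Nat.mod_lt _ (by norm_num)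
  rw [Nat.dvd_iff_mod_eq_zero]
  by_contra hk
  rw [SameCoset.iff_dvd] at h
  apply hpar
  refine h2.trans ?_
  have hk' : k % 3 = 1 ∨ k % 3 = 2 := by omega
  rcases hk' with hk' | hk' <;> rw [hk'] at h
  · rw [pow_one, (sl_R_row M).1, (sl_R_row M).2] at h
    exact h.trans (dvd_of_eq (by ring))
  · rw [(sl_R_sq_row M).1, (sl_R_sq_row M).2] at h
    exact h.trans (dvd_of_eq (by ring))

theorem Inequivalent.eq_and_eq {N : ℕ} (hN : 2 ∣ N) {t : Finset SL(2, ℤ)} (ht : Inequivalent N t)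
    {M M' : SL(2, ℤ)} (hM : M ∈ t) (hM' : M' ∈ t) {j k : ℕ} (hj : j < 3) (hk : k < 3)
    (h : SameCoset N (M * R ^ j) (M' * R ^ k)) : M = M' ∧ j = k := by
  have h1 := h.mul_right (R ^ (3 - j))
  rw [mul_assoc, mul_assoc, ← pow_add, ← pow_add, show j + (3 - j) = 3 by omega, R_cube, mul_neg,
    mul_one, SameCoset.neg_left_iff] at h1
  have h2 := ht M hM M' hM' _ h1
  refine ⟨h2, ?_⟩
  rw [← h2] at h1
  have := not_sameCoset_mul_R hN M h1
  omega

/-- This bound makes maximal dissections exist. Inverses pass from right cosets to the left cosets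
of the quotient. -/
theorem Inequivalent.card_le {N : ℕ} [NeZero N] {t : Finset SL(2, ℤ)} (ht : Inequivalent N t) :
    t.card ≤ (Gamma0 N).index := by
  have : Fintype (SL(2, ℤ) ⧸ Gamma0 N) := Subgroup.fintypeQuotientOfFiniteIndex
  rw [Subgroup.index, Nat.card_eq_fintype_card, ← Finset.card_univ]
  refine Finset.card_le_card_of_injOn (fun M => (M⁻¹ : SL(2, ℤ))) (by simp) ?_
  intro M hM M' hM' h
  have h1 := QuotientGroup.eq.1 h
  rw [inv_inv] at h1
  exact ht M hM M' hM' 0 (by rw [pow_zero, mul_one]; exact h1)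

/-! ### Missing cosets have no short vectors -/

namespace Dissection

variable {l : List SL(2, ℤ)} {t : Finset SL(2, ℤ)}

/-- Euclid's algorithm: subtracting the smaller entry of the row from the larger one leads to the
parent triangle. Going back down, a child with small denominators cannot be a side, so it is a
triangle of `t`. -/
theorem exists_triangle_of_row (hd : Dissection l t) {N : ℤ}
    (hl : ∀ X ∈ l, N < (X 1 0 + X 1 1) ^ 2) :
    ∀ m : ℕ, ∀ c d : ℤ, c + d = m → 0 ≤ c → 0 < d → IsCoprime c d → (c + d) ^ 2 ≤ N →
      ∃ M ∈ t, M 1 0 = c ∧ M 1 1 = d := by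
  intro m
  induction m using Nat.strong_induction_on with
  | _ m ih =>
    intro c d hm hc hd0 hcop hN
    rcases hc.eq_or_lt with rfl | hc
    · have : d = 1 := by
        rw [isCoprime_zero_left, Int.isUnit_iff] at hcop; omega
      exact ⟨1, hd.one_mem, rfl, by rw [this]; rfl⟩
    have key : ∀ X : SL(2, ℤ), X 1 0 = c → X 1 1 = d → X ∉ l := by
      rintro X rfl rfl hX
      have := hl X hX
      omega
    rcases lt_trichotomy c d with hcd | rfl | hcd
    · obtain ⟨M, hM, h1, h2⟩ := ih (d : ℤ).toNat (by omega) c (d - c) (by omega) hc.le (by omega)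
        (by simpa [sub_eq_add_neg] using (IsCoprime.add_mul_left_right_iff (z := -1)).2 hcop)
        (by nlinarith)
      have hrow := sl_T_row M
      have hT : M * T ∉ l := key _ (by omega) (by omega)
      rcases (hd.child M hM).2 with rfl | h | h
      · simp at h1; omega
      · exact ⟨_, h, by omega, by omega⟩
      · exact absurd h hT
    · have : c = 1 := by
        rw [isCoprime_self, Int.isUnit_iff] at hcop; omega
      subst this
      have hU : (1 : SL(2, ℤ)) * U ∉ l := key _ (by simp) (by simp)
      rcases (hd.child 1 hd.one_mem).1 with h | h
      · exact ⟨_, h, by simp, by simp⟩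
      · exact absurd h hU
    · obtain ⟨M, hM, h1, h2⟩ := ih (c : ℤ).toNat (by omega) (c - d) d (by omega) (by omega) hd0
        (by simpa [sub_eq_add_neg] using (IsCoprime.add_mul_right_left_iff (z := -1)).2 hcop)
        (by nlinarith)
      have hrow := sl_U_row M
      have hU : M * U ∉ l := key _ (by omega) (by omega)
      rcases (hd.child M hM).1 with h | h
      · exact ⟨_, h, by omega, by omega⟩
      · exact absurd h hU

/-- A coset without a short vector is one that does not contain a triangle with small
denominators. -/
theorem noShort_of_forall (hd : Dissection l t) {n : ℕ} (hn : 2 ≤ n)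
    (hl : ∀ X ∈ l, (2 ^ n : ℤ) < (X 1 0 + X 1 1) ^ 2) {g : SL(2, ℤ)}
    (hg : ∀ M ∈ t, (M 1 0 + M 1 1) ^ 2 ≤ (2 ^ n : ℤ) → ∀ k : ℕ, ¬ SameCoset (2 ^ n) g (M * R ^ k)) :
    NoShort (2 ^ n) (g 1 0) (g 1 1) := by
  have h4 : (4 : ℤ) ≤ 2 ^ n := by
    calc (4 : ℤ) = 2 ^ 2 := by norm_num
      _ ≤ 2 ^ n := pow_le_pow_right₀ (by norm_num) hn
  have main : ∀ c d : ℤ, IsCoprime c d → 0 ≤ c → 0 < d → (c + d) ^ 2 ≤ (2 ^ n : ℤ) →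
      ¬ (2 ^ n : ℤ) ∣ g 1 0 * d - g 1 1 * c ∧ ¬ (2 ^ n : ℤ) ∣ g 1 0 * (c + d) - g 1 1 * (-d) ∧
        ¬ (2 ^ n : ℤ) ∣ g 1 0 * c - g 1 1 * (-(c + d)) := by
    intro c d hcd hc hd0 hN
    obtain ⟨M, hM, rfl, rfl⟩ := hd.exists_triangle_of_row hl (c + d).toNat c d (by omega) hc hd0
      hcd hN
    have h0 := hg M hM hN 0
    have h1 := hg M hM hN 1
    have h2 := hg M hM hN 2
    rw [SameCoset.iff_dvd] at h0 h1 h2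
    rw [pow_zero, mul_one] at h0
    rw [pow_one, (sl_R_row M).1, (sl_R_row M).2] at h1
    rw [(sl_R_sq_row M).1, (sl_R_sq_row M).2] at h2
    push_cast at h0 h1 h2
    exact ⟨h0, h1, h2⟩
  -- One of the three rotations of the hexagonal norm brings the vector into the sector `p, q ≥ 0`,
  -- where it is the row of a Farey triangle.
  have main' : ∀ p q : ℤ, IsCoprime p q → 0 ≤ q → (2 ^ n : ℤ) ∣ p * g 1 1 - q * g 1 0 →
      (2 ^ n : ℤ) < p ^ 2 ∨ (2 ^ n : ℤ) < q ^ 2 ∨ (2 ^ n : ℤ) < (p + q) ^ 2 := by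
    intro p q hpq hq hdvd
    by_contra hcon
    push Not at hcon
    rw [← dvd_neg] at hdvd
    have e0 : -(p * g 1 1 - q * g 1 0) = g 1 0 * q - g 1 1 * p := by ring
    rw [e0] at hdvd
    rcases le_or_gt 0 p with hp | hp
    · rcases hq.eq_or_lt with rfl | hq
      · have hp1 : p = 1 := by
          rw [isCoprime_zero_right, Int.isUnit_iff] at hpq; omega
        subst hp1
        refine (main 0 1 isCoprime_one_right le_rfl one_pos (by linarith)).2.2 ?_
        rw [← dvd_neg]; simpa using hdvd
      · exact (main p q hpq hp hq hcon.2.2).1 hdvd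
    · rcases le_or_gt 0 (p + q) with hs | hs
      · refine (main (p + q) (-p) ?_ hs (by omega) (by simpa using hcon.2.1)).2.1 ?_
        · rw [IsCoprime.neg_right_iff]
          simpa [add_comm] using (IsCoprime.add_mul_left_left_iff (z := 1)).2 hpq.symm
        · simpa using hdvd
      · refine (main q (-(p + q)) ?_ hq (by omega) (by simpa using hcon.1)).2.2 ?_
        · rw [IsCoprime.neg_right_iff]
          simpa using (IsCoprime.add_mul_left_right_iff (z := 1)).2 hpq.symm
        · simpa using hdvd
  have main'' : ∀ p q : ℤ, IsCoprime p q → (2 ^ n : ℤ) ∣ p * g 1 1 - q * g 1 0 →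
      (2 ^ n : ℤ) < p ^ 2 ∨ (2 ^ n : ℤ) < q ^ 2 ∨ (2 ^ n : ℤ) < (p + q) ^ 2 := by
    intro p q hpq hdvd
    rcases le_total 0 q with hq | hq
    · exact main' p q hpq hq hdvd
    · have := main' (-p) (-q) hpq.neg_neg (by omega) (by
        rw [← dvd_neg]; exact hdvd.trans (dvd_of_eq (by ring)))
      rwa [neg_sq, neg_sq, ← neg_add, neg_sq] at this
  intro p q hdvd hodd
  have hpq0 : p ≠ 0 ∨ q ≠ 0 := by
    by_contra hcon
    push Not at hcon
    rw [hcon.1, hcon.2] at hodd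
    simp at hodd
  have he : 0 < p.gcd q := Int.gcd_pos_iff.2 hpq0
  obtain ⟨p', q', hcop, hp, hq⟩ := Int.exists_gcd_one he
  set e : ℤ := (p.gcd q : ℤ) with hedef
  have he1 : 1 ≤ e := by rw [hedef]; exact_mod_cast he
  -- The vector is not even, so its gcd is odd and can be cancelled modulo a power of two without
  -- leaving the lattice.
  have heodd : IsCoprime (2 ^ n : ℤ) e := by
    apply IsCoprime.pow_left
    rw [Int.isCoprime_iff_gcd_eq_one]
    have h2 : ¬ (2 : ℤ) ∣ e := fun h => hodd ⟨by rw [hp]; exact h.mul_left _,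
      by rw [hq]; exact h.mul_left _⟩
    have : IsCoprime (2 : ℤ) e := (Int.prime_two.coprime_iff_not_dvd).2 h2
    exact Int.isCoprime_iff_gcd_eq_one.1 this
  have hdvd' : (2 ^ n : ℤ) ∣ p' * g 1 1 - q' * g 1 0 := by
    refine heodd.dvd_of_dvd_mul_right (z := _) ?_
    refine hdvd.trans (dvd_of_eq ?_)
    conv_lhs => rw [hp, hq]
    ring
  have hle : ∀ x : ℤ, x ^ 2 ≤ (x * e) ^ 2 := fun x => by
    rw [mul_pow]; nlinarith [mul_nonneg (sq_nonneg x) (by nlinarith : (0 : ℤ) ≤ e ^ 2 - 1)]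
  have := main'' p' q' (Int.isCoprime_iff_gcd_eq_one.2 hcop) hdvd'
  rw [hp, hq, ← add_mul]
  rcases this with h | h | h
  · exact Or.inl (h.trans_le (hle _))
  · exact Or.inr (Or.inl (h.trans_le (hle _)))
  · exact Or.inr (Or.inr (h.trans_le (hle _)))

theorem noShort_of_not_represented (hd : Dissection l t) {n : ℕ} (hn : 2 ≤ n)
    (hl : ∀ X ∈ l, (2 ^ n : ℤ) < (X 1 0 + X 1 1) ^ 2) {g : SL(2, ℤ)}
    (hg : ¬ Represented (2 ^ n) t g) : NoShort (2 ^ n) (g 1 0) (g 1 1) :=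
  hd.noShort_of_forall hn hl fun M hM _ k hk => hg ⟨M, hM, k, hk⟩

theorem noShort_of_mem (hd : Dissection l t) {n : ℕ} (hn : 2 ≤ n)
    (hl : ∀ X ∈ l, (2 ^ n : ℤ) < (X 1 0 + X 1 1) ^ 2) (ht : Inequivalent (2 ^ n) t) {M : SL(2, ℤ)}
    (hM : M ∈ t) (hlarge : (2 ^ n : ℤ) < (M 1 0 + M 1 1) ^ 2) :
    NoShort (2 ^ n) (M 1 0) (M 1 1) := by
  refine hd.noShort_of_forall hn hl fun M' hM' h k hk => ?_
  rw [ht M hM M' hM' k hk] at hlarge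
  omega

end Dissection

/-! ### Extremal dissections -/

theorem exists_card_max {α β : Type*} {Q : List α → Finset β → Prop} {l₀ : List α} {t₀ : Finset β}
    (h₀ : Q l₀ t₀) {B : ℕ} (hB : ∀ l t, Q l t → t.card ≤ B) :
    ∃ l t, Q l t ∧ ∀ l' t', Q l' t' → t'.card ≤ t.card := by
  have hne : {k | ∃ l t, Q l t ∧ t.card = k}.Nonempty := ⟨_, l₀, t₀, h₀, rfl⟩
  have hbdd : BddAbove {k | ∃ l t, Q l t ∧ t.card = k} := ⟨B, by rintro k ⟨l, t, h, rfl⟩; exact hB l t h⟩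
  obtain ⟨l, t, h, hk⟩ := Nat.sSup_mem hne hbdd
  refine ⟨l, t, h, fun l' t' h' => ?_⟩
  rw [hk]
  exact le_csSup hbdd ⟨l', t', h', rfl⟩

theorem eq_of_coprime_of_mul_eq {a b c d : ℤ} (hab : IsCoprime a b) (hcd : IsCoprime c d)
    (ha : 0 < a) (hc : 0 < c) (h : a * d = b * c) : a = c ∧ b = d := by
  have h1 : a ∣ c := hab.dvd_of_dvd_mul_left ⟨d, h.symm⟩
  have h2 : c ∣ a := hcd.dvd_of_dvd_mul_right ⟨b, by linarith⟩
  have h3 : a = c := Int.dvd_antisymm ha.le hc.le h1 h2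
  refine ⟨h3, ?_⟩
  subst h3
  rw [mul_comm b] at h
  exact (mul_left_cancel₀ ha.ne' h).symm

namespace Dissection

variable {l : List SL(2, ℤ)} {t : Finset SL(2, ℤ)}

theorem InUnitInterval.row_pos {X : SL(2, ℤ)} (h : InUnitInterval X) : 0 < X 1 0 ∧ 0 < X 1 1 :=
  ⟨h.2.2.1.trans_le h.2.2.2, h.1.trans_lt h.2.1⟩

theorem InUnitInterval.eq_of_row_eq {X Y : SL(2, ℤ)} (hX : InUnitInterval X) (hY : InUnitInterval Y)
    (h0 : X 1 0 = Y 1 0) (h1 : X 1 1 = Y 1 1) : X = Y := by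
  have hd := hX.row_pos.2
  obtain ⟨hX1, hX2, -, -⟩ := hX
  obtain ⟨hY1, hY2, -, -⟩ := hY
  have e1 := sl_det X
  have e2 := sl_det Y
  rw [← h0, ← h1] at e2
  rw [← h1] at hY2
  have h2 : (X 0 0 - Y 0 0) * X 1 1 = (X 0 1 - Y 0 1) * X 1 0 := by linarith
  have h3 : X 1 1 ∣ X 0 1 - Y 0 1 :=
    (sl_row_isCoprime X).symm.dvd_of_dvd_mul_right ⟨X 0 0 - Y 0 0, by linarith⟩
  have h4 : X 0 1 - Y 0 1 = 0 := Int.eq_zero_of_abs_lt_dvd h3 (by rw [abs_lt]; constructor <;> linarith)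
  rw [h4, zero_mul] at h2
  have h5 : X 0 0 - Y 0 0 = 0 := by
    rcases mul_eq_zero.1 h2 with h | h
    · exact h
    · omega
  exact sl_ext (by omega) (by omega) h0 h1

/-- Equivalence means that `N` divides a bilinear expression in two rows. Rows with entry sums at
most `√N` make it too small in absolute value to be a nonzero multiple, so the rows are equal; the
root triangle is checked separately. -/
theorem not_represented_of_small (hd : Dissection l t) {N : ℕ}
    (ht : ∀ M ∈ t, M = 1 ∨ (M 1 0 + M 1 1) ^ 2 ≤ (N : ℤ)) {X : SL(2, ℤ)} (hX : X ∈ l)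
    (hXN : (X 1 0 + X 1 1) ^ 2 ≤ (N : ℤ)) : ¬ Represented N t X := by
  rintro ⟨M, hM, k, hk⟩
  rw [SameCoset.mul_R_pow_mod_iff, SameCoset.iff_dvd] at hk
  have hk3 : k % 3 < 3 := Nat.mod_lt _ (by norm_num)
  have hXu := hd.inUnitInterval_side X hX
  obtain ⟨hc, hd0⟩ := hXu.row_pos
  have hlt : ∀ x : ℤ, (N : ℤ) ∣ x → 0 < x → (N : ℤ) ≤ x := fun x h h' => Int.le_of_dvd h' h
  rcases ht M hM with rfl | hMN
  · interval_cases (k % 3)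
    · rw [pow_zero, mul_one] at hk
      have := hlt _ hk (by simpa using hc)
      simp at this
      nlinarith
    · rw [pow_one, (sl_R_row 1).1, (sl_R_row 1).2] at hk
      have := hlt _ hk (by simp; linarith)
      simp at this
      nlinarith
    · rw [(sl_R_sq_row 1).1, (sl_R_sq_row 1).2] at hk
      have := hlt _ hk (by simpa using hd0)
      simp at this
      nlinarith
  rcases hd.inUnitInterval_triangle M hM with rfl | hMu
  · simp at hMN
    interval_cases (k % 3)
    · rw [pow_zero, mul_one] at hk
      have := hlt _ hk (by simpa using hc)
      simp at this
      nlinarith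
    · rw [pow_one, (sl_R_row 1).1, (sl_R_row 1).2] at hk
      have := hlt _ hk (by simp; linarith)
      simp at this
      nlinarith
    · rw [(sl_R_sq_row 1).1, (sl_R_sq_row 1).2] at hk
      have := hlt _ hk (by simpa using hd0)
      simp at this
      nlinarith
  obtain ⟨hc', hd'⟩ := hMu.row_pos
  have h1 := mul_pos hc hc'
  have h2 := mul_pos hc hd'
  have h3 := mul_pos hd0 hc'
  have h4 := mul_pos hd0 hd'
  have hprod : (X 1 0 + X 1 1) * (M 1 0 + M 1 1) ≤ N := by
    nlinarith [sq_nonneg (X 1 0 + X 1 1 - (M 1 0 + M 1 1))]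
  interval_cases (k % 3)
  · rw [pow_zero, mul_one] at hk
    have := Int.eq_zero_of_abs_lt_dvd hk (by rw [abs_lt]; constructor <;> nlinarith)
    obtain ⟨e1, e2⟩ := eq_of_coprime_of_mul_eq (sl_row_isCoprime X) (sl_row_isCoprime M) hc hc'
      (by linarith)
    exact hd.not_mem_of_side hX (hXu.eq_of_row_eq hMu e1 e2 ▸ hM)
  · rw [pow_one, (sl_R_row M).1, (sl_R_row M).2] at hk
    have := hlt _ hk (by nlinarith)
    nlinarith
  · rw [(sl_R_sq_row M).1, (sl_R_sq_row M).2] at hk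
    have := hlt _ hk (by nlinarith)
    nlinarith

theorem _root_.four_le_two_pow {n : ℕ} (hn : 2 ≤ n) : (4 : ℤ) ≤ 2 ^ n := by
  calc (4 : ℤ) = 2 ^ 2 := by norm_num
    _ ≤ 2 ^ n := pow_le_pow_right₀ (by norm_num) hn

theorem _root_.two_pow_eq {n : ℕ} (hn : 2 ≤ n) : (2 : ℤ) ^ n = 2 * 2 ^ (n - 1) := by
  rw [← pow_succ']; congr 1; omega

theorem exists_farey_dissection {n : ℕ} :
    ∃ l t, Dissection l t ∧ Inequivalent (2 ^ n) t ∧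
      (∀ M ∈ t, M = 1 ∨ (M 1 0 + M 1 1) ^ 2 ≤ (2 ^ n : ℤ)) ∧
      ∀ X ∈ l, (2 ^ n : ℤ) < (X 1 0 + X 1 1) ^ 2 := by
  let Q : List SL(2, ℤ) → Finset SL(2, ℤ) → Prop := fun l t =>
    Dissection l t ∧ Inequivalent (2 ^ n) t ∧ ∀ M ∈ t, M = 1 ∨ (M 1 0 + M 1 1) ^ 2 ≤ (2 ^ n : ℤ)
  have h₀ : Q [U] {1} := ⟨.base, by intro M hM M' hM'; simp_all, by simp⟩
  obtain ⟨l, t, ⟨hd, hi, hs⟩, hmax⟩ := exists_card_max h₀ (fun l t h => h.2.1.card_le)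
  refine ⟨l, t, hd, hi, hs, fun X hX => ?_⟩
  by_contra hcon
  push Not at hcon
  have hnr : ¬ Represented (2 ^ n) t X :=
    hd.not_represented_of_small (by simpa using hs) hX (by simpa using hcon)
  have hXt := hd.not_mem_of_side hX
  obtain ⟨l₁, l₂, rfl⟩ := List.append_of_mem hX
  have := hmax _ _ ⟨hd.split, inequivalent_insert hi hnr, by
    intro M hM
    rcases Finset.mem_insert.1 hM with rfl | hM
    · exact Or.inr hcon
    · exact hs M hM⟩
  rw [Finset.card_insert_of_notMem hXt] at this
  omega

/-- Triangles are added to the `√N` stage as long as their largest denominator is at most `N / 2`. A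
side that blocks further growth is represented or has too large an outer triangle. -/
theorem exists_maximal_dissection {n : ℕ} (hn : 2 ≤ n) :
    ∃ l t, Dissection l t ∧ Inequivalent (2 ^ n) t ∧
      (∀ M ∈ t, M = 1 ∨ M 1 0 + M 1 1 ≤ (2 ^ (n - 1) : ℤ)) ∧
      (∀ X ∈ l, (2 ^ n : ℤ) < (X 1 0 + X 1 1) ^ 2) ∧
      ∀ X ∈ l, Represented (2 ^ n) t X ∨ (2 ^ (n - 1) : ℤ) < X 1 0 + X 1 1 := by
  let Q : List SL(2, ℤ) → Finset SL(2, ℤ) → Prop := fun l t =>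
    Dissection l t ∧ Inequivalent (2 ^ n) t ∧
      (∀ M ∈ t, M = 1 ∨ M 1 0 + M 1 1 ≤ (2 ^ (n - 1) : ℤ)) ∧
      (∀ X ∈ l, (2 ^ n : ℤ) < (X 1 0 + X 1 1) ^ 2)
  obtain ⟨l₀, t₀, hd₀, hi₀, hs₀, hl₀⟩ := exists_farey_dissection (n := n)
  -- The `√N` stage obeys the new bound because `√N ≤ N / 2` for `N ≥ 4`.
  have h₀ : Q l₀ t₀ := by
    refine ⟨hd₀, hi₀, fun M hM => (hs₀ M hM).imp_right fun h => ?_, hl₀⟩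
    have h4 := four_le_two_pow hn
    have h2 := two_pow_eq hn
    nlinarith
  obtain ⟨l, t, ⟨hd, hi, hs, hl⟩, hmax⟩ := exists_card_max h₀ (fun l t h => h.2.1.card_le)
  refine ⟨l, t, hd, hi, hs, hl, fun X hX => ?_⟩
  by_contra hcon
  push Not at hcon
  have hXt := hd.not_mem_of_side hX
  have hpos := (hd.inUnitInterval_side X hX).row_pos
  have hXN := hl X hX
  obtain ⟨l₁, l₂, rfl⟩ := List.append_of_mem hX
  have := hmax _ _ ⟨hd.split, inequivalent_insert hi hcon.1, by
    intro M hM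
    rcases Finset.mem_insert.1 hM with rfl | hM
    · exact Or.inr hcon.2
    · exact hs M hM, by
    intro Y hY
    simp only [List.mem_append, List.mem_cons] at hY hl
    rcases hY with hY | rfl | rfl | hY
    · exact hl Y (Or.inl hY)
    · rw [(sl_U_row X).1, (sl_U_row X).2]; nlinarith
    · rw [(sl_T_row X).1, (sl_T_row X).2]; nlinarith
    · exact hl Y (Or.inr (Or.inr hY))⟩
  rw [Finset.card_insert_of_notMem hXt] at this
  omega

/-! ### No coset is missing from a maximal dissection -/

/-- Across an edge of a triangle lies its parent, a child or the outside of a side. The vertical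
edges of the root triangle lead back to it, by translation. -/
theorem represented_or_side (hd : Dissection l t) (N : ℕ) {M : SL(2, ℤ)} (hM : M ∈ t) (k : ℕ) :
    Represented N t (M * R ^ k * S) ∨ ∃ X ∈ l, SameCoset N (M * R ^ k * S) X := by
  have hmod : SameCoset N (M * R ^ k * S) (M * R ^ (k % 3) * S) :=
    ((SameCoset.mul_R_pow_mod_iff k).1 (SameCoset.refl _)).mul_right S
  suffices Represented N t (M * R ^ (k % 3) * S) ∨ ∃ X ∈ l, SameCoset N (M * R ^ (k % 3) * S) X by
    rcases this with h | ⟨X, hX, h⟩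
    · exact Or.inl (h.of_sameCoset hmod)
    · exact Or.inr ⟨X, hX, hmod.trans h⟩
  have hk3 : k % 3 < 3 := Nat.mod_lt _ (by norm_num)
  have hmem : ∀ M ∈ t, Represented N t M := fun M hM =>
    ⟨M, hM, 0, by rw [pow_zero, mul_one]; exact SameCoset.refl _⟩
  interval_cases (k % 3)
  · rw [pow_zero, mul_one]
    left
    rcases hd.parent_triangle M hM with rfl | ⟨M', hM', rfl | ⟨-, rfl⟩⟩
    · refine ⟨1, hd.one_mem, 2, ?_⟩
      rw [SameCoset.iff_dvd, (sl_R_sq_row 1).1, (sl_R_sq_row 1).2]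
      simp
    · refine ⟨M', hM', 1, ?_⟩
      rw [mul_assoc, U_mul_S, mul_neg, SameCoset.neg_left_iff, pow_one]
      exact SameCoset.refl _
    · refine ⟨M', hM', 2, ?_⟩
      rw [mul_assoc, T_mul_S, mul_neg, SameCoset.neg_left_iff]
      exact SameCoset.refl _
  · rw [pow_one, mul_assoc, R_mul_S]
    rcases (hd.child M hM).1 with h | h
    · exact Or.inl (hmem _ h)
    · exact Or.inr ⟨_, h, SameCoset.refl _⟩
  · rw [mul_assoc, R_sq_mul_S]
    rcases (hd.child M hM).2 with rfl | h | h
    · left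
      refine (hmem 1 hd.one_mem).of_sameCoset ?_
      rw [SameCoset.iff_dvd]
      simp
    · exact Or.inl (hmem _ h)
    · exact Or.inr ⟨_, h, SameCoset.refl _⟩

/-- Descent to the parent triangle until its largest denominator is at most `√N`. The exceptional
case `N ∣ (a + b)²` of the step would make `X` equivalent to its parent. -/
theorem hasEvenPartner (hd : Dissection l t) {n : ℕ} (hn : 2 ≤ n) (ht : Inequivalent (2 ^ n) t)
    (hl : ∀ X ∈ l, (2 ^ n : ℤ) < (X 1 0 + X 1 1) ^ 2) (m : ℕ) :
    ∀ X : SL(2, ℤ), X 1 0 + X 1 1 = m → (X ∈ t ∨ (X ∈ l ∧ ¬ Represented (2 ^ n) t X)) →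
      (2 ^ n : ℤ) < (X 1 0 + X 1 1) ^ 2 → HasEvenPartner (2 ^ n) (X 1 0) (X 1 1) := by
  induction m using Nat.strong_induction_on with
  | _ m ih =>
    intro X hm hX hN
    have h4 := four_le_two_pow hn
    have hns : NoShort (2 ^ n) (X 1 0) (X 1 1) := by
      rcases hX with hX | hX
      · exact hd.noShort_of_mem hn hl ht hX hN
      · exact hd.noShort_of_not_represented hn hl hX.2
    have hpar : X = 1 ∨ ∃ M ∈ t, X = M * U ∨ (M ≠ 1 ∧ X = M * T) := by
      rcases hX with hX | hX
      · exact hd.parent_triangle X hX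
      · exact Or.inr (hd.parent_side X hX.1)
    have h2 : (2 : ℤ) ∣ 2 ^ n := dvd_pow_self 2 (by omega)
    rcases hpar with rfl | ⟨M, hM, hXM⟩
    · simp at hN; omega
    rcases hd.inUnitInterval_triangle M hM with rfl | hMu
    · rcases hXM with rfl | ⟨h, -⟩
      · simp at hN; omega
      · exact absurd rfl h
    obtain ⟨ha, hb⟩ := hMu.row_pos
    have hcop := sl_row_isCoprime M
    have hneq : ∀ k : ℕ, X 1 0 + X 1 1 ≠ M 1 0 + M 1 1 → ¬ SameCoset (2 ^ n) X (M * R ^ k) := by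
      intro k hsum h
      rcases hX with hX | hX
      · exact hsum (by rw [ht X hX M hM k h])
      · exact hX.2 ⟨M, hM, k, h⟩
    rcases hXM with rfl | ⟨-, rfl⟩
    · have hrow := sl_U_row M
      have hcop' := sl_row_isCoprime (M * U)
      rw [hrow.1, hrow.2] at hns hN hm hcop' ⊢
      by_cases hsm : (M 1 0 + M 1 1) ^ 2 ≤ (2 ^ n : ℤ)
      · exact hasEvenPartner_of_farey_side h2 (by omega) hb hsm (by nlinarith) hN hcop' hns
      · push Not at hsm
        refine (ih (M 1 0 + M 1 1).toNat (by omega) M (by omega) (Or.inl hM) hsm).step' ha hb hcop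
          (hd.noShort_of_mem hn hl ht hM hsm) hns (fun hdvd => ?_) hsm
        refine hneq 2 (by omega) ?_
        rw [SameCoset.iff_dvd, (sl_R_sq_row M).1, (sl_R_sq_row M).2, hrow.1, hrow.2]
        push_cast
        exact hdvd.trans (dvd_of_eq (by ring))
    · have hrow := sl_T_row M
      have hcop' := sl_row_isCoprime (M * T)
      rw [hrow.1, hrow.2] at hns hN hm hcop' ⊢
      by_cases hsm : (M 1 0 + M 1 1) ^ 2 ≤ (2 ^ n : ℤ)
      · exact hasEvenPartner_of_farey_side h2 ha (by omega) (by nlinarith) hsm hN hcop' hns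
      · push Not at hsm
        refine (ih (M 1 0 + M 1 1).toNat (by omega) M (by omega) (Or.inl hM) hsm).step ha hb hcop
          (hd.noShort_of_mem hn hl ht hM hsm) hns (fun hdvd => ?_) hsm
        refine hneq 1 (by omega) ?_
        rw [pow_one, SameCoset.iff_dvd, (sl_R_row M).1, (sl_R_row M).2, hrow.1, hrow.2]
        push_cast
        exact hdvd.trans (dvd_of_eq (by ring))

/-- The coset of `g` contains no triangle of `t`, and its lattice contains the even vector `(x, y)`
as part of a basis, with small positive coordinates. -/
def FacesEvenVector (n : ℕ) (t : Finset SL(2, ℤ)) (g : SL(2, ℤ)) (x y : ℤ) : Prop :=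
  ¬ Represented (2 ^ n) t g ∧ 2 ∣ x ∧ 2 ∣ y ∧ 0 < x ∧ 0 < y ∧ x ^ 2 < 2 ^ n ∧ y ^ 2 < 2 ^ n ∧
    (2 ^ n : ℤ) ∣ x * g 1 1 - y * g 1 0 ∧ ∃ v₁ v₂ : ℤ, (2 ^ n : ℤ) ∣ v₁ * g 1 1 - v₂ * g 1 0 ∧
      ¬ (2 ∣ v₁ ∧ 2 ∣ v₂) ∧ (v₁ * y - v₂ * x = 2 ^ n ∨ v₁ * y - v₂ * x = -2 ^ n)

theorem _root_.sl_row_odd (g : SL(2, ℤ)) : ¬ ((2 : ℤ) ∣ g 1 0 ∧ 2 ∣ g 1 1) := by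
  rintro ⟨h4, h5⟩
  have := (sl_row_isCoprime g).isUnit_of_dvd' h4 h5
  rw [Int.isUnit_iff] at this
  omega

/-- A missing side has `c + d > N / 2`, while an even growing vector would give `N = c y + d x ≥ 2
(c + d)`. This is where the bound `2ⁿ⁻¹` enters. -/
theorem exists_bounded_partner (hd : Dissection l t) {n : ℕ} (hn : 2 ≤ n)
    (ht : Inequivalent (2 ^ n) t) (hl : ∀ X ∈ l, (2 ^ n : ℤ) < (X 1 0 + X 1 1) ^ 2)
    (hmax : ∀ X ∈ l, Represented (2 ^ n) t X ∨ (2 ^ (n - 1) : ℤ) < X 1 0 + X 1 1) {X : SL(2, ℤ)}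
    (hX : X ∈ l) (hXr : ¬ Represented (2 ^ n) t X) :
    ∃ x y : ℤ, 2 ∣ x ∧ 2 ∣ y ∧ 0 < x ∧ 0 < y ∧
      (X 1 0 * y - X 1 1 * x = 2 ^ n ∨ X 1 0 * y - X 1 1 * x = -2 ^ n) ∧ x ^ 2 < 2 ^ n ∧
      y ^ 2 < 2 ^ n := by
  have hpos := (hd.inUnitInterval_side X hX).row_pos
  obtain ⟨x, y, hx, hy, hx0, hy0, ⟨h1, -, -⟩ | h⟩ := hd.hasEvenPartner hn ht hl
    (X 1 0 + X 1 1).toNat X (by omega) (Or.inr ⟨hX, hXr⟩) (hl X hX)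
  · exfalso
    have h2 := (hmax X hX).resolve_left hXr
    have h3 := two_pow_eq hn
    have hx2 : 2 ≤ x := Int.le_of_dvd hx0 hx
    have hy2 : 2 ≤ y := Int.le_of_dvd hy0 hy
    nlinarith
  · exact ⟨x, y, hx, hy, hx0, hy0, h⟩

theorem facesEvenVector_mul_T (hd : Dissection l t) {n : ℕ} (hn : 2 ≤ n)
    (ht : Inequivalent (2 ^ n) t) (hl : ∀ X ∈ l, (2 ^ n : ℤ) < (X 1 0 + X 1 1) ^ 2)
    (hmax : ∀ X ∈ l, Represented (2 ^ n) t X ∨ (2 ^ (n - 1) : ℤ) < X 1 0 + X 1 1) {g : SL(2, ℤ)}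
    {x y : ℤ} (hg : FacesEvenVector n t g x y) : FacesEvenVector n t (g * T) x (x + y) := by
  obtain ⟨hr, hx, hy, hx0, hy0, hxN, hyN, hD, v₁, v₂, hv, hodd, hvD⟩ := hg
  have hns := hd.noShort_of_not_represented hn hl hr
  have hrow := sl_T_row g
  have hr' : ¬ Represented (2 ^ n) t (g * T) := by
    -- Since `T⁻¹ = S R`, the coset of `g` is a rotation of the neighbour across an edge of a
    -- triangle in `t`. If this neighbour is not represented, it lies outside a missing side, whose
    -- bounded even vector contradicts that of `g`.
    rintro ⟨M, hM, k, hk⟩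
    have hg := hk.mul_right T⁻¹
    rw [mul_inv_cancel_right, T_inv_eq, ← mul_assoc] at hg
    rcases hd.represented_or_side (2 ^ n) hM k with h | ⟨X, hX, h⟩
    · exact hr (h.mul_R.of_sameCoset hg)
    replace hg := hg.trans (h.mul_right R)
    have hXr : ¬ Represented (2 ^ n) t X := fun h => hr (h.mul_R.of_sameCoset hg)
    obtain ⟨x', y', hx', hy', hx0', hy0', hN', hxN', hyN'⟩ :=
      hd.exists_bounded_partner hn ht hl hmax hX hXr
    have hmem : (2 ^ n : ℤ) ∣ -y' * (X * R) 1 1 - (x' + y') * (X * R) 1 0 := by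
      rw [(sl_R_row X).1, (sl_R_row X).2]
      rcases hN' with h | h
      · exact ⟨-1, by linarith⟩
      · exact ⟨1, by linarith⟩
    rw [SameCoset.iff_dvd] at hg
    push_cast at hg
    refine not_noShort_of_two_even (dvd_pow_self 2 (by omega)) (sl_row_isCoprime g) hx hy hx' hy'
      hx0 hy0 hx0' hy0' hxN hyN hxN' hyN' hD
      (dvd_cross (sl_row_isCoprime (X * R)) hmem hg) hv hodd hvD
      (w₁ := (X * R) 1 0) (w₂ := (X * R) 1 1) ?_ ?_ hns
    · rw [← dvd_neg]; exact hg.trans (dvd_of_eq (by ring))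
    · rw [(sl_R_row X).1, (sl_R_row X).2]
      rcases hN' with h | h
      · left; linarith
      · right; linarith
  have hns' := hd.noShort_of_not_represented hn hl hr'
  rw [hrow.1, hrow.2] at hns'
  refine ⟨hr', hx, dvd_add hx hy, hx0, by linarith, hxN,
    add_sq_lt_of_noShort hns hns' hx hy hx0 hy0 hxN hyN hD hv hodd hvD, ?_, v₁, v₁ + v₂, ?_, ?_, ?_⟩
  · rw [hrow.1, hrow.2]; exact hD.trans (dvd_of_eq (by ring))
  · rw [hrow.1, hrow.2]; exact hv.trans (dvd_of_eq (by ring))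
  · omega
  · rcases hvD with h | h
    · left; linarith
    · right; linarith

theorem represented_of_maximal (hd : Dissection l t) {n : ℕ} (hn : 2 ≤ n)
    (ht : Inequivalent (2 ^ n) t) (hl : ∀ X ∈ l, (2 ^ n : ℤ) < (X 1 0 + X 1 1) ^ 2)
    (hmax : ∀ X ∈ l, Represented (2 ^ n) t X ∨ (2 ^ (n - 1) : ℤ) < X 1 0 + X 1 1) :
    ∀ X ∈ l, Represented (2 ^ n) t X := by
  intro X hX
  by_contra hXr
  -- Each multiplication by `T` adds `x ≥ 1` to `y`, although `y² < N` always holds.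
  have grow : ∀ K : ℕ, ∃ g x y, FacesEvenVector n t g x y ∧ (K : ℤ) ≤ y := by
    intro K
    induction K with
    | zero =>
      obtain ⟨x, y, hx, hy, hx0, hy0, hN, hxN, hyN⟩ :=
        hd.exists_bounded_partner hn ht hl hmax hX hXr
      refine ⟨X, x, y, ⟨hXr, hx, hy, hx0, hy0, hxN, hyN, ?_, X 1 0, X 1 1, ?_, sl_row_odd X, hN⟩,
        by simpa using hy0.le⟩
      · rcases hN with h | h
        · exact ⟨-1, by linarith⟩
        · exact ⟨1, by linarith⟩
      · exact ⟨0, by ring⟩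
    | succ K ih =>
      obtain ⟨g, x, y, hg, hK⟩ := ih
      refine ⟨g * T, x, x + y, hd.facesEvenVector_mul_T hn ht hl hmax hg, ?_⟩
      have := hg.2.2.2.1
      push_cast
      linarith
  obtain ⟨g, x, y, hg, hK⟩ := grow (2 ^ n)
  have h1 := hg.2.2.2.2.2.2.1
  push_cast at hK
  have : (0 : ℤ) < 2 ^ n := by positivity
  nlinarith

end Dissection

/-! ### Covering by translates and gluing of the sides -/

/-- `g` is moved by `H` to an oriented side of a triangle in `t`. -/
def ReachedBy (H : Subgroup SL(2, ℤ)) (t : Finset SL(2, ℤ)) (g : SL(2, ℤ)) : Prop :=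
  ∃ γ ∈ H, ∃ M ∈ t, ∃ k : ℕ, γ * g = M * R ^ k

namespace ReachedBy

variable {H : Subgroup SL(2, ℤ)} {t : Finset SL(2, ℤ)} {g : SL(2, ℤ)}

theorem of_mul_left {γ : SL(2, ℤ)} (hγ : γ ∈ H) (h : ReachedBy H t (γ * g)) : ReachedBy H t g := by
  obtain ⟨δ, hδ, M, hM, k, hk⟩ := h
  exact ⟨δ * γ, mul_mem hδ hγ, M, hM, k, by rw [mul_assoc, hk]⟩

theorem of_neg (hneg : -1 ∈ H) (h : ReachedBy H t (-g)) : ReachedBy H t g :=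
  of_mul_left hneg (by rwa [neg_one_mul])

theorem mul_R (h : ReachedBy H t g) : ReachedBy H t (g * R) := by
  obtain ⟨γ, hγ, M, hM, k, hk⟩ := h
  exact ⟨γ, hγ, M, hM, k + 1, by rw [← mul_assoc, hk, pow_succ, mul_assoc]⟩

end ReachedBy

namespace Dissection

variable {l : List SL(2, ℤ)} {t : Finset SL(2, ℤ)}

/-- Crossing an unoriented non-vertical side of a dissection leads to the triangle next to it. -/
theorem mul_S_of_child (hd : Dissection l t) {X : SL(2, ℤ)} (hX : X ∈ l ∨ X ∈ t ∧ X ≠ 1) :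
    ∃ M ∈ t, ∃ k : ℕ, k < 3 ∧ X * S = -(M * R ^ k) := by
  have h : ∃ M ∈ t, X = M * U ∨ (M ≠ 1 ∧ X = M * T) := by
    rcases hX with h | ⟨h, h1⟩
    · exact hd.parent_side X h
    · exact (hd.parent_triangle X h).resolve_left h1
  obtain ⟨M, hM, rfl | ⟨-, rfl⟩⟩ := h
  · exact ⟨M, hM, 1, by norm_num, by rw [mul_assoc, U_mul_S, pow_one, mul_neg]⟩
  · exact ⟨M, hM, 2, by norm_num, by rw [mul_assoc, T_mul_S, mul_neg]⟩

theorem cross_side (hd : Dissection l t) {M : SL(2, ℤ)} (hM : M ∈ t) {k : ℕ} (hk : k < 3) :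
    (∃ M' ∈ t, ∃ j : ℕ, j < 3 ∧ (M * R ^ k * S = M' * R ^ j ∨ M * R ^ k * S = -(M' * R ^ j))) ∨
      M * R ^ k * S ∈ l ∨ (M = 1 ∧ (k = 0 ∨ k = 2)) := by
  obtain ⟨hU, hT⟩ := hd.child M hM
  interval_cases k
  · by_cases h1 : M = 1
    · exact Or.inr (Or.inr ⟨h1, Or.inl rfl⟩)
    · obtain ⟨M', hM', k, hk, h⟩ := hd.mul_S_of_child (Or.inr ⟨hM, h1⟩)
      exact Or.inl ⟨M', hM', k, hk, Or.inr (by rw [pow_zero, mul_one, h])⟩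
  · rw [pow_one, mul_assoc, R_mul_S]
    rcases hU with h | h
    · exact Or.inl ⟨_, h, 0, by norm_num, Or.inl (by simp)⟩
    · exact Or.inr (Or.inl h)
  · rw [mul_assoc, R_sq_mul_S]
    rcases hT with h | h | h
    · exact Or.inr (Or.inr ⟨h, Or.inr rfl⟩)
    · exact Or.inl ⟨_, h, 0, by norm_num, Or.inl (by simp)⟩
    · exact Or.inr (Or.inl h)

/-- If the sides of a dissection are glued by elements of `H`, then the translates of its triangles
under `H` cover all triangles. -/
theorem reachedBy (hd : Dissection l t) {H : Subgroup SL(2, ℤ)} (hneg : -1 ∈ H) (hT : T ∈ H)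
    (hpair : ∀ X ∈ l, ∃ Y ∈ l, Y * S * X⁻¹ ∈ H) (g : SL(2, ℤ)) : ReachedBy H t g := by
  have base : ∀ M ∈ t, ∀ k : ℕ, ReachedBy H t (M * R ^ k) :=
    fun M hM k => ⟨1, H.one_mem, M, hM, k, one_mul _⟩
  have hS3 : ∀ M ∈ t, ∀ k : ℕ, k < 3 → ReachedBy H t (M * R ^ k * S) := by
    intro M hM k hk
    rcases hd.cross_side hM hk with ⟨M', hM', j, -, h | h⟩ | h | ⟨rfl, rfl | rfl⟩
    · rw [h]; exact base _ hM' j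
    · refine .of_neg hneg ?_
      rw [h, neg_neg]; exact base _ hM' j
    · obtain ⟨Y, hY, hYH⟩ := hpair _ h
      refine .of_mul_left hYH ?_
      rw [inv_mul_cancel_right]
      obtain ⟨M', hM', j, -, h'⟩ := hd.mul_S_of_child (Or.inl hY)
      refine .of_neg hneg ?_
      rw [h', neg_neg]; exact base _ hM' j
    · refine .of_mul_left hT (.of_neg hneg ?_)
      rw [pow_zero, mul_one, one_mul, T_mul_S, neg_neg]
      simpa using base 1 hM 2
    · refine .of_mul_left (inv_mem hT) ?_
      rw [one_mul, R_sq_mul_S, inv_mul_cancel]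
      simpa using base 1 hM 0
  have hS : ∀ M ∈ t, ∀ k : ℕ, ReachedBy H t (M * R ^ k * S) := by
    intro M hM k
    rw [← Nat.mod_add_div k 3, pow_add, pow_mul, R_cube]
    rcases neg_one_pow_eq_or SL(2, ℤ) (k / 3) with h | h <;> rw [h]
    · rw [mul_one]; exact hS3 M hM _ (Nat.mod_lt _ (by norm_num))
    · refine .of_neg hneg ?_
      simpa using hS3 M hM _ (Nat.mod_lt k (by norm_num))
  have mul_S : ∀ x, ReachedBy H t x → ReachedBy H t (x * S) := by
    rintro x ⟨γ, hγ, M, hM, k, hk⟩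
    refine .of_mul_left hγ ?_
    rw [← mul_assoc, hk]; exact hS M hM k
  have hg : g ∈ Subgroup.closure {S, T} := by
    rw [SpecialLinearGroup.SL2Z_generators]; trivial
  induction hg using Subgroup.closure_induction_right with
  | one => simpa using base 1 hd.one_mem 0
  | mul_right x y hx hy ih =>
    rcases hy with rfl | rfl
    · exact mul_S x ih
    · rw [← R_sq_mul_S, pow_two, ← mul_assoc, ← mul_assoc]
      exact mul_S _ ih.mul_R.mul_R
  | mul_inv_cancel x y hx hy ih =>
    rcases hy with rfl | rfl
    · refine .of_neg hneg ?_
      have : (S : SL(2, ℤ))⁻¹ = -S := by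
        rw [inv_eq_iff_mul_eq_one, mul_neg, S_mul_S, neg_neg]
      rw [this, mul_neg, neg_neg]
      exact mul_S x ih
    · rw [T_inv_eq, ← mul_assoc]
      exact (mul_S x ih).mul_R

theorem not_side_eq_triangle_mul (hd : Dissection l t) {X M : SL(2, ℤ)} (hX : X ∈ l) (hM : M ∈ t)
    {k : ℕ} (hk : k < 3) : X ≠ M * R ^ k ∧ X ≠ -(M * R ^ k) := by
  have h := hd.triangleApart X (by simp [hX]) M hM
  constructor
  · rintro rfl
    rw [mul_inv_rev, inv_mul_cancel_right] at h
    obtain ⟨h1, h2, h3⟩ := h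
    interval_cases k <;> simp [sl_inv_zero_zero, sl_inv_zero_one, sl_inv_one_zero, sl_inv_one_one,
      sl_mul_apply, pow_two] at h1 h2 h3
  · rintro rfl
    rw [← mul_neg, mul_inv_rev, inv_mul_cancel_right] at h
    obtain ⟨h1, h2, h3⟩ := h
    interval_cases k <;> simp [sl_inv_zero_zero, sl_inv_zero_one, sl_inv_one_zero, sl_inv_one_one,
      sl_mul_apply, pow_two] at h1 h2 h3

theorem side_le (hd : Dissection l t) {B : ℤ} (hB : 1 ≤ B)
    (ht : ∀ M ∈ t, M = 1 ∨ M 1 0 + M 1 1 ≤ B) {X : SL(2, ℤ)} (hX : X ∈ l) :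
    X 1 0 ≤ B ∧ X 1 1 ≤ B := by
  obtain ⟨M, hM, rfl | ⟨h1, rfl⟩⟩ := hd.parent_side X hX
  · rw [(sl_U_row M).1, (sl_U_row M).2]
    rcases ht M hM with rfl | h
    · simpa using hB
    · rcases hd.inUnitInterval_triangle M hM with rfl | hu
      · simpa using hB
      · have := hu.row_pos; omega
  · rw [(sl_T_row M).1, (sl_T_row M).2]
    have h := (ht M hM).resolve_left h1
    have := ((hd.inUnitInterval_triangle M hM).resolve_left h1).row_pos
    omega

/-- The sides of a maximal dissection are glued in pairs by elements of `Γ₀(N)`. -/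
theorem exists_partner (hd : Dissection l t) {N : ℕ} (hN : 2 ∣ N) (ht : Inequivalent N t)
    (hlt : ∀ X ∈ l, X 1 0 < N ∧ X 1 1 < N) (hr : ∀ X ∈ l, Represented N t X) {X : SL(2, ℤ)}
    (hX : X ∈ l) : ∃ Y ∈ l, SameCoset N (Y * S) X := by
  obtain ⟨M, hM, k, hk⟩ := hr X hX
  rw [SameCoset.mul_R_pow_mod_iff] at hk
  have hk3 : k % 3 < 3 := Nat.mod_lt _ (by norm_num)
  have hpos := (hd.inUnitInterval_side X hX).row_pos
  have hlt := hlt X hX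
  rcases hd.cross_side hM hk3 with ⟨M', hM', j, hj, h⟩ | h | ⟨rfl, h | h⟩
  · exfalso
    -- The triangle inside `X` would be equivalent, hence equal, to the one across the edge `M * R ^
    -- k`. Then `X` would be an oriented edge of a triangle inside, up to sign.
    obtain ⟨M₀, hM₀, i, hi, h₀⟩ := hd.mul_S_of_child (Or.inl hX)
    have h1 : SameCoset N (X * S) (M * R ^ (k % 3) * S) := hk.mul_right S
    have h2 : SameCoset N (X * S) (M' * R ^ j) := by
      rcases h with h | h <;> rw [h] at h1
      · exact h1
      · rwa [SameCoset.neg_right_iff] at h1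
    rw [h₀, SameCoset.neg_left_iff] at h2
    obtain ⟨rfl, rfl⟩ := ht.eq_and_eq hN hM₀ hM' hi hj h2
    obtain ⟨h3, h4⟩ := hd.not_side_eq_triangle_mul hX hM hk3
    rcases h with h | h
    · exact h4 (mul_right_cancel (b := S) (by rw [h₀, neg_mul, h]))
    · exact h3 (mul_right_cancel (b := S) (by rw [h₀, h]))
  · refine ⟨_, h, ?_⟩
    rw [mul_assoc, S_mul_S, mul_neg, mul_one, SameCoset.neg_left_iff]
    exact hk.symm
  -- For a vertical edge, `N` would divide a denominator of `X`, which lies strictly between `0` and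
  -- `N`.
  · exfalso
    rw [h, SameCoset.iff_dvd] at hk
    simp at hk
    have := Int.le_of_dvd hpos.1 hk
    omega
  · exfalso
    rw [h, SameCoset.iff_dvd] at hk
    simp [pow_two, sl_mul_apply] at hk
    have := Int.le_of_dvd hpos.2 hk
    omega

/-- `X * S` and `Y * S` are, up to sign, oriented edges of triangles in `t`, and these lie in
different cosets unless they coincide. -/
theorem partner_unique (hd : Dissection l t) {N : ℕ} (hN : 2 ∣ N) (ht : Inequivalent N t)
    {X Y : SL(2, ℤ)} (hX : X ∈ l) (hY : Y ∈ l) (h : SameCoset N (X * S) (Y * S)) : X = Y := by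
  obtain ⟨M, hM, i, hi, h₁⟩ := hd.mul_S_of_child (Or.inl hX)
  obtain ⟨M', hM', j, hj, h₂⟩ := hd.mul_S_of_child (Or.inl hY)
  rw [h₁, h₂, SameCoset.neg_left_iff, SameCoset.neg_right_iff] at h
  obtain ⟨rfl, rfl⟩ := ht.eq_and_eq hN hM hM' hi hj h
  exact mul_right_cancel (b := S) (by rw [h₁, h₂])

end Dissection

/-! ### Polygons in the upper half plane -/

/-- Up to a positive factor, the real part of `g • z`. -/
noncomputable def reForm (g : SL(2, ℤ)) (z : UpperHalfPlane) : ℝ :=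
  g 0 0 * g 1 0 * (z.re ^ 2 + z.im ^ 2) + (g 0 0 * g 1 1 + g 0 1 * g 1 0) * z.re + g 0 1 * g 1 1

theorem exists_re_smul_eq (g : SL(2, ℤ)) (z : UpperHalfPlane) :
    ∃ r : ℝ, 0 < r ∧ (g • z).re = reForm g z / r := by
  have hne : (g 1 0 : ℂ) * z + g 1 1 ≠ 0 := by
    intro h
    have him := congrArg Complex.im h
    have hre := congrArg Complex.re h
    simp at him hre
    rcases him with h0 | h0
    · rw [h0] at hre
      simp at hre
      have := sl_det g
      simp [h0, hre] at this
    · exact z.im_pos.ne' h0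
  refine ⟨Complex.normSq ((g 1 0 : ℂ) * z + g 1 1), Complex.normSq_pos.2 hne, ?_⟩
  rw [← UpperHalfPlane.coe_re, UpperHalfPlane.coe_specialLinearGroup_apply]
  simp only [algebraMap_int_eq, eq_intCast, Complex.ofReal_intCast, Complex.div_re]
  rw [← add_div]
  congr 1
  simp [reForm]
  ring

theorem re_smul_nonpos_iff {g : SL(2, ℤ)} {z : UpperHalfPlane} : (g • z).re ≤ 0 ↔ reForm g z ≤ 0 := by
  obtain ⟨r, hr, h⟩ := exists_re_smul_eq g z
  rw [h, div_le_iff₀ hr, zero_mul]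

theorem re_smul_neg_iff {g : SL(2, ℤ)} {z : UpperHalfPlane} : (g • z).re < 0 ↔ reForm g z < 0 := by
  obtain ⟨r, hr, h⟩ := exists_re_smul_eq g z
  rw [h, div_lt_iff₀ hr, zero_mul]

theorem re_smul_pos_iff {g : SL(2, ℤ)} {z : UpperHalfPlane} : 0 < (g • z).re ↔ 0 < reForm g z := by
  obtain ⟨r, hr, h⟩ := exists_re_smul_eq g z
  rw [h, lt_div_iff₀ hr, zero_mul]

theorem continuous_sl_smul (g : SL(2, ℤ)) : Continuous fun z : UpperHalfPlane => g • z :=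
  continuous_const_smul (Matrix.SpecialLinearGroup.mapGL ℝ g)

theorem Apart.re_smul_neg {h : SL(2, ℤ)} (H : Apart h) {z : UpperHalfPlane} (hz : 0 < z.re) :
    (h • z).re < 0 := by
  obtain ⟨h1, h2, h3⟩ := H
  have hd := sl_det h
  -- By the determinant this sum is `1 + 2 * h 0 1 * h 1 0`, an odd number, so nonpositive means at
  -- most `-1`.
  have h3 : h 0 0 * h 1 1 + h 0 1 * h 1 0 ≤ -1 := by
    by_contra
    have : h 0 0 * h 1 1 + h 0 1 * h 1 0 = 0 := by omega
    omega
  rw [re_smul_neg_iff, reForm]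
  have e1 : ((h 0 0 : ℝ) * h 1 0) ≤ 0 := by exact_mod_cast h1
  have e2 : ((h 0 1 : ℝ) * h 1 1) ≤ 0 := by exact_mod_cast h2
  have e3 : ((h 0 0 : ℝ) * h 1 1 + h 0 1 * h 1 0) ≤ -1 := by exact_mod_cast h3
  have := mul_nonneg (neg_nonneg.2 e1) (by positivity : 0 ≤ z.re ^ 2 + z.im ^ 2)
  nlinarith

/-- The intersection of the closed half-planes to the left of the geodesics `X (0, ∞)`. -/
def closedPolygon (s : Set SL(2, ℤ)) : Set UpperHalfPlane := {z | ∀ X ∈ s, (X⁻¹ • z).re ≤ 0}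

/-- The intersection of the open half-planes to the left of the geodesics `X (0, ∞)`. -/
def openPolygon (s : Set SL(2, ℤ)) : Set UpperHalfPlane := {z | ∀ X ∈ s, (X⁻¹ • z).re < 0}

theorem isClosed_closedPolygon (s : Set SL(2, ℤ)) : IsClosed (closedPolygon s) := by
  have : closedPolygon s = ⋂ X ∈ s, {z | (X⁻¹ • z).re ≤ 0} := by ext; simp [closedPolygon]
  rw [this]
  exact isClosed_biInter fun X _ =>
    isClosed_le (UpperHalfPlane.continuous_re.comp (continuous_sl_smul _)) continuous_const

theorem interior_closedPolygon_subset (s : Set SL(2, ℤ)) :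
    interior (closedPolygon s) ⊆ openPolygon s := by
  intro z hz X hX
  by_contra hcon
  have h0 := le_antisymm (interior_subset hz X hX) (not_lt.1 hcon)
  -- A boundary point on `X (0, ∞)` leaves the polygon under small shifts to the right in the
  -- coordinate `X⁻¹ z`.
  let f : ℝ → UpperHalfPlane := fun ε => X • (ε +ᵥ X⁻¹ • z)
  have hf0 : f 0 = z := by simp [f]
  have hcont : Continuous f := by
    refine (continuous_sl_smul X).comp ?_
    rw [UpperHalfPlane.isEmbedding_coe.continuous_iff]
    simp only [Function.comp_def, UpperHalfPlane.coe_vadd]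
    fun_prop
  have hmem : ∀ᶠ ε in nhdsWithin (0 : ℝ) (Set.Ioi 0), f ε ∈ closedPolygon s := by
    refine (hcont.tendsto 0).mono_left nhdsWithin_le_nhds ?_
    rw [hf0]
    exact mem_interior_iff_mem_nhds.1 hz
  obtain ⟨ε, hε, hpos⟩ := (hmem.and self_mem_nhdsWithin).exists
  have := hε X hX
  simp only [f, inv_smul_smul, UpperHalfPlane.vadd_re, h0, add_zero] at this
  exact absurd hpos (not_lt.2 this)

/-- The ideal triangle with vertices `0, 1, ∞`. -/
def fareyTriangle : Set UpperHalfPlane := closedPolygon {S, T, U}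

theorem mem_fareyTriangle_iff {z : UpperHalfPlane} :
    z ∈ fareyTriangle ↔ 0 ≤ z.re ∧ z.re ≤ 1 ∧ z.re ≤ z.re ^ 2 + z.im ^ 2 := by
  simp only [fareyTriangle, closedPolygon, Set.mem_insert_iff, Set.mem_singleton_iff,
    forall_eq_or_imp, forall_eq, Set.mem_ofPred_eq, re_smul_nonpos_iff, reForm]
  simp [sl_inv_zero_zero, sl_inv_zero_one, sl_inv_one_zero, sl_inv_one_one]
  grind

theorem exists_smul_mem_fareyTriangle (z : UpperHalfPlane) : ∃ g : SL(2, ℤ), g • z ∈ fareyTriangle := by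
  obtain ⟨g, h1, h2⟩ := ModularGroup.exists_smul_mem_fd z
  rw [Complex.normSq_apply, UpperHalfPlane.coe_re, UpperHalfPlane.coe_im] at h1
  rw [abs_le] at h2
  rcases le_or_gt 0 (g • z).re with h | h
  · exact ⟨g, mem_fareyTriangle_iff.2 ⟨h, by linarith, by nlinarith⟩⟩
  · refine ⟨T * g, ?_⟩
    rw [mul_smul, mem_fareyTriangle_iff, UpperHalfPlane.modular_T_smul, UpperHalfPlane.vadd_re,
      UpperHalfPlane.vadd_im]
    exact ⟨by linarith, by linarith, by nlinarith⟩

theorem rotThree_smul_mem_fareyTriangle {z : UpperHalfPlane} (hz : z ∈ fareyTriangle) :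
    R • z ∈ fareyTriangle := by
  simp only [fareyTriangle, closedPolygon, Set.mem_insert_iff, Set.mem_singleton_iff,
    forall_eq_or_imp, forall_eq, Set.mem_ofPred_eq] at hz ⊢
  obtain ⟨h1, h2, h3⟩ := hz
  have e1 : S⁻¹ * R = -T⁻¹ := by
    apply sl_ext <;> simp [sl_mul_apply, sl_inv_zero_zero, sl_inv_zero_one, sl_inv_one_zero,
      sl_inv_one_one]
  have e2 : T⁻¹ * R = U⁻¹ := by
    apply sl_ext <;> simp [sl_mul_apply, sl_inv_zero_zero, sl_inv_zero_one, sl_inv_one_zero,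
      sl_inv_one_one]
  have e3 : U⁻¹ * R = S⁻¹ := by
    apply sl_ext <;> simp [sl_mul_apply, sl_inv_zero_zero, sl_inv_zero_one, sl_inv_one_zero,
      sl_inv_one_one]
  rw [← mul_smul, ← mul_smul, ← mul_smul, e1, e2, e3, ModularGroup.SL_neg_smul]
  exact ⟨h2, h3, h1⟩

theorem rotThree_pow_smul_mem_fareyTriangle {z : UpperHalfPlane} (hz : z ∈ fareyTriangle) (k : ℕ) :
    R ^ k • z ∈ fareyTriangle := by
  induction k with
  | zero => simpa using hz
  | succ k ih => rw [pow_succ', mul_smul]; exact rotThree_smul_mem_fareyTriangle ih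

/-- `reForm h z` is a combination of the quantities at `∞`, `1`, `0` with weights `|z|² - Re z`, `Re
z`, `1 - Re z`, which are nonnegative on the triangle. -/
theorem TriangleApart.re_smul_nonpos {h : SL(2, ℤ)} (H : TriangleApart h) {z : UpperHalfPlane}
    (hz : z ∈ fareyTriangle) : (h • z).re ≤ 0 := by
  obtain ⟨h1, h2, h3⟩ := H
  rw [mem_fareyTriangle_iff] at hz
  obtain ⟨z1, z2, z3⟩ := hz
  rw [re_smul_nonpos_iff, reForm]
  have e1 : ((h 0 0 : ℝ) * h 1 0) ≤ 0 := by exact_mod_cast h1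
  have e2 : ((h 0 1 : ℝ) * h 1 1) ≤ 0 := by exact_mod_cast h2
  have e3 : ((h 0 0 + h 0 1 : ℝ) * (h 1 0 + h 1 1)) ≤ 0 := by exact_mod_cast h3
  linarith [mul_nonneg (neg_nonneg.2 e1) (sub_nonneg.2 z3), mul_nonneg (neg_nonneg.2 e3) z1,
    mul_nonneg (neg_nonneg.2 e2) (sub_nonneg.2 z2)]

namespace Dissection

variable {l : List SL(2, ℤ)} {t : Finset SL(2, ℤ)}

/-- The sides of a dissection together with the two vertical sides. -/
def sides (l : List SL(2, ℤ)) : Set SL(2, ℤ) := {X | X ∈ S :: T :: l}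

theorem smul_mem_closedPolygon (hd : Dissection l t) {M : SL(2, ℤ)} (hM : M ∈ t)
    {z : UpperHalfPlane} (hz : z ∈ fareyTriangle) : M • z ∈ closedPolygon (sides l) := fun X hX => by
  rw [← mul_smul]
  exact (hd.triangleApart X hX M hM).re_smul_nonpos hz

theorem exists_smul_mem_closedPolygon (hd : Dissection l t) {H : Subgroup SL(2, ℤ)} (hneg : -1 ∈ H)
    (hT : T ∈ H) (hpair : ∀ X ∈ l, ∃ Y ∈ l, Y * S * X⁻¹ ∈ H) (z : UpperHalfPlane) :
    ∃ γ ∈ H, γ • z ∈ closedPolygon (sides l) := by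
  obtain ⟨g, hg⟩ := exists_smul_mem_fareyTriangle z
  obtain ⟨γ, hγ, M, hM, k, hk⟩ := hd.reachedBy hneg hT hpair g⁻¹
  refine ⟨γ, hγ, ?_⟩
  have : γ • z = M • (R ^ k • (g • z)) := by
    rw [← mul_smul, ← hk, ← mul_smul, inv_mul_cancel_right]
  rw [this]
  exact hd.smul_mem_closedPolygon hM (rotThree_pow_smul_mem_fareyTriangle hg k)

theorem openPolygon_nonempty (hd : Dissection l t) : (openPolygon (sides l)).Nonempty := by
  refine ⟨⟨⟨1 / 2, 1⟩, one_pos⟩, fun X hX => ?_⟩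
  rw [re_smul_neg_iff, reForm]
  change _ * _ * ((1 / 2 : ℝ) ^ 2 + (1 : ℝ) ^ 2) + _ * (1 / 2 : ℝ) + _ < 0
  rw [sl_inv_zero_zero, sl_inv_zero_one, sl_inv_one_zero, sl_inv_one_one]
  simp only [sides, List.mem_cons, Set.mem_ofPred_eq] at hX
  rcases hX with rfl | rfl | hX
  · norm_num
  · norm_num
  · have hu := hd.inUnitInterval_side X hX
    obtain ⟨hc, hd0⟩ := hu.row_pos
    obtain ⟨h1, h2, h3, h4⟩ := hu
    have f1 : (0 : ℝ) ≤ X 0 1 := by exact_mod_cast h1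
    have f2 : (X 0 1 : ℝ) < X 1 1 := by exact_mod_cast h2
    have f3 : (0 : ℝ) < X 0 0 := by exact_mod_cast h3
    have f4 : (X 0 0 : ℝ) ≤ X 1 0 := by exact_mod_cast h4
    have f5 : (0 : ℝ) < X 1 0 := by exact_mod_cast hc
    have f6 : (0 : ℝ) < X 1 1 := by exact_mod_cast hd0
    push_cast
    nlinarith [mul_nonneg f1 f3.le, mul_pos f5 f6]

end Dissection

/-! ### Ping-pong and Poincaré's theorem -/

section PingPong

open Pointwise

variable {ι G α : Type*} [Group G] [MulAction G α] {g : ι → G} {X : ι → Set α} {P : Set α}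

/-- The ping-pong lemma for cyclic groups, with a base set `P`. -/
theorem lift_zpowers_ping_pong (hdisj : ∀ i, Disjoint P (X i))
    (hXX : ∀ i, ∀ h ∈ Subgroup.zpowers (g i), h ≠ 1 → ∀ j, i ≠ j → h • X j ⊆ X i)
    (hPX : ∀ i, ∀ h ∈ Subgroup.zpowers (g i), h ≠ 1 → h • P ⊆ X i)
    {x : Monoid.CoprodI (fun i => Subgroup.zpowers (g i))} (hx : x ≠ 1) {p : α} (hp : p ∈ P) :
    Monoid.CoprodI.lift (fun i => (Subgroup.zpowers (g i)).subtype) x • p ∉ P := by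
  classical
  set f : ∀ i, Subgroup.zpowers (g i) →* G := fun i => (Subgroup.zpowers (g i)).subtype
  have hpp : Pairwise fun i j => ∀ h : Subgroup.zpowers (g i), h ≠ 1 → f i h • X j ⊆ X i :=
    fun i j hij h hh => hXX i h h.2 (by simpa using hh) j hij
  have hword : ∀ i j (w : Monoid.CoprodI.NeWord (fun i => Subgroup.zpowers (g i)) i j),
      Monoid.CoprodI.lift f w.prod • p ∈ X i := by
    intro i j w
    induction w with
    | singleton y hy =>
      simp only [Monoid.CoprodI.NeWord.prod_singleton, Monoid.CoprodI.lift_of]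
      exact hPX _ _ y.2 (by simpa using hy) ⟨p, hp, rfl⟩
    | append w₁ hne w₂ _ ih₂ =>
      rw [Monoid.CoprodI.NeWord.append_prod, map_mul, mul_smul]
      exact Monoid.CoprodI.lift_word_ping_pong f X hpp w₁ hne ⟨_, ih₂, rfl⟩
  obtain ⟨w, rfl⟩ := Monoid.CoprodI.Word.equiv.symm.surjective x
  have hw : w ≠ Monoid.CoprodI.Word.empty := by
    rintro rfl
    exact hx (by simp [Monoid.CoprodI.Word.equiv])
  obtain ⟨i, j, w', rfl⟩ := Monoid.CoprodI.NeWord.of_word w hw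
  exact Set.disjoint_right.1 (hdisj i) (hword i j w')

end PingPong

theorem toModGroup_eq_one_iff {g : SL(2, ℤ)} : toModGroup g = 1 ↔ g = 1 ∨ g = -1 := by
  rw [toModGroup, QuotientGroup.mk'_apply, QuotientGroup.eq_one_iff,
    Matrix.SpecialLinearGroup.mem_center_iff]
  constructor
  · rintro ⟨r, hr, h⟩
    have h00 := congrFun (congrFun h 0) 0
    have h01 := congrFun (congrFun h 0) 1
    have h10 := congrFun (congrFun h 1) 0
    have h11 := congrFun (congrFun h 1) 1
    simp at h00 h01 h10 h11
    rw [Fintype.card_fin, sq_eq_one_iff] at hr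
    rcases hr with rfl | rfl
    · left; apply sl_ext <;> simp [← h00, ← h01, ← h10, ← h11]
    · right; apply sl_ext <;> simp [neg_apply_sl, ← h00, ← h01, ← h10, ← h11]
  · rintro (rfl | rfl)
    · exact ⟨1, by simp, by simp⟩
    · exact ⟨-1, by simp, by ext i j; fin_cases i <;> fin_cases j <;> simp⟩

/-- The action of `PSL(2, ℤ)` on the upper half plane, as a homomorphism. -/
noncomputable def modGroupToPerm : ModGroup →* Equiv.Perm UpperHalfPlane :=
  QuotientGroup.lift (Subgroup.center SL(2, ℤ)) (MulAction.toPermHom SL(2, ℤ) UpperHalfPlane) (by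
    intro g hg
    have : toModGroup g = 1 := (QuotientGroup.eq_one_iff g).2 hg
    ext1 z
    rcases toModGroup_eq_one_iff.1 this with rfl | rfl
    · simp
    · rw [MulAction.toPermHom_apply, MulAction.toPerm_apply, ModularGroup.SL_neg_smul]; simp)

noncomputable instance : MulAction ModGroup UpperHalfPlane :=
  MulAction.compHom UpperHalfPlane modGroupToPerm

theorem toModGroup_smul (g : SL(2, ℤ)) (z : UpperHalfPlane) : toModGroup g • z = g • z := rfl

/-- The element that maps the side `a (0, ∞)` to `b (0, ∞)`, with the orientation reversed. -/
def glueSides (a b : SL(2, ℤ)) : SL(2, ℤ) := b * S * a⁻¹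

/-- The open half-plane to the right of the geodesic `X (0, ∞)`. -/
def outside (X : SL(2, ℤ)) : Set UpperHalfPlane := {z | 0 < (X⁻¹ • z).re}

theorem SidesApart.re_neg {X Y : SL(2, ℤ)} (h : SidesApart X Y) {z : UpperHalfPlane}
    (hz : z ∈ outside Y) : (X⁻¹ • z).re < 0 := by
  have : X⁻¹ • z = (X⁻¹ * Y) • (Y⁻¹ • z) := by rw [← mul_smul, mul_inv_cancel_right]
  rw [this]
  exact h.1.re_smul_neg hz

theorem re_S_smul_pos {z : UpperHalfPlane} (hz : z.re < 0) : 0 < (S • z).re := by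
  rw [re_smul_pos_iff, reForm]
  simpa using hz

theorem glueSides_smul_mem_outside {a b : SL(2, ℤ)} {z : UpperHalfPlane} (hz : (a⁻¹ • z).re < 0) :
    glueSides a b • z ∈ outside b := by
  have : b⁻¹ • glueSides a b • z = S • a⁻¹ • z := by
    rw [glueSides, ← mul_smul, ← mul_smul, ← mul_assoc, inv_mul_cancel_left]
  rw [outside, Set.mem_ofPred_eq, this]
  exact re_S_smul_pos hz

/-- One application sends the inner side of `a` to the outside of `b`. This again lies on the inner
side of `a`, so iteration stays there. -/
theorem glueSides_pow_smul_mem_outside {a b : SL(2, ℤ)} (hab : SidesApart a b) {z : UpperHalfPlane}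
    (hz : (a⁻¹ • z).re < 0) (k : ℕ) : glueSides a b ^ (k + 1) • z ∈ outside b := by
  induction k with
  | zero => simpa using glueSides_smul_mem_outside hz
  | succ k ih =>
    rw [pow_succ', mul_smul]
    exact glueSides_smul_mem_outside (hab.re_neg ih)

theorem glueSides_inv (a b : SL(2, ℤ)) : (glueSides a b)⁻¹ = -glueSides b a := by
  have : (S : SL(2, ℤ))⁻¹ = -S := by rw [inv_eq_iff_mul_eq_one, mul_neg, S_mul_S, neg_neg]
  rw [glueSides, glueSides, mul_inv_rev, mul_inv_rev, inv_inv, this, neg_mul, mul_neg, mul_assoc]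

theorem zpow_glueSides_smul_mem {a b : SL(2, ℤ)} (hab : SidesApart a b) {z : UpperHalfPlane}
    (ha : (a⁻¹ • z).re < 0) (hb : (b⁻¹ • z).re < 0) {k : ℤ} (hk : k ≠ 0) :
    toModGroup (glueSides a b) ^ k • z ∈ outside a ∪ outside b := by
  rcases lt_or_gt_of_ne hk with h | h
  · obtain ⟨m, rfl⟩ : ∃ m : ℕ, k = -((m + 1 : ℕ) : ℤ) := ⟨(-k).toNat - 1, by omega⟩
    left
    have : toModGroup (-1) = 1 := toModGroup_eq_one_iff.2 (Or.inr rfl)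
    rw [zpow_neg, zpow_natCast, ← inv_pow, ← map_inv, glueSides_inv, ← neg_one_mul, map_mul, this,
      one_mul, ← map_pow, toModGroup_smul]
    exact glueSides_pow_smul_mem_outside hab.symm hb m
  · obtain ⟨m, rfl⟩ : ∃ m : ℕ, k = ((m + 1 : ℕ) : ℤ) := ⟨k.toNat - 1, by omega⟩
    right
    rw [zpow_natCast, ← map_pow, toModGroup_smul]
    exact glueSides_pow_smul_mem_outside hab ha m

/-- **Poincaré's theorem** for an ideal polygon whose sides are disjoint and paired by elements of
infinite order: the side pairings generate their free product, and its nontrivial elements move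
the open polygon off itself. -/
theorem glueSides_ping_pong {ι : Type*} {s : Set SL(2, ℤ)} {a b : ι → SL(2, ℤ)}
    (hne : (openPolygon s).Nonempty) (ha : ∀ i, a i ∈ s) (hb : ∀ i, b i ∈ s)
    (hab : ∀ i, SidesApart (a i) (b i))
    (hd : ∀ i j, i ≠ j → SidesApart (a i) (a j) ∧ SidesApart (a i) (b j) ∧ SidesApart (b i) (a j) ∧
      SidesApart (b i) (b j)) :
    (∀ i, toModGroup (glueSides (a i) (b i)) ≠ 1) ∧
      ∀ x : Monoid.CoprodI (fun i => Subgroup.zpowers (toModGroup (glueSides (a i) (b i)))), x ≠ 1 →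
        ∀ p ∈ openPolygon s, Monoid.CoprodI.lift
          (fun i => (Subgroup.zpowers (toModGroup (glueSides (a i) (b i)))).subtype) x • p ∉
            openPolygon s := by
  have hdisj : ∀ i, Disjoint (openPolygon s) (outside (a i) ∪ outside (b i)) := by
    intro i
    rw [Set.disjoint_left]
    rintro z hz (h | h)
    · exact lt_asymm h (hz _ (ha i))
    · exact lt_asymm h (hz _ (hb i))
  have hpow : ∀ i, ∀ h ∈ Subgroup.zpowers (toModGroup (glueSides (a i) (b i))), h ≠ 1 →
      ∀ z : UpperHalfPlane, ((a i)⁻¹ • z).re < 0 → ((b i)⁻¹ • z).re < 0 →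
        h • z ∈ outside (a i) ∪ outside (b i) := by
    rintro i _ ⟨k, rfl⟩ hk z h1 h2
    exact zpow_glueSides_smul_mem (hab i) h1 h2 (by rintro rfl; exact hk (zpow_zero _))
  refine ⟨fun i h1 => ?_, fun x hx p hp => ?_⟩
  · obtain ⟨p, hp⟩ := hne
    have := zpow_glueSides_smul_mem (hab i) (hp _ (ha i)) (hp _ (hb i)) one_ne_zero
    rw [h1, zpow_one, one_smul] at this
    exact Set.disjoint_left.1 (hdisj i) hp this
  · refine lift_zpowers_ping_pong (X := fun i => outside (a i) ∪ outside (b i)) hdisj ?_ ?_ hx hp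
    · rintro i h hh h1 j hij _ ⟨z, hz, rfl⟩
      obtain ⟨h2, h3, h4, h5⟩ := hd i j hij
      rcases hz with hz | hz
      · exact hpow i h hh h1 z (h2.re_neg hz) (h4.re_neg hz)
      · exact hpow i h hh h1 z (h3.re_neg hz) (h5.re_neg hz)
    · rintro i h hh h1 _ ⟨z, hz, rfl⟩
      exact hpow i h hh h1 z (hz _ (ha i)) (hz _ (hb i))

/-! ### Farey polygons and their denominators -/

namespace FareyPolygon

variable (F : FareyPolygon)

theorem sideMat_00 (i : Fin F.m) : F.sideMat i 0 0 = (F.cusp i.succ).num := rfl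
theorem sideMat_01 (i : Fin F.m) : F.sideMat i 0 1 = (F.cusp i.castSucc).num := rfl
theorem sideMat_10 (i : Fin F.m) : F.sideMat i 1 0 = (F.denom i.succ : ℤ) := rfl
theorem sideMat_11 (i : Fin F.m) : F.sideMat i 1 1 = (F.denom i.castSucc : ℤ) := rfl

theorem denom_pos (i : Fin (F.m + 1)) : 0 < F.denom i := (F.cusp i).den_pos

/-- The matrices `X` whose geodesics `X (0, ∞)` are the sides of the polygon. -/
def boundary : Set SL(2, ℤ) := insert S (insert T (Set.range F.sideMat))

theorem idealPolygon_eq : F.idealPolygon = closedPolygon F.boundary := by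
  ext z
  simp only [idealPolygon, closedPolygon, boundary, Set.mem_insert_iff, forall_eq_or_imp,
    Set.forall_mem_range, Set.mem_ofPred_eq]
  refine and_congr ?_ (and_congr ?_ (forall_congr' fun i => ?_))
  · rw [re_smul_nonpos_iff, reForm]
    simp [sl_inv_zero_zero, sl_inv_zero_one, sl_inv_one_zero, sl_inv_one_one]
  · rw [re_smul_nonpos_iff, reForm]
    simp [sl_inv_zero_zero, sl_inv_zero_one, sl_inv_one_zero, sl_inv_one_one]
  · rw [re_smul_nonpos_iff, reForm, sl_inv_zero_zero, sl_inv_zero_one, sl_inv_one_zero,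
      sl_inv_one_one, sideMat_00, sideMat_01, sideMat_10, sideMat_11, denom, denom]
    have e1 := Rat.cast_def (K := ℝ) (F.cusp i.castSucc)
    have e2 := Rat.cast_def (K := ℝ) (F.cusp i.succ)
    have h1 : (0 : ℝ) < (F.cusp i.castSucc).den := by exact_mod_cast (F.cusp i.castSucc).den_pos
    have h2 : (0 : ℝ) < (F.cusp i.succ).den := by exact_mod_cast (F.cusp i.succ).den_pos
    rw [e1, e2]
    push_cast
    set a := ((F.cusp i.succ).num : ℝ)
    set b := ((F.cusp i.castSucc).num : ℝ)
    set c := ((F.cusp i.succ).den : ℝ)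
    set d := ((F.cusp i.castSucc).den : ℝ)
    have : (z.re - b / d) * (z.re - a / c) + z.im ^ 2 =
        -(d * -c * (z.re ^ 2 + z.im ^ 2) + (d * a + -b * -c) * z.re + -b * a) / (c * d) := by
      field_simp
      ring
    rw [this, le_div_iff₀ (mul_pos h2 h1), zero_mul, neg_nonneg]

/-- A number in `[0, 1]` is a cusp or lies under a side. -/
theorem cusp_or_between {q : ℚ} (h0 : 0 ≤ q) (h1 : q ≤ 1) :
    (∃ i, F.cusp i = q) ∨ ∃ i : Fin F.m, F.cusp i.castSucc < q ∧ q < F.cusp i.succ := by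
  by_contra! hcon
  obtain ⟨hc, hb⟩ := hcon
  have : ∀ i, F.cusp i < q := by
    intro i
    induction i using Fin.induction with
    | zero => exact lt_of_le_of_ne (by rw [F.cusp_first]; exact h0) (hc 0)
    | succ i ih => exact lt_of_le_of_ne (hb i ih) (hc _)
  have := this (Fin.last _)
  rw [F.cusp_last] at this
  exact absurd h1 (not_le.2 this)

/-- The denominator of `q` is a combination of the two neighbouring denominators, and strict
betweenness makes both integer coefficients at least one. -/
theorem denom_add_denom_le {q : ℚ} {i : Fin F.m} (h1 : F.cusp i.castSucc < q)
    (h2 : q < F.cusp i.succ) : F.denom i.castSucc + F.denom i.succ ≤ q.den := by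
  rw [Rat.lt_iff] at h1 h2
  have h := F.neighbours i
  have hc : (0 : ℤ) < (F.denom i.castSucc : ℤ) := by exact_mod_cast F.denom_pos _
  have hd : (0 : ℤ) < (F.denom i.succ : ℤ) := by exact_mod_cast F.denom_pos _
  rw [denom] at hc hd ⊢
  zify
  rw [denom]
  have e : (q.den : ℤ) = (F.cusp i.castSucc).den * ((F.cusp i.succ).num * q.den -
      q.num * (F.cusp i.succ).den) + (F.cusp i.succ).den * (q.num * (F.cusp i.castSucc).den -
        (F.cusp i.castSucc).num * q.den) := by linear_combination (-(q.den : ℤ)) * h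
  nlinarith

theorem isPaired_iff {N : ℕ} {i j : Fin F.m} :
    F.IsPaired N i j ↔ SameCoset N (F.sideMat j * S) (F.sideMat i) := by
  rw [SameCoset.iff_dvd, (sl_S_row _).1, (sl_S_row _).2, IsPaired, sideMat_10, sideMat_10,
    sideMat_11, sideMat_11, ← Int.natCast_dvd_natCast]
  push_cast
  refine iff_of_eq (congrArg _ ?_)
  ring

theorem IsPaired.symm {F : FareyPolygon} {N : ℕ} {i j : Fin F.m} (h : F.IsPaired N i j) :
    F.IsPaired N j i := by
  rw [IsPaired] at *
  rwa [mul_comm (F.denom j.castSucc), mul_comm (F.denom j.succ)]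

theorem glue_mem_iff {N : ℕ} {i j : Fin F.m} : F.glue i j ∈ Gamma0 N ↔ F.IsPaired N i j := by
  rw [isPaired_iff]; rfl

/-- The numerators of a Farey polygon are determined by the denominators. -/
theorem cuspList_eq_of_denomList_eq {F G : FareyPolygon} (h : F.denomList = G.denomList) :
    F.cuspList = G.cuspList := by
  have hm : F.m = G.m := by
    have := congrArg List.length h
    simpa [denomList] using this
  have hden : ∀ (i : ℕ) (hF : i < F.m + 1) (hG : i < G.m + 1), F.denom ⟨i, hF⟩ = G.denom ⟨i, hG⟩ := by
    intro i hF hG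
    have e1 : F.denomList[i]? = some (F.denom ⟨i, hF⟩) := by
      rw [denomList, List.getElem?_ofFn, dif_pos hF]
    have e2 : G.denomList[i]? = some (G.denom ⟨i, hG⟩) := by
      rw [denomList, List.getElem?_ofFn, dif_pos hG]
    rw [h, e2] at e1
    exact (Option.some.inj e1).symm
  have hcusp : ∀ (i : ℕ) (hF : i < F.m + 1) (hG : i < G.m + 1), F.cusp ⟨i, hF⟩ = G.cusp ⟨i, hG⟩ := by
    intro i
    induction i with
    | zero => intro _ _; exact F.cusp_first.trans G.cusp_first.symm
    | succ i ih =>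
      intro hF hG
      have h1 := F.neighbours ⟨i, by omega⟩
      have h2 := G.neighbours ⟨i, by omega⟩
      have h3 := hden (i + 1) hF hG
      have h4 := ih (by omega) (by omega)
      simp only [Fin.succ_mk, Fin.castSucc_mk] at h1 h2
      rw [h4] at h1
      simp only [denom] at h3
      rw [h3] at h1
      refine Rat.ext ?_ h3
      have hpos : ((G.cusp ⟨i, by omega⟩).den : ℤ) ≠ 0 := by exact_mod_cast (G.cusp _).den_pos.ne'
      exact mul_right_cancel₀ hpos (by linarith)
  refine List.ext_getElem (by simp [cuspList, hm]) fun i h1 h2 => ?_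
  simp only [cuspList, List.getElem_ofFn]
  exact hcusp i _ _

end FareyPolygon

/-! ### The Farey polygon of a dissection -/

namespace Dissection

variable {l : List SL(2, ℤ)} {t : Finset SL(2, ℤ)}

theorem div_num_den {a b : ℤ} (h : IsCoprime a b) (hb : 0 < b) :
    ((a : ℚ) / b).num = a ∧ (((a : ℚ) / b).den : ℤ) = b := by
  have hc : Nat.Coprime a.natAbs b.natAbs := Int.isCoprime_iff_gcd_eq_one.1 h
  exact ⟨Rat.num_div_eq_of_coprime hb hc, Rat.den_div_eq_of_coprime hb hc⟩

theorem left_num_den (hd : Dissection l t) {X : SL(2, ℤ)} (hX : X ∈ l) :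
    ((X 0 1 : ℚ) / X 1 1).num = X 0 1 ∧ (((X 0 1 : ℚ) / X 1 1).den : ℤ) = X 1 1 :=
  div_num_den ⟨-X 1 0, X 0 0, by linarith [sl_det X]⟩ (hd.inUnitInterval_side X hX).row_pos.2

theorem right_num_den (hd : Dissection l t) {X : SL(2, ℤ)} (hX : X ∈ l) :
    ((X 0 0 : ℚ) / X 1 0).num = X 0 0 ∧ (((X 0 0 : ℚ) / X 1 0).den : ℤ) = X 1 0 :=
  div_num_den ⟨X 1 1, -X 0 1, by linarith [sl_det X]⟩ (hd.inUnitInterval_side X hX).row_pos.1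

/-- The left end point of the `i`-th side, or `1`. -/
def cuspAt (l : List SL(2, ℤ)) (i : ℕ) : ℚ := if h : i < l.length then (l[i] 0 1 : ℚ) / l[i] 1 1 else 1

theorem cuspAt_of_lt {i : ℕ} (h : i < l.length) : cuspAt l i = (l[i] 0 1 : ℚ) / l[i] 1 1 := dif_pos h

theorem cuspAt_succ (hd : Dissection l t) {i : ℕ} (h : i < l.length) :
    cuspAt l (i + 1) = (l[i] 0 0 : ℚ) / l[i] 1 0 := by
  obtain ⟨h1, -, h3⟩ := hd.isChain
  by_cases hi : i + 1 < l.length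
  · obtain ⟨e1, e2⟩ := List.isChain_iff_getElem.1 h1 i hi
    rw [cuspAt_of_lt hi, e1, e2]
  · rw [cuspAt, dif_neg hi]
    have hlast : l[i] ∈ l.getLast? := by
      rw [List.getLast?_eq_getElem?, Option.mem_def, List.getElem?_eq_some_iff]
      exact ⟨by omega, by congr 1; omega⟩
    obtain ⟨e1, e2⟩ := h3 _ hlast
    rw [e1, e2]; simp

/-- The Farey polygon formed by the triangles of a dissection. -/
def fareyPolygon (hd : Dissection l t) : FareyPolygon where
  m := l.length
  cusp i := cuspAt l i
  cusp_first := by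
    have h0 : 0 < l.length := List.length_pos_iff.2 hd.ne_nil
    have := (hd.isChain.2.1 l[0] (by rw [List.head?_eq_getElem?]; simp)).1
    rw [Fin.val_zero, cuspAt_of_lt h0, this]
    simp
  cusp_last := by simp [cuspAt]
  neighbours i := by
    rw [Fin.val_succ, Fin.val_castSucc, hd.cuspAt_succ i.2, cuspAt_of_lt i.2]
    obtain ⟨h1, h2⟩ := hd.left_num_den (List.getElem_mem i.2)
    obtain ⟨h3, h4⟩ := hd.right_num_den (List.getElem_mem i.2)
    rw [h1, h2, h3, h4]
    linarith [sl_det l[(i : ℕ)]]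

theorem val_lt (hd : Dissection l t) (i : Fin hd.fareyPolygon.m) : (i : ℕ) < l.length := i.2

theorem sideMat_fareyPolygon (hd : Dissection l t) (i : Fin hd.fareyPolygon.m) :
    hd.fareyPolygon.sideMat i = l[(i : ℕ)]'(hd.val_lt i) := by
  have hi := hd.val_lt i
  obtain ⟨h1, h2⟩ := hd.left_num_den (List.getElem_mem hi)
  obtain ⟨h3, h4⟩ := hd.right_num_den (List.getElem_mem hi)
  have e1 : hd.fareyPolygon.cusp (Fin.castSucc i) = _ := cuspAt_of_lt hi
  have e2 : hd.fareyPolygon.cusp (Fin.succ i) = _ := hd.cuspAt_succ hi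
  apply sl_ext
  · rw [FareyPolygon.sideMat_00, e2]; exact h3
  · rw [FareyPolygon.sideMat_01, e1]; exact h1
  · rw [FareyPolygon.sideMat_10, FareyPolygon.denom, e2]; exact h4
  · rw [FareyPolygon.sideMat_11, FareyPolygon.denom, e1]; exact h2

theorem sideMat_mem (hd : Dissection l t) (i : Fin hd.fareyPolygon.m) :
    hd.fareyPolygon.sideMat i ∈ l := by
  rw [hd.sideMat_fareyPolygon i]; exact List.getElem_mem _

theorem exists_sideMat_eq (hd : Dissection l t) {X : SL(2, ℤ)} (hX : X ∈ l) :
    ∃ i, hd.fareyPolygon.sideMat i = X := by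
  obtain ⟨i, hi, rfl⟩ := List.getElem_of_mem hX
  exact ⟨(⟨i, hi⟩ : Fin l.length), hd.sideMat_fareyPolygon (⟨i, hi⟩ : Fin l.length)⟩

theorem boundary_fareyPolygon (hd : Dissection l t) : hd.fareyPolygon.boundary = sides l := by
  ext X
  simp only [FareyPolygon.boundary, sides, Set.mem_insert_iff, Set.mem_range, Set.mem_ofPred_eq,
    List.mem_cons]
  refine or_congr Iff.rfl (or_congr Iff.rfl ⟨?_, hd.exists_sideMat_eq⟩)
  rintro ⟨i, rfl⟩
  exact hd.sideMat_mem i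

theorem sidesApart_sideMat (hd : Dissection l t) {i j : Fin hd.fareyPolygon.m} (hij : i ≠ j) :
    SidesApart (hd.fareyPolygon.sideMat i) (hd.fareyPolygon.sideMat j) := by
  rw [hd.sideMat_fareyPolygon i, hd.sideMat_fareyPolygon j]
  have h := (List.pairwise_cons.1 (List.pairwise_cons.1 hd.pairwise).2).2
  rw [List.pairwise_iff_getElem] at h
  have hij' : (i : ℕ) ≠ j := fun h => hij (Fin.ext h)
  rcases lt_or_gt_of_ne hij' with h1 | h1
  · exact h i j i.2 j.2 h1
  · exact (h j i j.2 i.2 h1).symm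

theorem sidesApart_S_T (hd : Dissection l t) : SidesApart S T :=
  (List.pairwise_cons.1 hd.pairwise).1 T (by simp)

theorem sidesApart_S (hd : Dissection l t) {X : SL(2, ℤ)} (hX : X ∈ l) : SidesApart S X :=
  (List.pairwise_cons.1 hd.pairwise).1 X (by simp [hX])

theorem sidesApart_T (hd : Dissection l t) {X : SL(2, ℤ)} (hX : X ∈ l) : SidesApart T X :=
  (List.pairwise_cons.1 (List.pairwise_cons.1 hd.pairwise).2).1 X hX

theorem not_sidesApart_self (X : SL(2, ℤ)) : ¬ SidesApart X X := fun h => by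
  have := h.1
  rw [inv_mul_cancel] at this
  exact not_apart_one this

theorem sideMat_injective (hd : Dissection l t) : Function.Injective hd.fareyPolygon.sideMat := by
  intro i j h
  by_contra hij
  have := hd.sidesApart_sideMat hij
  rw [h] at this
  exact not_sidesApart_self _ this

end Dissection

/-! ### The lower bound for the largest denominator -/

/-- If `h` maps `i` into the half-plane `Re z ≤ 0`, then `h ∞ ≤ 0` or `h ∞ = ∞`. -/
theorem mul_nonpos_of_re_smul_I {h : SL(2, ℤ)} (H : (h • UpperHalfPlane.I).re ≤ 0) :
    h 0 0 * h 1 0 ≤ 0 := by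
  rw [re_smul_nonpos_iff, reForm, UpperHalfPlane.I_re, UpperHalfPlane.I_im] at H
  have H' : h 0 0 * h 1 0 + h 0 1 * h 1 1 ≤ 0 := by
    have : ((h 0 0 * h 1 0 + h 0 1 * h 1 1 : ℤ) : ℝ) ≤ 0 := by push_cast; linarith
    exact_mod_cast this
  have hd := sl_det h
  by_contra! hpos
  -- With `t = h 0 1 * h 1 0` the product is `t (t + 1) ≥ 0`, so the quantities at `0` and `∞` do
  -- not have opposite signs; their sum is nonpositive.
  have h1 : (h 0 1 * h 1 1) * (h 0 0 * h 1 0) = h 0 1 * h 1 0 * (1 + h 0 1 * h 1 0) := by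
    linear_combination h 0 1 * h 1 0 * hd
  have h2 : 0 ≤ h 0 1 * h 1 0 * (1 + h 0 1 * h 1 0) := by
    rcases le_or_gt 0 (h 0 1 * h 1 0) with h | h
    · positivity
    · exact mul_nonneg_of_nonpos_of_nonpos h.le (by omega)
  nlinarith

namespace FareyPolygon

variable (F : FareyPolygon)

/-- If the translate `g i` lies in the polygon, then `g ∞` is one of its rational cusps. -/
theorem exists_dvd_denom {g : SL(2, ℤ)} (hg : g • UpperHalfPlane.I ∈ F.idealPolygon)
    (h0 : g 1 0 ≠ 0) : ∃ i, g 1 0 ∣ (F.denom i : ℤ) := by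
  rw [F.idealPolygon_eq] at hg
  have key : ∀ X ∈ F.boundary, (X⁻¹ * g) 0 0 * (X⁻¹ * g) 1 0 ≤ 0 := fun X hX =>
    mul_nonpos_of_re_smul_I (by rw [mul_smul]; exact hg X hX)
  have hS := key S (by simp [boundary])
  have hT := key T (by simp [boundary])
  simp only [sl_mul_apply, sl_inv_zero_zero, sl_inv_zero_one, sl_inv_one_zero, sl_inv_one_one,
    S_00, S_01, S_10, S_11, T_00, T_01, T_10, T_11] at hS hT
  -- This is `g ∞`. The vertical sides place it in `[0, 1]`, and if it lay strictly under a side,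
  -- that side would be violated.
  set q : ℚ := (g 0 0 : ℚ) / g 1 0 with hq
  have h0' : (g 1 0 : ℚ) ≠ 0 := by exact_mod_cast h0
  have hsq : (0 : ℚ) < (g 1 0 : ℚ) ^ 2 := by positivity
  have hqg : (g 0 0 : ℚ) = q * g 1 0 := by rw [hq]; field_simp
  have hS' : (0 : ℚ) ≤ g 0 0 * g 1 0 := by
    have : 0 ≤ g 0 0 * g 1 0 := by linarith
    exact_mod_cast this
  have hT' : ((g 0 0 : ℚ) - g 1 0) * g 1 0 ≤ 0 := by
    have : (g 0 0 - g 1 0) * g 1 0 ≤ 0 := by linarith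
    exact_mod_cast this
  rw [hqg] at hS' hT'
  have hq0 : 0 ≤ q := by
    by_contra! hneg
    nlinarith
  have hq1 : q ≤ 1 := by
    by_contra! hneg
    nlinarith
  have hdvd : g 1 0 ∣ (q.den : ℤ) := by
    have e : q.num * g 1 0 = g 0 0 * q.den := by
      have : (q.num : ℚ) * g 1 0 = g 0 0 * q.den := by
        rw [hqg, ← Rat.mul_den_eq_num q]; ring
      exact_mod_cast this
    have hc : IsCoprime (g 1 0) (g 0 0) := ⟨-g 0 1, g 1 1, by linarith [sl_det g]⟩
    exact hc.dvd_of_dvd_mul_left ⟨q.num, by rw [← e]; ring⟩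
  rcases F.cusp_or_between hq0 hq1 with ⟨i, hi⟩ | ⟨i, h1, h2⟩
  · exact ⟨i, by rw [denom, hi]; exact hdvd⟩
  · exfalso
    have hX := key (F.sideMat i) (by simp [boundary])
    simp only [sl_mul_apply, sl_inv_zero_zero, sl_inv_zero_one, sl_inv_one_zero, sl_inv_one_one,
      sideMat_00, sideMat_01, sideMat_10, sideMat_11, denom] at hX
    have hX' : (((F.cusp i.castSucc).den : ℚ) * g 0 0 + -(F.cusp i.castSucc).num * g 1 0) *
        (-((F.cusp i.succ).den : ℚ) * g 0 0 + (F.cusp i.succ).num * g 1 0) ≤ 0 := by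
      exact_mod_cast hX
    rw [hqg, ← Rat.mul_den_eq_num (F.cusp i.castSucc), ← Rat.mul_den_eq_num (F.cusp i.succ)] at hX'
    have p1 : (0 : ℚ) < (F.cusp i.castSucc).den := by exact_mod_cast (F.cusp i.castSucc).den_pos
    have p2 : (0 : ℚ) < (F.cusp i.succ).den := by exact_mod_cast (F.cusp i.succ).den_pos
    have := mul_pos (mul_pos (mul_pos p1 p2) hsq) (mul_pos (sub_pos.2 h1) (sub_pos.2 h2))
    linarith

@[simp] theorem region_empty : F.region ∅ = F.idealPolygon := by simp [region]

end FareyPolygon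

/-- A rotation of order three in `Γ₀(N)` would fix a coset, which is impossible for even `N`. -/
theorem SpecialPolygon.odd_eq_empty {N : ℕ} (hN : 2 ∣ N) (P : SpecialPolygon N) : P.odd = ∅ := by
  rw [Finset.eq_empty_iff_forall_notMem]
  intro i hi
  have h : SameCoset N (P.sideMat i * R ^ 1) (P.sideMat i) := by
    rw [pow_one]; exact P.rot_mem i hi
  have := not_sameCoset_mul_R hN _ h.symm
  omega

/-- Every special polygon of `Γ₀(2ⁿ)` has a cusp equivalent to `1 / 2ⁿ⁻¹`. -/
theorem SpecialPolygon.exists_le_denom {n : ℕ} (hn : 2 ≤ n) (P : SpecialPolygon (2 ^ n)) :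
    ∃ j, 2 ^ (n - 1) ≤ P.denom j := by
  -- `A` maps `∞` to `1 / 2ⁿ⁻¹`. Moving `A • i` into the polygon makes the image of `∞` under `γ *
  -- A` one of its cusps, unless it is `∞`.
  let A : SL(2, ℤ) := ⟨!![1, 0; 2 ^ (n - 1), 1], by simp [Matrix.det_fin_two]⟩
  have hA : A 1 0 = 2 ^ (n - 1) ∧ A 0 0 = 1 := ⟨rfl, rfl⟩
  obtain ⟨γ, hγ, hmem⟩ := P.fundamental.2.1 (A • UpperHalfPlane.I)
  rw [P.odd_eq_empty (dvd_pow_self 2 (by omega)), P.region_empty, ← mul_smul] at hmem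
  have hγ' := mem_Gamma0_iff.1 hγ
  push_cast at hγ'
  have hg : (γ * A) 1 0 = γ 1 0 + γ 1 1 * 2 ^ (n - 1) := by rw [sl_mul_apply, hA.1, hA.2, mul_one]
  rw [two_pow_eq hn] at hγ'
  have hdvd : (2 ^ (n - 1) : ℤ) ∣ (γ * A) 1 0 := by
    rw [hg]; exact dvd_add ((dvd_mul_left _ _).trans hγ') (dvd_mul_left _ _)
  -- The image of the cusp is not `∞`: otherwise both entries of the bottom row of `γ` would be
  -- even.
  have hne : (γ * A) 1 0 ≠ 0 := by
    intro h
    have h2 : (2 : ℤ) * 2 ^ (n - 1) ∣ γ 1 1 * 2 ^ (n - 1) := by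
      have : γ 1 1 * 2 ^ (n - 1) = -γ 1 0 := by linarith
      rw [this]; exact hγ'.neg_right
    exact sl_row_odd γ ⟨(dvd_mul_right _ _).trans hγ',
      Int.dvd_of_mul_dvd_mul_right (by positivity) h2⟩
  obtain ⟨j, hj⟩ := P.exists_dvd_denom hmem hne
  refine ⟨j, ?_⟩
  have := Int.le_of_dvd (by exact_mod_cast P.denom_pos j) (hdvd.trans hj)
  exact_mod_cast this

/-! ### The special polygon of a complete dissection -/

/-- A dissection whose triangles are a fundamental set for `Γ₀(2ⁿ)`, with the bounds on the
denominators that single out the polygon of the theorem. -/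
structure IsCompleteDissection (n : ℕ) (l : List SL(2, ℤ)) (t : Finset SL(2, ℤ)) : Prop where
  dissection : Dissection l t
  inequivalent : Inequivalent (2 ^ n) t
  le : ∀ X ∈ l, X 1 0 ≤ (2 ^ (n - 1) : ℤ) ∧ X 1 1 ≤ (2 ^ (n - 1) : ℤ)
  large : ∀ X ∈ l, (2 ^ n : ℤ) < (X 1 0 + X 1 1) ^ 2
  represented : ∀ X ∈ l, Represented (2 ^ n) t X

theorem exists_isCompleteDissection {n : ℕ} (hn : 2 ≤ n) : ∃ l t, IsCompleteDissection n l t := by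
  obtain ⟨l, t, hd, ht, hle, hl, hmax⟩ := Dissection.exists_maximal_dissection hn
  exact ⟨l, t, hd, ht, fun X hX => hd.side_le (one_le_pow₀ (by norm_num)) hle hX, hl,
    hd.represented_of_maximal hn ht hl hmax⟩

namespace IsCompleteDissection

variable {n : ℕ} {l : List SL(2, ℤ)} {t : Finset SL(2, ℤ)}

/-- The Farey polygon formed by the triangles of a complete dissection. -/
def farey (h : IsCompleteDissection n l t) : FareyPolygon := h.dissection.fareyPolygon

theorem sideMat_mem (h : IsCompleteDissection n l t) (i : Fin h.farey.m) : h.farey.sideMat i ∈ l := h.dissection.sideMat_mem i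

theorem exists_sideMat_eq (h : IsCompleteDissection n l t) {X : SL(2, ℤ)} (hX : X ∈ l) :
    ∃ i, h.farey.sideMat i = X := h.dissection.exists_sideMat_eq hX

theorem existsUnique_isPaired (h : IsCompleteDissection n l t) (hn : 2 ≤ n) (i : Fin h.farey.m) : ∃! j, h.farey.IsPaired (2 ^ n) i j := by
  have h2 : 2 ∣ 2 ^ n := dvd_pow_self 2 (by omega)
  have hlt : ∀ X ∈ l, X 1 0 < ((2 ^ n : ℕ) : ℤ) ∧ X 1 1 < ((2 ^ n : ℕ) : ℤ) := by
    intro X hX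
    have h1 := h.le X hX
    have h3 : (0 : ℤ) < 2 ^ (n - 1) := by positivity
    push_cast
    rw [two_pow_eq hn]
    omega
  obtain ⟨Y, hY, hYX⟩ := h.dissection.exists_partner h2 h.inequivalent hlt h.represented
    (h.sideMat_mem i)
  obtain ⟨j, rfl⟩ := h.exists_sideMat_eq hY
  refine ⟨j, h.farey.isPaired_iff.2 hYX, fun k hk => ?_⟩
  exact h.dissection.sideMat_injective (h.dissection.partner_unique h2 h.inequivalent
    (h.sideMat_mem k) hY ((h.farey.isPaired_iff.1 hk).trans hYX.symm))

/-- The pairing of the sides. -/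
noncomputable def pair (h : IsCompleteDissection n l t) (hn : 2 ≤ n) (i : Fin h.farey.m) : Fin h.farey.m := (h.existsUnique_isPaired hn i).choose

theorem isPaired_pair (h : IsCompleteDissection n l t) (hn : 2 ≤ n) (i : Fin h.farey.m) : h.farey.IsPaired (2 ^ n) i (h.pair hn i) :=
  (h.existsUnique_isPaired hn i).choose_spec.1

theorem eq_pair (h : IsCompleteDissection n l t) (hn : 2 ≤ n) {i j : Fin h.farey.m} (hij : h.farey.IsPaired (2 ^ n) i j) : j = h.pair hn i :=
  (h.existsUnique_isPaired hn i).choose_spec.2 j hij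

theorem pair_pair (h : IsCompleteDissection n l t) (hn : 2 ≤ n) (i : Fin h.farey.m) : h.pair hn (h.pair hn i) = i :=
  (h.eq_pair hn (h.isPaired_pair hn i).symm).symm

/-- A sum of two squares divisible by four has both terms even, which coprime denominators exclude.
So all side pairings join two different sides. -/
theorem pair_ne (h : IsCompleteDissection n l t) (hn : 2 ≤ n) (i : Fin h.farey.m) : h.pair hn i ≠ i := by
  intro hi
  have h1 := h.isPaired_pair hn i
  rw [hi] at h1
  have h4 : (4 : ℤ) ∣ (h.farey.denom i.castSucc) ^ 2 + (h.farey.denom i.succ) ^ 2 := by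
    have : 4 ∣ 2 ^ n := pow_dvd_pow 2 hn
    have := this.trans h1
    zify at this
    exact this.trans (dvd_of_eq (by ring))
  have hodd := sl_row_odd (h.farey.sideMat i)
  rw [FareyPolygon.sideMat_10, FareyPolygon.sideMat_11] at hodd
  generalize (h.farey.denom i.castSucc : ℤ) = x at h4 hodd
  generalize (h.farey.denom i.succ : ℤ) = y at h4 hodd
  rcases Int.even_or_odd' x with ⟨a, rfl | rfl⟩ <;> rcases Int.even_or_odd' y with ⟨b, rfl | rfl⟩ <;>
    ring_nf at h4 hodd <;> omega

/-- The two sides that are glued by a side pairing: the first one. -/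
noncomputable def sideA (h : IsCompleteDissection n l t) (hn : 2 ≤ n) : Option {i : Fin h.farey.m // i ≤ h.pair hn i} → SL(2, ℤ)
  | none => S
  | some i => h.farey.sideMat i

/-- The two sides that are glued by a side pairing: the second one. -/
noncomputable def sideB (h : IsCompleteDissection n l t) (hn : 2 ≤ n) : Option {i : Fin h.farey.m // i ≤ h.pair hn i} → SL(2, ℤ)
  | none => T
  | some i => h.farey.sideMat (h.pair hn i)

/-- The side pairings. -/
noncomputable def generator (h : IsCompleteDissection n l t) (hn : 2 ≤ n) (i : Option {i : Fin h.farey.m // i ≤ h.pair hn i}) : ModGroup :=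
  toModGroup (glueSides (h.sideA hn i) (h.sideB hn i))

theorem ping_pong (h : IsCompleteDissection n l t) (hn : 2 ≤ n) : (∀ i, h.generator hn i ≠ 1) ∧
    ∀ x : Monoid.CoprodI (fun i => Subgroup.zpowers (h.generator hn i)), x ≠ 1 →
      ∀ p ∈ openPolygon h.farey.boundary, Monoid.CoprodI.lift
        (fun i => (Subgroup.zpowers (h.generator hn i)).subtype) x • p ∉
          openPolygon h.farey.boundary := by
  have hS : ∀ i, h.farey.sideMat i ∈ h.farey.boundary := fun i => by simp [FareyPolygon.boundary]
  have hsides : ∀ {i j}, i ≠ j → SidesApart (h.farey.sideMat i) (h.farey.sideMat j) :=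
    fun hij => h.dissection.sidesApart_sideMat hij
  have hA : ∀ i, SidesApart S (h.farey.sideMat i) := fun i =>
    h.dissection.sidesApart_S (h.sideMat_mem i)
  have hB : ∀ i, SidesApart T (h.farey.sideMat i) := fun i =>
    h.dissection.sidesApart_T (h.sideMat_mem i)
  refine glueSides_ping_pong ?_ ?_ ?_ ?_ ?_
  · rw [farey, h.dissection.boundary_fareyPolygon]
    exact h.dissection.openPolygon_nonempty
  · rintro (_ | i)
    · simp [sideA, FareyPolygon.boundary]
    · exact hS _
  · rintro (_ | i)
    · simp [sideB, FareyPolygon.boundary]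
    · exact hS _
  · rintro (_ | i)
    · exact h.dissection.sidesApart_S_T
    · exact hsides (h.pair_ne hn i.1).symm
  · rintro (_ | ⟨i, hi⟩) (_ | ⟨j, hj⟩) hij
    · exact absurd rfl hij
    · exact ⟨hA _, hA _, hB _, hB _⟩
    · exact ⟨(hA _).symm, (hB _).symm, (hA _).symm, (hB _).symm⟩
    · have hij' : i ≠ j := by rintro rfl; exact hij rfl
      refine ⟨hsides hij', hsides ?_, hsides ?_, hsides ?_⟩
      · rintro rfl
        rw [h.pair_pair hn] at hi
        exact hij' (le_antisymm hi hj)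
      · rintro rfl
        rw [h.pair_pair hn] at hj
        exact hij' (le_antisymm hi hj)
      · intro he
        have := congrArg (h.pair hn) he
        rw [h.pair_pair hn, h.pair_pair hn] at this
        exact hij' this

/-- Covering by the generated group suffices. For `g` in `Γ₀(N)` some generated `γ` brings `γ g` to
an edge `M R ^ k` in the coset of `1`; inequivalence forces `M = 1` and `3 ∣ k`, so `g = γ⁻¹` up to
sign. -/
theorem range_lift_generator (h : IsCompleteDissection n l t) (hn : 2 ≤ n) :
    (Monoid.CoprodI.lift fun i => (Subgroup.zpowers (h.generator hn i)).subtype :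
      Monoid.CoprodI (fun i => Subgroup.zpowers (h.generator hn i)) →* ModGroup).range =
        gammaZero (2 ^ n) := by
  set f : Monoid.CoprodI (fun i => Subgroup.zpowers (h.generator hn i)) →* ModGroup :=
    Monoid.CoprodI.lift fun i => (Subgroup.zpowers (h.generator hn i)).subtype with hf
  have hgen : ∀ i, h.generator hn i ∈ f.range := fun i =>
    ⟨Monoid.CoprodI.of (⟨h.generator hn i, Subgroup.mem_zpowers _⟩ :
      Subgroup.zpowers (h.generator hn i)), by rw [hf, Monoid.CoprodI.lift_of]; rfl⟩
  have hle : f.range ≤ gammaZero (2 ^ n) := by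
    refine Monoid.CoprodI.lift_range_le _ _ fun i => ?_
    rw [Subgroup.range_subtype, Subgroup.zpowers_le]
    refine ⟨_, ?_, rfl⟩
    rcases i with _ | i
    · change T * S * S⁻¹ ∈ Gamma0 (2 ^ n)
      rw [mul_inv_cancel_right, mem_Gamma0_iff]
      simp
    · exact FareyPolygon.glue_mem_iff _ |>.2 (h.isPaired_pair hn i.1)
  refine le_antisymm hle ?_
  have hneg : toModGroup (-1) = 1 := toModGroup_eq_one_iff.2 (Or.inr rfl)
  have hneg1 : (-1 : SL(2, ℤ)) ∈ f.range.comap toModGroup := by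
    rw [Subgroup.mem_comap, hneg]; exact one_mem _
  have hT : T ∈ f.range.comap toModGroup := by
    have := hgen none
    rw [generator, glueSides, sideA, sideB, mul_inv_cancel_right] at this
    exact this
  have hpair : ∀ X ∈ l, ∃ Y ∈ l, Y * S * X⁻¹ ∈ f.range.comap toModGroup := by
    intro X hX
    obtain ⟨i, rfl⟩ := h.exists_sideMat_eq hX
    refine ⟨_, h.sideMat_mem (h.pair hn i), ?_⟩
    rcases le_total i (h.pair hn i) with hi | hi
    · exact hgen (some ⟨i, hi⟩)
    · have h1 := hgen (some ⟨h.pair hn i, by rwa [h.pair_pair hn]⟩)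
      rw [generator, sideA, sideB] at h1
      simp only [h.pair_pair hn] at h1
      have h2 := inv_mem h1
      rw [← map_inv, glueSides_inv, ← neg_one_mul, map_mul, hneg, one_mul] at h2
      exact h2
  rintro _ ⟨g, hg, rfl⟩
  obtain ⟨γ, hγ, M, hM, k, hk⟩ := h.dissection.reachedBy hneg1 hT hpair g
  have hγ0 : γ ∈ Gamma0 (2 ^ n) := by
    obtain ⟨δ, hδ, hδγ⟩ := hle hγ
    have : toModGroup (δ⁻¹ * γ) = 1 := by rw [map_mul, map_inv, hδγ, inv_mul_cancel]
    rcases toModGroup_eq_one_iff.1 this with h1 | h1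
    · rw [← inv_mul_eq_one.1 h1]; exact hδ
    · rw [inv_mul_eq_iff_eq_mul] at h1
      rw [h1]
      refine mul_mem hδ ?_
      rw [mem_Gamma0_iff]; simp [neg_apply_sl]
  have hco : SameCoset (2 ^ n) (1 * R ^ 0) (M * R ^ (k % 3)) := by
    rw [← SameCoset.mul_R_pow_mod_iff, ← hk, pow_zero, mul_one, SameCoset, one_mul, inv_mem_iff]
    exact mul_mem hγ0 hg
  obtain ⟨rfl, h0⟩ := h.inequivalent.eq_and_eq (dvd_pow_self 2 (by omega)) h.dissection.one_mem hM
    (by norm_num) (Nat.mod_lt k (by norm_num)) hco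
  have hR : toModGroup (R ^ k) = 1 := by
    rw [← Nat.mod_add_div k 3, ← h0, zero_add, pow_mul, R_cube, map_pow, hneg, one_pow]
  have : toModGroup g = (toModGroup γ)⁻¹ :=
    eq_inv_of_mul_eq_one_right (by rw [← map_mul, hk, one_mul, hR])
  rw [this]
  exact inv_mem hγ

theorem isIndependentGenerators (h : IsCompleteDissection n l t) (hn : 2 ≤ n) :
    IsIndependentGenerators (h.generator hn) (gammaZero (2 ^ n)) := by
  obtain ⟨h1, h2⟩ := h.ping_pong hn
  refine ⟨h1, ?_, h.range_lift_generator hn⟩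
  rw [injective_iff_map_eq_one]
  intro x hx
  by_contra hne
  have hP : (openPolygon h.farey.boundary).Nonempty := by
    rw [farey, h.dissection.boundary_fareyPolygon]
    exact h.dissection.openPolygon_nonempty
  obtain ⟨p, hp⟩ := hP
  have := h2 x hne p hp
  rw [hx, one_smul] at this
  exact this hp

theorem isFundamentalRegion (h : IsCompleteDissection n l t) (hn : 2 ≤ n) :
    IsFundamentalRegion (Gamma0 (2 ^ n)) h.farey.idealPolygon := by
  rw [h.farey.idealPolygon_eq]
  refine ⟨isClosed_closedPolygon _, fun z => ?_, fun γ hγ h1 h2 z hz hγz => ?_⟩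
  · rw [farey, h.dissection.boundary_fareyPolygon]
    refine h.dissection.exists_smul_mem_closedPolygon ?_ ?_ ?_ z
    · rw [mem_Gamma0_iff]; simp [neg_apply_sl]
    · rw [mem_Gamma0_iff]; simp
    · intro X hX
      obtain ⟨i, rfl⟩ := h.exists_sideMat_eq hX
      exact ⟨_, h.sideMat_mem (h.pair hn i), h.farey.isPaired_iff.1 (h.isPaired_pair hn i)⟩
  · have hmem : toModGroup γ ∈ gammaZero (2 ^ n) := ⟨γ, hγ, rfl⟩
    rw [← h.range_lift_generator hn] at hmem
    obtain ⟨x, hx⟩ := hmem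
    have hx1 : x ≠ 1 := by
      rintro rfl
      rw [map_one] at hx
      exact (toModGroup_eq_one_iff.1 hx.symm).elim h1 h2
    have := (h.ping_pong hn).2 x hx1 z (interior_closedPolygon_subset _ hz)
    rw [hx, toModGroup_smul] at this
    exact this (interior_closedPolygon_subset _ hγz)

/-- The special polygon of a complete dissection. -/
noncomputable def specialPolygon (h : IsCompleteDissection n l t) (hn : 2 ≤ n) : SpecialPolygon (2 ^ n) where
  toFareyPolygon := h.farey
  pair := h.pair hn
  pair_pair := h.pair_pair hn
  odd := ∅
  pair_odd := by simp
  glue_mem i _ := h.farey.glue_mem_iff.2 (h.isPaired_pair hn i)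
  rot_mem := by simp
  fundamental := by rw [FareyPolygon.region_empty]; exact h.isFundamentalRegion hn

theorem sidePairings_specialPolygon (h : IsCompleteDissection n l t) (hn : 2 ≤ n) : (h.specialPolygon hn).sidePairings = h.generator hn := by
  funext i
  rcases i with _ | i
  · change toModGroup T = toModGroup (T * S * S⁻¹)
    rw [mul_inv_cancel_right]
  · change toModGroup ((h.specialPolygon hn).sidePairing i.1) = _
    have hi : i.1 ∉ (h.specialPolygon hn).odd := Finset.notMem_empty _
    rw [SpecialPolygon.sidePairing, if_neg hi]
    rfl

theorem represented_all (h : IsCompleteDissection n l t) (hn : 2 ≤ n) (g : SL(2, ℤ)) : Represented (2 ^ n) t g := by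
  obtain ⟨γ, hγ, M, hM, k, hk⟩ := h.dissection.reachedBy (H := Gamma0 (2 ^ n)) (by
      rw [mem_Gamma0_iff]; simp [neg_apply_sl]) (by rw [mem_Gamma0_iff]; simp) (by
      intro X hX
      obtain ⟨i, rfl⟩ := h.exists_sideMat_eq hX
      exact ⟨_, h.sideMat_mem (h.pair hn i), h.farey.isPaired_iff.1 (h.isPaired_pair hn i)⟩) g
  refine ⟨M, hM, k, ?_⟩
  rw [← hk, SameCoset, mul_inv_rev, mul_inv_cancel_left, inv_mem_iff]
  exact hγ

/-- The three oriented edges of each triangle represent every coset exactly once. -/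
theorem index_eq (h : IsCompleteDissection n l t) (hn : 2 ≤ n) : (Gamma0 (2 ^ n)).index = t.card * 3 := by
  have hcard : Nat.card (t × Fin 3) = t.card * 3 := by simp
  rw [← hcard, Subgroup.index]
  symm
  refine Nat.card_eq_of_bijective
    (fun x : t × Fin 3 => (QuotientGroup.mk ((x.1 * R ^ (x.2 : ℕ))⁻¹) : SL(2, ℤ) ⧸ Gamma0 (2 ^ n)))
    ⟨?_, ?_⟩
  · rintro ⟨⟨M, hM⟩, j⟩ ⟨⟨M', hM'⟩, k⟩ hx
    have hx' := QuotientGroup.eq.1 hx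
    rw [inv_inv] at hx'
    obtain ⟨rfl, hjk⟩ := h.inequivalent.eq_and_eq (dvd_pow_self 2 (by omega)) hM hM' j.2 k.2 hx'
    rw [Fin.ext hjk]
  · intro x
    obtain ⟨g, rfl⟩ := QuotientGroup.mk_surjective x
    obtain ⟨M, hM, k, hk⟩ := h.represented_all hn g⁻¹
    rw [SameCoset.mul_R_pow_mod_iff] at hk
    refine ⟨⟨⟨M, hM⟩, ⟨k % 3, Nat.mod_lt _ (by norm_num)⟩⟩, ?_⟩
    rw [QuotientGroup.eq, inv_inv]
    have := hk.symm
    rwa [SameCoset, inv_inv] at this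

theorem isFareySequenceOf (h : IsCompleteDissection n l t) (hn : 2 ≤ n) : h.farey.IsFareySequenceOf (2 ^ n) := by
  refine ⟨fun q h0 h1 hq => ?_, ?_, fun i _ => h.existsUnique_isPaired hn i⟩
  -- A fraction under a side has denominator at least the sum of the two end denominators, which
  -- exceeds `√N`.
  · refine (h.farey.cusp_or_between h0 h1).resolve_right ?_
    rintro ⟨i, hi1, hi2⟩
    have h2 := h.farey.denom_add_denom_le hi1 hi2
    have h3 := h.large _ (h.sideMat_mem i)
    rw [FareyPolygon.sideMat_10, FareyPolygon.sideMat_11] at h3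
    have h3' : 2 ^ n < (h.farey.denom i.succ + h.farey.denom i.castSucc) ^ 2 := by exact_mod_cast h3
    rw [Nat.le_sqrt'] at hq
    have := Nat.pow_le_pow_left h2 2
    rw [add_comm] at this
    omega
  · rw [index_eq h hn, Nat.mul_div_cancel _ (by norm_num), add_comm]
    exact congrArg (1 + ·) h.dissection.length_eq_card

theorem denom_le (h : IsCompleteDissection n l t) (i : Fin (h.farey.m + 1)) : h.farey.denom i ≤ 2 ^ (n - 1) := by
  induction i using Fin.cases with
  | zero =>
    rw [FareyPolygon.denom, h.farey.cusp_first]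
    exact Nat.one_le_two_pow
  | succ i =>
    have := (h.le _ (h.sideMat_mem i)).1
    rw [FareyPolygon.sideMat_10] at this
    exact_mod_cast this

/-- Sides ending at a cusp with denominator `2ⁿ⁻¹` begin at one with odd denominator. Two odd
multiples of `2ⁿ⁻¹` agree modulo `2ⁿ`, so the reversed sides lie in one coset and the sides
coincide. -/
theorem denom_injOn (h : IsCompleteDissection n l t) (hn : 2 ≤ n) {i j : Fin (h.farey.m + 1)} (hi : h.farey.denom i = 2 ^ (n - 1))
    (hj : h.farey.denom j = 2 ^ (n - 1)) : i = j := by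
  have h0 : h.farey.denom 0 ≠ 2 ^ (n - 1) := by
    rw [FareyPolygon.denom, h.farey.cusp_first]
    exact (Nat.one_lt_two_pow (by omega)).ne
  have hodd : ∀ k : Fin h.farey.m, h.farey.denom k.succ = 2 ^ (n - 1) →
      ¬ (2 : ℤ) ∣ h.farey.denom k.castSucc := by
    intro k hk h2
    refine sl_row_odd (h.farey.sideMat k) ⟨?_, h2⟩
    rw [FareyPolygon.sideMat_10, hk]
    push_cast
    exact dvd_pow_self 2 (by omega)
  induction i using Fin.cases with
  | zero => exact absurd hi h0
  | succ i =>
    induction j using Fin.cases with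
    | zero => exact absurd hj h0
    | succ j =>
      rw [Fin.succ_inj]
      refine h.dissection.sideMat_injective (h.dissection.partner_unique
        (dvd_pow_self 2 (by omega : n ≠ 0)) h.inequivalent (h.sideMat_mem i) (h.sideMat_mem j) ?_)
      rw [SameCoset.iff_dvd, (sl_S_row _).1, (sl_S_row _).2, (sl_S_row _).1, (sl_S_row _).2]
      change _ ∣ (h.farey.denom i.castSucc : ℤ) * -(h.farey.denom j.succ : ℤ) -
        -(h.farey.denom i.succ : ℤ) * (h.farey.denom j.castSucc : ℤ)
      rw [hi, hj]
      push_cast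
      obtain ⟨c, hc⟩ : (2 : ℤ) ∣ h.farey.denom j.castSucc - h.farey.denom i.castSucc := by
        have := hodd i hi
        have := hodd j hj
        omega
      exact ⟨c, by rw [two_pow_eq hn]; linear_combination (2 : ℤ) ^ (n - 1) * hc⟩

end IsCompleteDissection

theorem theorem1p1 (n : ℕ) (hn : 2 ≤ n) :
    (∃ P : SpecialPolygon (2 ^ n),
      P.IsFareySequenceOf (2 ^ n) ∧
      (∀ i, P.denom i ≤ 2 ^ (n - 1)) ∧
      (∃! j, P.denom j = 2 ^ (n - 1)) ∧
      IsIndependentGenerators P.sidePairings (gammaZero (2 ^ n)) ∧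
      (∀ Q : SpecialPolygon (2 ^ n), Q.denomList = P.denomList → Q.cuspList = P.cuspList)) ∧
    (∀ Q : SpecialPolygon (2 ^ n), ∃ j, 2 ^ (n - 1) ≤ Q.denom j) := by
  refine ⟨?_, fun Q => Q.exists_le_denom hn⟩
  obtain ⟨l, t, h⟩ := exists_isCompleteDissection hn
  refine ⟨h.specialPolygon hn, h.isFareySequenceOf hn, h.denom_le, ?_, ?_,
    fun Q hQ => FareyPolygon.cuspList_eq_of_denomList_eq hQ⟩
  · obtain ⟨j, hj⟩ := (h.specialPolygon hn).exists_le_denom hn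
    have hj' := le_antisymm (h.denom_le j) hj
    exact ⟨j, hj', fun k hk => h.denom_injOn hn hk hj'⟩
  · rw [h.sidePairings_specialPolygon hn]
    exact h.isIndependentGenerators hn
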